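/- Let $K$ be an algebraically closed field of characteristic $0$ and let $\alpha\in K$ with $\alpha\neq 0$. Let $\mathcal D_4(\alpha,\alpha)$ be the $K$-algebra generated by $x_{ij}=-x_{ji}$ ($1\le i\ne j\le 4$) subject to $x_{ij}^2=\alpha$ and $x_{ij}x_{jk}+x_{jk}x_{ki}+x_{ki}x_{ij}=\alpha$ for distinct $i,j,k$ (resp. $i,j$), and $x_{ij}x_{kl}=x_{kl}x_{ij}$ for distinct $i,j,k,l$. Let $B$ be a basic finite-dimensional $K$-algebra (that is, $B/\mathrm{rad}\,B$ is isomorphic to a finite product of copies of $K$) that is Morita equivalent to $\mathcal D_4(\alpha,\alpha)$ over $K$. Let $e\in B$ be a primitive idempotent, let $\Gamma=eB$ be the corresponding indecomposable projective right $B$-module, and let $\mathrm{gr}\,\Gamma=\bigoplus_{n\ge 0} e\,(\mathrm{rad}\,B)^n/e\,(\mathrm{rad}\,B)^{n+1}$ be the associated graded object for the radical filtration. Let $Q$ be the quiver whose vertices are the elements of the symmetric group $\mathbb S_3$ on three letters and which has, for every vertex $\sigma$, three arrows $\beta_1(\sigma),\beta_3(\sigma)\colon\sigma\to\sigma\,(1\,2)$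 and $\beta_2(\sigma)\colon\sigma\to\sigma\,(2\,3)$. Then $Q$ can be realised as the ordinary quiver of $B$ with $e$ at the vertex $1$: there are a complete system of orthogonal primitive idempotents $(e_\sigma)_{\sigma\in\mathbb S_3}$ of $B$ with $e_1=e$, and for each arrow $\beta_i(\sigma)\colon\sigma\to\tau$ of $Q$ an element of $e_\sigma(\mathrm{rad}\,B)e_\tau$, again denoted by $\beta_i(\sigma)$, such that the classes of these elements form a basis of $\mathrm{rad}\,B/(\mathrm{rad}\,B)^2$. Moreover, they can be chosen so that, when the paths of $Q$ starting at the vertex $1$ are identified with the words in $s_1,s_2,s_3$ (a path corresponds to the sequence of labels of its arrows, read in the order of travel), mapping a word of length $n$ to the class in $e(\mathrm{rad}\,B)^n/e(\mathrm{rad}\,B)^{n+1}$ of the product of the arrows of its path (the class of $e$ for $n=0$) induces an isomorphism of $K$-vector spaces $$K\langle s_1,s_2,s_3\rangle/I\;\cong\;\mathrm{gr}\,\Gamma,$$ where $I$ is the two-sided ideal generated by $$s_1^2,\quad s_2^2,\quad s_3^2,\quad s_1s_3-s_3s_1,\quad s_2s_1s_2-s_1s_2s_3-s_3s_2s_1,\quad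 s_2s_3s_2-s_1s_2s_1+s_3s_2s_3 .$$ In other words, the kernel of the resulting surjection $K\langle s_1,s_2,s_3\rangle\to\mathrm{gr}\,\Gamma$ is exactly $I$; in particular the isomorphism is graded and $\mathrm{gr}\,\Gamma$ inherits the algebra structure of $K\langle s_1,s_2,s_3\rangle/I$, multiplication being composition of labelled paths. -/

import Mathlib

open scoped DirectSum

universe u

noncomputable section

/-! ### Deformed Fomin–Kirillov algebras -/

namespace DeformedFK

/-- The defining relations of the deformed Fomin–Kirillov algebra, imposed on the free algebra on
letters `x i j`.  The letters `x i i`, which are not generators in the mathematical definition,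
are set to zero. -/
inductive Rel (K : Type*) [Field K] (n : ℕ) (α₁ α₂ : K) :
    FreeAlgebra K (Fin n × Fin n) → FreeAlgebra K (Fin n × Fin n) → Prop
  | diag (i : Fin n) : Rel K n α₁ α₂ (FreeAlgebra.ι K (i, i)) 0
  | antisymm (i j : Fin n) (hij : i ≠ j) :
      Rel K n α₁ α₂ (FreeAlgebra.ι K (i, j)) (-FreeAlgebra.ι K (j, i))
  | sq (i j : Fin n) (hij : i ≠ j) :
      Rel K n α₁ α₂ (FreeAlgebra.ι K (i, j) * FreeAlgebra.ι K (i, j))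
        (algebraMap K _ α₁)
  | comm (i j k l : Fin n) (hij : i ≠ j) (hik : i ≠ k) (hil : i ≠ l)
      (hjk : j ≠ k) (hjl : j ≠ l) (hkl : k ≠ l) :
      Rel K n α₁ α₂
        (FreeAlgebra.ι K (i, j) * FreeAlgebra.ι K (k, l)
          - FreeAlgebra.ι K (k, l) * FreeAlgebra.ι K (i, j)) 0
  | cyclic (i j k : Fin n) (hij : i ≠ j) (hjk : j ≠ k) (hik : i ≠ k) :
      Rel K n α₁ α₂
        (FreeAlgebra.ι K (i, j) * FreeAlgebra.ι K (j, k)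
          + FreeAlgebra.ι K (j, k) * FreeAlgebra.ι K (k, i)
          + FreeAlgebra.ι K (k, i) * FreeAlgebra.ι K (i, j))
        (algebraMap K _ α₂)

end DeformedFK

/-- The deformed Fomin–Kirillov algebra `𝒟ₙ(α₁, α₂)` over `K`. -/
abbrev DeformedFK (K : Type*) [Field K] (n : ℕ) (α₁ α₂ : K) : Type _ :=
  RingQuot (DeformedFK.Rel K n α₁ α₂)

/-! ### Basic algebras, primitive idempotents, graded projectives -/

/-- A finite-dimensional `K`-algebra is basic if its quotient by the Jacobson radical is isomorphic
to a finite product of copies of `K`. -/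
structure IsBasicAlgebra (K B : Type*) [Field K] [Ring B] [Algebra K B] : Prop where
  finite : Module.Finite K B
  quotient : ∃ m : ℕ, Nonempty ((B ⧸ Ring.jacobson B) ≃ₐ[K] (Fin m → K))

/-- A primitive idempotent: a nonzero idempotent `e` such that the only idempotents `f` with
`e * f = f = f * e` are `0` and `e`.  Equivalently, `e B` is an indecomposable projective right
`B`-module. -/
structure IsPrimitiveIdempotent {B : Type*} [Ring B] (e : B) : Prop where
  idem : IsIdempotentElem e
  ne_zero : e ≠ 0
  eq_or_eq : ∀ f : B, IsIdempotentElem f → e * f = f → f * e = f → f = 0 ∨ f = e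

/-- The `n`-th step `Γ · rad(B)ⁿ = e · rad(B)ⁿ` of the radical filtration of the right `B`-module
`Γ = e B`. -/
def projFiltration (K : Type*) {B : Type*} [Field K] [Ring B] [Algebra K B] (e : B) (n : ℕ) :
    Submodule K B :=
  ((Ring.jacobson B ^ n).restrictScalars K).map (LinearMap.mulLeft K e)

/-- The homogeneous component `Γ rad(B)ⁿ / Γ rad(B)ⁿ⁺¹` of `gr Γ`, where `Γ = e B`. -/
abbrev GrProjPiece (K : Type*) {B : Type*} [Field K] [Ring B] [Algebra K B] (e : B) (n : ℕ) :
    Type _ :=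
  projFiltration K e n ⧸ (projFiltration K e (n + 1)).submoduleOf (projFiltration K e n)

/-- `gr Γ = ⨁ₙ Γ rad(B)ⁿ / Γ rad(B)ⁿ⁺¹` for the right `B`-module `Γ = e B`. -/
abbrev GrProj (K : Type*) {B : Type*} [Field K] [Ring B] [Algebra K B] (e : B) : Type _ :=
  ⨁ n : ℕ, GrProjPiece K e n

/-- The class in degree `n` of `gr (e B)` of an element `x` of `e · rad(B)ⁿ`. -/
def grClass (K : Type*) {B : Type*} [Field K] [Ring B] [Algebra K B] (e : B) (n : ℕ) (x : B)
    (hx : x ∈ projFiltration K e n) : GrProj K e :=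
  DirectSum.of (fun n => GrProjPiece K e n) n (Submodule.Quotient.mk ⟨x, hx⟩)

/-! ### The quiver and its realisation in an algebra -/

/-- The quiver has the elements of the symmetric group on three letters as vertices, and for each
vertex `σ` three arrows `β₁(σ), β₂(σ), β₃(σ)` (indexed by `0, 1, 2`) starting in `σ`; the arrow
`βᵢ(σ)` ends in `σ * arrowStep i`.  Hence `β₁, β₃` are parallel. -/
def arrowStep : Fin 3 → Equiv.Perm (Fin 3) :=
  ![Equiv.swap 0 1, Equiv.swap 1 2, Equiv.swap 0 1]

/-- A realisation of the quiver as the ordinary quiver of `B`, with the given idempotent `e` at the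
vertex `1`: a complete system of orthogonal primitive idempotents of `B` indexed by the vertices,
and for each arrow `σ ⟶ τ` an element of `e_σ rad(B) e_τ`, such that the classes of these elements
form a basis of `rad(B) / rad(B)²`. -/
structure QuiverRealization (K : Type*) {B : Type*} [Field K] [Ring B] [Algebra K B] (e : B) where
  idem : Equiv.Perm (Fin 3) → B
  complete : CompleteOrthogonalIdempotents idem
  primitive : ∀ σ, IsPrimitiveIdempotent (idem σ)
  idem_one : idem 1 = e
  arrow : Fin 3 → Equiv.Perm (Fin 3) → B
  arrow_mem : ∀ i σ, arrow i σ ∈ Ring.jacobson B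
  idem_mul_arrow : ∀ i σ, idem σ * arrow i σ = arrow i σ
  arrow_mul_idem : ∀ i σ, arrow i σ * idem (σ * arrowStep i) = arrow i σ
  /-- The classes of the three arrows starting in `σ` form a basis of
  `e_σ rad(B) / e_σ rad(B)²`. -/
  basis : ∀ σ, ∀ x ∈ Ring.jacobson B,
    ∃! c : Fin 3 → K, idem σ * x - ∑ i, c i • arrow i σ ∈ Ring.jacobson B ^ 2

namespace QuiverRealization

variable {K B : Type*} [Field K] [Ring B] [Algebra K B] {e : B}

/-- The value in `B` of the path that starts in `σ` and whose arrows are labelled, in this order,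
by the letters of the word `w`; the trivial path has the value `e_σ`. -/
def path (Q : QuiverRealization K e) : Equiv.Perm (Fin 3) → List (Fin 3) → B
  | σ, [] => Q.idem σ
  | σ, i :: w => Q.arrow i σ * Q.path (σ * arrowStep i) w

theorem path_mem_pow (Q : QuiverRealization K e) (σ : Equiv.Perm (Fin 3)) (w : List (Fin 3)) :
    Q.path σ w ∈ Ring.jacobson B ^ w.length := by
  induction w generalizing σ with
  | nil => rw [List.length_nil, Submodule.pow_zero, Ideal.one_eq_top]; trivial
  | cons i w ih =>
    rw [List.length_cons, Ideal.IsTwoSided.pow_succ]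
    exact Ideal.mul_mem_mul (Q.arrow_mem i σ) (ih _)

theorem idem_mul_path (Q : QuiverRealization K e) (σ : Equiv.Perm (Fin 3)) (w : List (Fin 3)) :
    Q.idem σ * Q.path σ w = Q.path σ w := by
  cases w with
  | nil => exact (Q.primitive σ).idem
  | cons i w => rw [path, ← mul_assoc, Q.idem_mul_arrow]

theorem path_mem (Q : QuiverRealization K e) (w : List (Fin 3)) :
    Q.path 1 w ∈ projFiltration K e w.length :=
  ⟨Q.path 1 w, Q.path_mem_pow 1 w, by
    rw [LinearMap.mulLeft_apply]; nth_rewrite 1 [← Q.idem_one]; exact Q.idem_mul_path 1 w⟩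

end QuiverRealization

/-! ### The presented algebra -/

/-- The relations `s₁², s₂², s₃²`, `s₁s₃ - s₃s₁`, `s₂s₁s₂ - s₁s₂s₃ - s₃s₂s₁` and
`s₂s₃s₂ - s₁s₂s₁ + s₃s₂s₃` in the free algebra on `s₁, s₂, s₃`, indexed by `0, 1, 2`. -/
inductive GrRel (K : Type*) [Field K] : FreeAlgebra K (Fin 3) → FreeAlgebra K (Fin 3) → Prop
  | sq (t : Fin 3) : GrRel K (FreeAlgebra.ι K t * FreeAlgebra.ι K t) 0
  | comm : GrRel K
      (FreeAlgebra.ι K 0 * FreeAlgebra.ι K 2 - FreeAlgebra.ι K 2 * FreeAlgebra.ι K 0) 0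
  | cubic₁ : GrRel K
      (FreeAlgebra.ι K 1 * FreeAlgebra.ι K 0 * FreeAlgebra.ι K 1
        - FreeAlgebra.ι K 0 * FreeAlgebra.ι K 1 * FreeAlgebra.ι K 2
        - FreeAlgebra.ι K 2 * FreeAlgebra.ι K 1 * FreeAlgebra.ι K 0) 0
  | cubic₂ : GrRel K
      (FreeAlgebra.ι K 1 * FreeAlgebra.ι K 2 * FreeAlgebra.ι K 1
        - FreeAlgebra.ι K 0 * FreeAlgebra.ι K 1 * FreeAlgebra.ι K 0
        + FreeAlgebra.ι K 2 * FreeAlgebra.ι K 1 * FreeAlgebra.ι K 2) 0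

/-- The quotient of `K⟨s₁, s₂, s₃⟩` by the two-sided ideal generated by the relations. -/
abbrev GrPresentation (K : Type*) [Field K] : Type _ := RingQuot (GrRel K)

/-- The class in the quotient of the monomial that is the product of the letters of `w`. -/
def GrPresentation.monomial (K : Type*) [Field K] (w : List (Fin 3)) : GrPresentation K :=
  RingQuot.mkAlgHom K (GrRel K) (w.map (FreeAlgebra.ι K)).prod

end

/-! Write `A` for `GrPresentation K`. Its relations are homogeneous for the length and also for the
end point of a path, that is, for the `𝕊₃`-grading in which the letter `i` has degree `arrowStep i`.
Hence `A` has a covering algebra `C` with complete orthogonal idempotents `E σ`, where `E σ * s = s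
* E (σ * arrowStep i)` for the letter `s` with index `i`, and where `r ↦ E σ * r` identifies `A`
with each projective module `E σ * C`. Words of positive length generate a nilpotent ideal, which is
the radical of `C`. The radical filtration of `E σ * C` is therefore the length filtration of `A`,
and since `A` is graded by length, the associated graded module is `A` itself. `CoverData`
axiomatises this situation, and `CoverData.exists_quiverRealization` draws the conclusion.

It remains to see that `B` is isomorphic to `C`. The algebra `C` is basic, and Morita equivalent
basic algebras are isomorphic because projective covers are unique
(`IsBasicAlgebra.nonempty_algEquiv_of_isMoritaEquivalent`). So it suffices that `𝒟₄(α, α)` is the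
algebra of 2 × 2 matrices over `C`. With `α = r²` the generators can be rescaled to have square 1.
Explicit matrices, written in terms of the anticommuting matrices `X`, `Z` and of words, satisfy the
rescaled relations and generate the whole matrix algebra (`CoverData.ofDeformedFK_surjective`).
Finally the dimensions agree: `A` has a basis of 24 normal words (`linearIndependent_normalWord`),
so the matrix algebra has dimension 4 · 6 · 24 = 576, while a rewriting system bounds the dimension
of `𝒟₄(α, α)` by 576 (`DeformedFK.finite_and_finrank_le`).

All identities behind these steps have integer coefficients, so they are checked by evaluation,
independently of `K`. -/

section

open CategoryTheory CategoryTheory.Limits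
open scoped ModuleCat.Algebra

/-! ### Projective covers in a category -/

section EssentialEpi

variable {C D : Type*} [Category* C] [Category* D]

/-- An epimorphism through which only epimorphisms factor from the left. -/
structure IsEssentialEpi {P T : C} (π : P ⟶ T) : Prop where
  epi : Epi π
  epi_of_comp : ∀ {M : C} (g : M ⟶ P), Epi (g ≫ π) → Epi g

theorem IsEssentialEpi.comp_iso {P T T' : C} {π : P ⟶ T} (h : IsEssentialEpi π) (i : T ≅ T') :
    IsEssentialEpi (π ≫ i.hom) where
  epi := by have := h.epi; infer_instance
  epi_of_comp g hg := by
    refine h.epi_of_comp g ?_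
    have : g ≫ π = (g ≫ π ≫ i.hom) ≫ i.inv := by simp
    rw [this]; infer_instance

/-- The notion is categorical: a test morphism into the image of `P` is carried back by the inverse
functor and corrected by the unit isomorphism. -/
theorem IsEssentialEpi.map (F : C ≌ D) {P T : C} {π : P ⟶ T} (h : IsEssentialEpi π) :
    IsEssentialEpi (F.functor.map π) where
  epi := by have := h.epi; infer_instance
  epi_of_comp {M} g hg := by
    have h1 : Epi (F.inverse.map (g ≫ F.functor.map π)) := inferInstance
    have h2 : F.inverse.map (g ≫ F.functor.map π)
        = ((F.inverse.map g ≫ F.unitInv.app P) ≫ π) ≫ F.unit.app T := by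
      simp [F.inv_fun_map]
    have h3 : (F.inverse.map g ≫ F.unitInv.app P) ≫ π
        = F.inverse.map (g ≫ F.functor.map π) ≫ F.unitInv.app T := by
      rw [h2]; simp
    have h4 : Epi (F.inverse.map g ≫ F.unitInv.app P) := h.epi_of_comp _ (by
      rw [h3]; infer_instance)
    have h5 : F.inverse.map g = (F.inverse.map g ≫ F.unitInv.app P) ≫ F.unit.app P := by simp
    have h6 : Epi (F.inverse.map g) := by rw [h5]; infer_instance
    exact F.inverse.epi_of_epi_map h6

/-- Projective covers of the same object are isomorphic. -/
theorem IsEssentialEpi.nonempty_iso [Balanced C] {P P' T : C} [Projective P] [Projective P']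
    {π : P ⟶ T} {π' : P' ⟶ T} (h : IsEssentialEpi π) (h' : IsEssentialEpi π') :
    Nonempty (P ≅ P') := by
  have := h.epi
  have := h'.epi
  let f : P ⟶ P' := Projective.factorThru π π'
  have hf : f ≫ π' = π := Projective.factorThru_comp _ _
  have ef : Epi f := h'.epi_of_comp f (by rw [hf]; infer_instance)
  -- A section of `f` exists because `P'` is projective. It is an epimorphism because `s ≫ π = π'`
  -- and `π` is essential; being also a split monomorphism, it is an isomorphism.
  let s : P' ⟶ P := Projective.factorThru (𝟙 P') f
  have hs : s ≫ f = 𝟙 P' := Projective.factorThru_comp _ _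
  have es : Epi s := h.epi_of_comp s (by rw [← hf, ← Category.assoc, hs]; simpa using h'.epi)
  have ms : Mono s := by
    have : Mono (s ≫ f) := by rw [hs]; infer_instance
    exact mono_of_mono s f
  have := isIso_of_mono_of_epi s
  exact ⟨(asIso s).symm⟩

end EssentialEpi

theorem CategoryTheory.Functor.map_smul_id {K C D : Type*} [Semiring K] [Category* C] [Category* D]
    [Preadditive C] [Preadditive D] [CategoryTheory.Linear K C] [CategoryTheory.Linear K D] (F : C ⥤ D)
    [F.Linear K] (X : C)
    (k : K) : F.map (k • 𝟙 X) = k • 𝟙 (F.obj X) := by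
  rw [F.map_smul, F.map_id]

/-! ### Morita equivalence of basic algebras -/

section BasicAlgebra

variable {K : Type u} [Field K] {B : Type u} [Ring B] [Algebra K B]

/-- The simple module given by a character. -/
noncomputable def charModule (χ : B →ₐ[K] K) : ModuleCat.{u} B :=
  (ModuleCat.restrictScalars χ.toRingHom).obj (ModuleCat.of K K)

/-- The projection of the regular module onto the simple module given by a character. -/
noncomputable def charModule.proj (χ : B →ₐ[K] K) : B →ₗ[B] charModule χ where
  toFun b := (χ b : K)
  map_add' := χ.map_add
  map_smul' := χ.map_mul

theorem AlgHom.surjective_of_field (χ : B →ₐ[K] K) : Function.Surjective χ :=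
  fun k => ⟨algebraMap K B k, by simp⟩

theorem simple_charModule (χ : B →ₐ[K] K) : Simple (charModule χ) := by
  have : IsSimpleModule B (charModule χ) := by
    rw [isSimpleModule_iff_toSpanSingleton_surjective]
    refine ⟨show Nontrivial K from inferInstance, fun (x : K) (hx : x ≠ 0) (y : K) => ?_⟩
    obtain ⟨b, hb⟩ := AlgHom.surjective_of_field χ (y * x⁻¹)
    refine ⟨b, ?_⟩
    change χ b * x = y
    rw [hb, inv_mul_cancel_right₀ hx]
  exact (simple_iff_isSimpleModule (M := (charModule χ : ModuleCat B))).2 this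

/-- The scalar `χ b` acts in the same way on both modules, but agrees with `b` only on the first;
comparing the two actions on the image of 1 gives `χ b = χ' b`. -/
theorem eq_of_charModule_iso {χ χ' : B →ₐ[K] K} (i : charModule χ ≅ charModule χ') : χ = χ' := by
  let f : charModule χ ≃ₗ[B] charModule χ' := i.toLinearEquiv
  let g : K → K := f
  have key (b : B) (x : K) : g (χ b * x) = χ' b * g x := f.map_smul b x
  have h1 : g 1 ≠ 0 := by
    intro h
    have h0 : g 0 = 0 := f.map_zero
    have hinj : Function.Injective g := f.injective
    exact one_ne_zero (hinj (h.trans h0.symm))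
  ext b
  have h2 := key b 1
  have h3 := key (algebraMap K B (χ b)) 1
  simp only [AlgHom.commutes, Algebra.algebraMap_self, RingHom.id_apply, mul_one] at h2 h3
  exact mul_right_cancel₀ h1 (h3.symm.trans h2)

/-- A complete list of pairwise distinct characters of a basic algebra. -/
structure IsCharList {m : ℕ} (χ : Fin m → B →ₐ[K] K) : Prop where
  surj : ∀ v : Fin m → K, ∃ b, ∀ j, χ j b = v j
  ker : ∀ b, (∀ j, χ j b = 0) ↔ b ∈ Ring.jacobson B

theorem IsBasicAlgebra.exists_isCharList (h : IsBasicAlgebra K B) :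
    ∃ (m : ℕ) (χ : Fin m → B →ₐ[K] K), IsCharList χ := by
  obtain ⟨m, ⟨φ⟩⟩ := h.quotient
  let q : B →ₐ[K] (Fin m → K) := φ.toAlgHom.comp (Ideal.Quotient.mkₐ K (Ring.jacobson B))
  refine ⟨m, fun j => (Pi.evalAlgHom K (fun _ => K) j).comp q, ⟨fun v => ?_, fun b => ?_⟩⟩
  · obtain ⟨b, hb⟩ := Ideal.Quotient.mk_surjective (φ.symm v)
    refine ⟨b, fun j => ?_⟩
    change φ (Ideal.Quotient.mk _ b) j = v j
    rw [hb, AlgEquiv.apply_symm_apply]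
  · rw [← Ideal.Quotient.eq_zero_iff_mem, ← map_eq_zero_iff φ φ.injective, funext_iff]
    rfl

namespace IsCharList

variable {m : ℕ} {χ : Fin m → B →ₐ[K] K} (hχ : IsCharList χ)
include hχ

theorem injective : Function.Injective χ := by
  intro i j hij
  by_contra hne
  obtain ⟨b, hb⟩ := hχ.surj (Pi.single i 1)
  have h1 := hb i
  have h2 := hb j
  rw [Pi.single_eq_same] at h1
  rw [Pi.single_eq_of_ne (Ne.symm hne)] at h2
  rw [hij, h2] at h1
  exact zero_ne_one h1

/-- The radical kills `M`. Lifts `c j` of the primitive idempotents of the semisimple quotient sum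
to 1 modulo the radical, so some `c j • x` is nonzero. On this vector every `b` acts by the scalar
`χ j b`, and Schur's lemma applies to the resulting map from `charModule (χ j)`. -/
theorem exists_iso (M : ModuleCat.{u} B) [Simple M] : ∃ j, Nonempty (charModule (χ j) ≅ M) := by
  have hM : IsSimpleModule B M := simple_iff_isSimpleModule.1 ‹Simple M›
  have hJ : ∀ b ∈ Ring.jacobson B, ∀ x : M, b • x = 0 := by
    intro b hb x
    have h1 := Ring.jacobson_smul_top_le B M
      (Submodule.smul_mem_smul hb (Submodule.mem_top (x := x)))
    rw [IsSemisimpleModule.jacobson_eq_bot] at h1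
    simpa using h1
  have := IsSimpleModule.nontrivial B M
  obtain ⟨x, hx⟩ := exists_ne (0 : M)
  choose c hc using fun j : Fin m => hχ.surj (Pi.single j 1)
  have h1 : (∑ j, c j) • x = x := by
    have : (∑ j, c j) - 1 ∈ Ring.jacobson B := by
      rw [← hχ.ker]
      intro i
      rw [map_sub, map_sum, map_one, Finset.sum_eq_single i, hc, Pi.single_eq_same, sub_self]
      · intro k _ hk
        rw [hc, Pi.single_eq_of_ne hk.symm]
      · simp
    have := hJ _ this x
    rwa [sub_smul, one_smul, sub_eq_zero] at this
  obtain ⟨j, hj⟩ : ∃ j, c j • x ≠ 0 := by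
    by_contra! hcon
    rw [Finset.sum_smul, Finset.sum_eq_zero fun j _ => hcon j] at h1
    exact hx h1.symm
  have h2 (b : B) : b • c j • x = algebraMap K B (χ j b) • c j • x := by
    rw [← sub_eq_zero, ← sub_smul, ← mul_smul]
    refine hJ _ ?_ x
    rw [← hχ.ker]
    intro i
    rw [map_mul, map_sub, hc]
    rcases eq_or_ne i j with rfl | hij
    · simp
    · simp [hij]
  let f : charModule (χ j) →ₗ[B] M :=
    { toFun := fun k : K => algebraMap K B k • c j • x
      map_add' := fun (k l : K) => by
        change algebraMap K B (k + l) • _ = _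
        rw [map_add, add_smul]
      map_smul' := fun b (k : K) => by
        change algebraMap K B (χ j b * k) • _ = b • _
        rw [← mul_smul b, ← Algebra.commutes k b, mul_smul (algebraMap K B k) b, h2 b,
          ← mul_smul (algebraMap K B k), ← map_mul, mul_comm] }
  have hf : f ≠ 0 := by
    intro h
    have h3 : algebraMap K B 1 • c j • x = 0 := LinearMap.congr_fun h (1 : K)
    rw [map_one, one_smul] at h3
    exact hj h3
  let φ := ModuleCat.ofHom f
  have h3 : Simple (ModuleCat.of B (charModule (χ j))) := simple_charModule (χ j)
  have h4 : Simple (ModuleCat.of B M) := ‹Simple M›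
  have h5 : φ ≠ 0 := fun h => hf (by simpa [φ] using congrArg ModuleCat.Hom.hom h)
  have h6 := isIso_of_hom_simple h5
  exact ⟨j, ⟨asIso φ⟩⟩

/-- The map from the regular module to the product of the simple modules. -/
theorem exists_isEssentialEpi :
    ∃ π : ModuleCat.of B B ⟶ ∏ᶜ fun j => charModule (χ j), IsEssentialEpi π := by
  let f : B →ₗ[B] (∀ j, charModule (χ j)) := LinearMap.pi fun j => charModule.proj (χ j)
  have hf : Function.Surjective f := fun v => by
    obtain ⟨b, hb⟩ := hχ.surj v
    exact ⟨b, funext hb⟩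
  have hker : ∀ b, f b = 0 → b ∈ Ring.jacobson B := fun b hb =>
    (hχ.ker b).1 fun j => congrFun hb j
  have h : IsEssentialEpi (ModuleCat.ofHom f) :=
    { epi := (ModuleCat.epi_iff_surjective _).2 hf
      epi_of_comp := fun {M} g hg => by
        rw [ModuleCat.epi_iff_surjective] at hg ⊢
        rw [← ModuleCat.hom_ofHom f] at hker
        obtain ⟨x, hx⟩ := hg (f 1)
        have h1 : g.hom x - 1 ∈ Ring.jacobson B := hker _ (by
          rw [map_sub, sub_eq_zero]; exact hx)
        -- Nakayama's argument: a maximal left ideal above a proper range contains `g x` and the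
        -- radical, hence also 1.
        have h2 : LinearMap.range g.hom = ⊤ := by
          by_contra hne
          obtain ⟨I, hI, hle⟩ := Ideal.exists_le_maximal (LinearMap.range g.hom) hne
          have h3 : g.hom x ∈ I := hle ⟨x, rfl⟩
          have h4 := Ring.jacobson_le_of_isMaximal I h1
          exact hI.ne_top ((Ideal.eq_top_iff_one I).2 (by simpa using I.sub_mem h3 h4))
        exact LinearMap.range_eq_top.1 h2 }
  exact ⟨_, h.comp_iso (ModuleCat.piIsoPi _).symm⟩

end IsCharList

/-- Morita equivalent basic algebras are isomorphic. -/
theorem IsBasicAlgebra.nonempty_algEquiv_of_isMoritaEquivalent {C : Type u} [Ring C] [Algebra K C]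
    (hB : IsBasicAlgebra K B) (hC : IsBasicAlgebra K C) (h : IsMoritaEquivalent K B C) :
    Nonempty (B ≃ₐ[K] C) := by
  obtain ⟨F⟩ := h.cond
  obtain ⟨m, χ, hχ⟩ := hB.exists_isCharList
  obtain ⟨n, ψ, hψ⟩ := hC.exists_isCharList
  obtain ⟨π, hπ⟩ := hχ.exists_isEssentialEpi
  obtain ⟨π', hπ'⟩ := hψ.exists_isEssentialEpi
  have hs (j) : Simple (F.eqv.functor.obj (charModule (χ j))) := by
    have := simple_charModule (χ j)
    exact simple_obj _ _
  have hs' (j) : Simple (F.eqv.inverse.obj (charModule (ψ j))) := by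
    have := simple_charModule (ψ j)
    exact simple_obj _ _
  -- The equivalence induces a bijection between the simple modules, so it carries the product of
  -- all simple `B`-modules to that of all simple `C`-modules. The regular modules are the
  -- projective covers of these products; hence the image of the regular `B`-module is the regular
  -- `C`-module.
  choose σ hσ using fun j => hψ.exists_iso (F.eqv.functor.obj (charModule (χ j)))
  have hσ_inj : Function.Injective σ := by
    intro i j hij
    obtain ⟨a⟩ := hσ i
    obtain ⟨b⟩ := hσ j
    rw [hij] at a
    exact hχ.injective (eq_of_charModule_iso (F.eqv.functor.preimageIso (a.symm ≪≫ b)))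
  have hσ_surj : Function.Surjective σ := by
    intro j
    obtain ⟨i, ⟨a⟩⟩ := hχ.exists_iso (F.eqv.inverse.obj (charModule (ψ j)))
    obtain ⟨b⟩ := hσ i
    refine ⟨i, hψ.injective (eq_of_charModule_iso ?_)⟩
    exact b ≪≫ F.eqv.functor.mapIso a ≪≫ F.eqv.counitIso.app _
  let e : Fin m ≃ Fin n := Equiv.ofBijective σ ⟨hσ_inj, hσ_surj⟩
  let i1 : F.eqv.functor.obj (∏ᶜ fun j => charModule (χ j)) ≅
      ∏ᶜ fun j => charModule (ψ j) :=
    CategoryTheory.Limits.PreservesProduct.iso F.eqv.functor (fun j => charModule (χ j)) ≪≫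
      Pi.whiskerEquiv e (fun j => (hσ j).some)
  have h1 := (hπ.map F.eqv).comp_iso i1
  have hPB : Projective (ModuleCat.of B B) :=
    ModuleCat.projective_of_free (Module.Basis.singleton Unit B)
  have : Projective (ModuleCat.of C C) :=
    ModuleCat.projective_of_free (Module.Basis.singleton Unit C)
  have : Projective (F.eqv.functor.obj (ModuleCat.of B B)) :=
    (F.eqv.map_projective_iff _).2 hPB
  obtain ⟨i⟩ := h1.nonempty_iso hπ'
  -- Right multiplications are the endomorphisms of the regular left module. With composition in
  -- diagrammatic order `ρ` is multiplicative, so no opposite algebra appears; `f` below is `ρ`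
  -- transported by the functor and by `i`.
  let ρ (b : B) : ModuleCat.of B B ⟶ ModuleCat.of B B :=
    ModuleCat.ofHom (LinearMap.toSpanSingleton B B b)
  let g (b : B) : ModuleCat.of C C ⟶ ModuleCat.of C C := i.inv ≫ F.eqv.functor.map (ρ b) ≫ i.hom
  have g_apply (b : B) (x : C) : (g b).hom x = x * (g b).hom (1 : C) := by
    have := (g b).hom.map_smul x (1 : C)
    simpa using this
  have ρ_mul (a b : B) : ρ (a * b) = ρ a ≫ ρ b := by
    ext; simp [ρ]
  have ρ_add (a b : B) : ρ (a + b) = ρ a + ρ b := by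
    ext; simp [ρ]
  have ρ_one : ρ 1 = 𝟙 _ := by
    ext; simp [ρ]
  have ρ_zero : ρ 0 = 0 := by
    ext; simp [ρ]
  have map_ρ (k : K) (x : F.eqv.functor.obj (ModuleCat.of B B)) :
      (F.eqv.functor.map (ρ (algebraMap K B k))).hom x = algebraMap K C k • x := by
    have h2 := Functor.map_smul_id F.eqv.functor (ModuleCat.of B B) k
    refine (congrArg (fun t => t.hom x) (Eq.trans (congrArg F.eqv.functor.map ?_) h2)).trans rfl
    ext
    change (1 : B) * algebraMap K B k = algebraMap K B k * 1
    rw [one_mul, mul_one]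
  have g_mul (a b : B) : g (a * b) = g a ≫ g b := by
    simp [g, ρ_mul]
  let f : B →ₐ[K] C :=
    { toFun := fun b => (g b).hom (1 : C)
      map_one' := by
        simp [g, ρ_one]
      map_mul' := fun a b => by
        rw [g_mul]
        exact g_apply b _
      map_zero' := by
        simp [g, ρ_zero]
      map_add' := fun a b => by simp [g, ρ_add]
      commutes' := fun k => by
        simp only [g, ModuleCat.hom_comp, LinearMap.comp_apply, map_ρ, map_smul]
        rw [← LinearMap.comp_apply, ← ModuleCat.hom_comp, i.inv_hom_id]
        exact mul_one _ }
  refine ⟨AlgEquiv.ofBijective f ⟨fun a b hab => ?_, fun c => ?_⟩⟩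
  · have h2 : g a = g b := by
      ext
      exact hab
    have h3 : F.eqv.functor.map (ρ a) = F.eqv.functor.map (ρ b) := by
      simpa [g] using h2
    have h4 := F.eqv.functor.map_injective h3
    have h5 := congrArg (fun t => t.hom (1 : B)) h4
    simpa [ρ] using h5
  · obtain ⟨r, hr⟩ := F.eqv.functor.map_surjective
      (i.hom ≫ ModuleCat.ofHom (LinearMap.toSpanSingleton C C c) ≫ i.inv)
    refine ⟨r.hom (1 : B), ?_⟩
    have : ρ (r.hom (1 : B)) = r := by
      ext; simp [ρ]
    change (g _).hom (1 : C) = c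
    simp [g, this, hr]

end BasicAlgebra

end

noncomputable section

/-! ### Integral linear combinations given by lists -/

section ListCombination

variable {ι M : Type*} [AddCommGroup M]

/-- The linear combination of the vectors `v j` with the coefficients listed in `L`. -/
def listComb (v : ι → M) (L : List (ℤ × ι)) : M := (L.map fun t => t.1 • v t.2).sum

/-- The total coefficient of `j` in the list `L`. -/
def listCoeff [DecidableEq ι] (L : List (ℤ × ι)) (j : ι) : ℤ :=
  L.foldr (fun t c => if t.2 = j then t.1 + c else c) 0

@[simp] theorem listComb_nil (v : ι → M) : listComb v [] = 0 := rfl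

@[simp] theorem listComb_cons (v : ι → M) (t : ℤ × ι) (L : List (ℤ × ι)) :
    listComb v (t :: L) = t.1 • v t.2 + listComb v L := by simp [listComb]

@[simp] theorem listComb_append (v : ι → M) (L L' : List (ℤ × ι)) :
    listComb v (L ++ L') = listComb v L + listComb v L' := by simp [listComb]

theorem listComb_eq_sum [Fintype ι] [DecidableEq ι] (v : ι → M) (L : List (ℤ × ι)) :
    listComb v L = ∑ j, listCoeff L j • v j := by
  induction L with
  | nil => simp [listCoeff]
  | cons t L ih =>
    have h (j : ι) : listCoeff (t :: L) j • v j
        = (if t.2 = j then t.1 • v j else 0) + listCoeff L j • v j := by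
      change (if t.2 = j then t.1 + listCoeff L j else listCoeff L j) • v j = _
      split_ifs
      · rw [add_smul]
      · rw [zero_add]
    rw [listComb_cons, ih, Finset.sum_congr rfl fun j _ => h j, Finset.sum_add_distrib]
    simp

/-- Reduces an identity in a module to finitely many equalities of integers, which can be decided by
evaluation. -/
theorem listComb_congr [Fintype ι] [DecidableEq ι] (v : ι → M) {L L' : List (ℤ × ι)}
    (h : ∀ j, listCoeff L j = listCoeff L' j) : listComb v L = listComb v L' := by
  simp_rw [listComb_eq_sum, h]

theorem map_listComb {N F : Type*} [AddCommGroup N] [FunLike F M N] [AddMonoidHomClass F M N]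
    (f : F) (v : ι → M) (L : List (ℤ × ι)) : f (listComb v L) = listComb (fun j => f (v j)) L := by
  induction L with
  | nil => simp
  | cons t L ih => simp [ih, map_zsmul]

theorem listComb_flatMap (v : ι → M) {κ : Type*} (L : List (ℤ × κ)) (f : κ → List (ℤ × ι)) :
    listComb v (L.flatMap fun t => (f t.2).map fun s => (t.1 * s.1, s.2))
      = listComb (fun k => listComb v (f k)) L := by
  induction L with
  | nil => rfl
  | cons t L ih =>
    rw [List.flatMap_cons, listComb_append, ih, listComb_cons]
    congr 1
    induction f t.2 with
    | nil => simp
    | cons s l ih' => simp [ih', mul_smul]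

theorem listComb_mem {S : Type*} [SetLike S M] [AddSubgroupClass S M] (s : S) (v : ι → M)
    (L : List (ℤ × ι)) (h : ∀ t ∈ L, v t.2 ∈ s) : listComb v L ∈ s := by
  induction L with
  | nil => exact zero_mem s
  | cons t L ih =>
    rw [listComb_cons]
    exact add_mem (zsmul_mem (h t (by simp)) _) (ih fun u hu => h u (by simp [hu]))

end ListCombination

/-! ### Normal words in the presented algebra -/

namespace GrPresentation

/-- These are the words that contain none of `00`, `11`, `22`, `02`, `010`, `012`, `1210`, `12120`,
`121212`, the leading words of the rewriting rules below. Their numbers in lengths 0 to 6 are 1, 3,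
5, 6, 5, 3, 1. -/
def normalWordList : List (List (Fin 3)) :=
  [[], [0], [1], [2], [0, 1], [1, 0],
   [1, 2], [2, 0], [2, 1], [1, 0, 1], [1, 2, 0], [1, 2, 1],
   [2, 0, 1], [2, 1, 0], [2, 1, 2], [1, 2, 0, 1], [1, 2, 1, 2], [2, 1, 0, 1],
   [2, 1, 2, 0], [2, 1, 2, 1], [1, 2, 1, 2, 1], [2, 1, 2, 0, 1], [2, 1, 2, 1, 2], [2, 1, 2, 1, 2, 1]]

/-- The entries result from the rewriting rules; an empty entry stands for a vanishing product. -/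
def mulTableList : List (List (List (ℤ × Fin 24))) :=
  [[[(1, 1)], [(1, 2)], [(1, 3)]], [[], [(1, 4)], [(1, 7)]],
   [[(1, 5)], [], [(1, 6)]], [[(1, 7)], [(1, 8)], []],
   [[(1, 14), (1, 11)], [], [(-1, 13), (1, 9)]], [[], [(1, 9)], [(1, 10)]],
   [[(1, 10)], [(1, 11)], []], [[], [(1, 12)], []],
   [[(1, 13)], [], [(1, 14)]], [[(1, 16)], [], [(1, 18)]],
   [[], [(1, 15)], []], [[(-1, 18)], [], [(1, 16)]],
   [[(1, 19)], [], [(1, 17)]], [[], [(1, 17)], [(1, 18)]],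
   [[(1, 18)], [(1, 19)], []], [[(1, 20)], [], [(-1, 21)]],
   [[], [(1, 20)], []], [[(1, 22)], [], []],
   [[], [(1, 21)], []], [[], [], [(1, 22)]],
   [[], [], [(-1, 23)]], [[(1, 23)], [], []],
   [[], [(1, 23)], []], [[], [], []]]

/-- The normal words. -/
def normalWord (k : Fin 24) : List (Fin 3) := normalWordList.getD k []

/-- The expansion in normal words of the product of the `k`-th normal word with the letter `i`. -/
def mulTable (k : Fin 24) (i : Fin 3) : List (ℤ × Fin 24) := (mulTableList.getD k []).getD i []

/-- The expansion of a word in normal words. -/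
def expandFrom : List (ℤ × Fin 24) → List (Fin 3) → List (ℤ × Fin 24)
  | L, [] => L
  | L, i :: w =>
    expandFrom (L.flatMap fun t => (mulTable t.2 i).map fun s => (t.1 * s.1, s.2)) w

/-- The expansion of a word in normal words. -/
def expand (w : List (Fin 3)) : List (ℤ × Fin 24) := expandFrom [(1, 0)] w

/-- The vertex reached from the vertex `1` along a word. -/
def wordEnd (w : List (Fin 3)) : Equiv.Perm (Fin 3) := (w.map arrowStep).prod

@[simp] theorem wordEnd_nil : wordEnd [] = 1 := rfl

@[simp] theorem wordEnd_cons (i : Fin 3) (w : List (Fin 3)) :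
    wordEnd (i :: w) = arrowStep i * wordEnd w := by simp [wordEnd]

@[simp] theorem wordEnd_append (v w : List (Fin 3)) : wordEnd (v ++ w) = wordEnd v * wordEnd w := by
  simp [wordEnd]

section Relations

variable (K : Type*) [Field K]

@[simp] theorem monomial_nil : monomial K [] = 1 := by simp [monomial]

theorem monomial_append (v w : List (Fin 3)) :
    monomial K (v ++ w) = monomial K v * monomial K w := by simp [monomial]

theorem monomial_cons (i : Fin 3) (w : List (Fin 3)) :
    monomial K (i :: w) = monomial K [i] * monomial K w := monomial_append K [i] w

theorem sq_eq_zero (i : Fin 3) : monomial K [i] * monomial K [i] = 0 := by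
  have := RingQuot.mkAlgHom_rel K (GrRel.sq (K := K) i)
  simpa [monomial] using this

theorem comm_rel :
    monomial K [0] * monomial K [2] = monomial K [2] * monomial K [0] := by
  have := RingQuot.mkAlgHom_rel K (GrRel.comm (K := K))
  simpa [monomial, sub_eq_zero] using this

theorem cubic_rel₁ : monomial K [0] * (monomial K [1] * monomial K [2])
    = monomial K [1] * (monomial K [0] * monomial K [1])
      - monomial K [2] * (monomial K [1] * monomial K [0]) := by
  have := RingQuot.mkAlgHom_rel K (GrRel.cubic₁ (K := K))
  simp only [map_sub, map_mul, map_zero, mul_assoc] at this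
  rw [sub_sub, sub_eq_zero] at this
  simp [monomial, this]

theorem cubic_rel₂ : monomial K [0] * (monomial K [1] * monomial K [0])
    = monomial K [1] * (monomial K [2] * monomial K [1])
      + monomial K [2] * (monomial K [1] * monomial K [2]) := by
  have := RingQuot.mkAlgHom_rel K (GrRel.cubic₂ (K := K))
  simp only [map_add, map_sub, map_mul, map_zero, mul_assoc] at this
  rw [sub_add_eq_add_sub, sub_eq_zero] at this
  simp [monomial, this]

end Relations

/-- Consequences of the defining relations, in the form of a terminating rewriting system. -/
theorem rewriting_of_relations {S : Type*} [Ring S] {a b c : S} (haa : a * a = 0) (hbb : b * b = 0)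
    (hcc : c * c = 0) (h₂ : a * (b * a) = b * (c * b) + c * (b * c)) :
    b * (c * (b * a)) = -(c * (b * (c * a))) ∧ b * (c * (b * (c * a))) = 0 ∧
      b * (c * (b * (c * (b * c)))) = -(c * (b * (c * (b * (c * b))))) := by
  -- All three rules come from `a * a = 0` through `h₂`: the element `aba = bcb + cbc` is
  -- annihilated by `a` on the right, and its square vanishes.
  have h₃ : b * (c * (b * a)) = -(c * (b * (c * a))) := by
    have h : (b * (c * b) + c * (b * c)) * a = 0 := by
      rw [← h₂]; simp only [mul_assoc, haa, mul_zero]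
    rw [eq_neg_iff_add_eq_zero, ← h]
    simp only [mul_assoc, add_mul]
  have hbb' (t : S) : b * (b * t) = 0 := by rw [← mul_assoc, hbb, zero_mul]
  have hcc' (t : S) : c * (c * t) = 0 := by rw [← mul_assoc, hcc, zero_mul]
  refine ⟨h₃, ?_, ?_⟩
  · rw [← neg_eq_iff_eq_neg.2 h₃, mul_neg, hbb', neg_zero]
  · have h : (b * (c * b) + c * (b * c)) * (b * (c * b) + c * (b * c)) = 0 := by
      rw [← h₂]
      simp only [mul_assoc]
      simp only [← mul_assoc a a, haa, zero_mul, mul_zero]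
    rw [eq_neg_iff_add_eq_zero, ← h]
    simp only [mul_assoc, add_mul, mul_add, hbb', hcc', mul_zero, zero_add, add_zero]
    rw [add_comm]

/-- The products of normal words with letters in any ring with elements satisfying the relations. -/
theorem prod_normalWord_mul {S : Type*} [Ring S] {a b c : S} (haa : a * a = 0) (hbb : b * b = 0)
    (hcc : c * c = 0) (h₁ : a * (b * c) = b * (a * b) - c * (b * a))
    (h₂ : a * (b * a) = b * (c * b) + c * (b * c)) (hac : a * c = c * a) (k : Fin 24) (i : Fin 3) :
    ((normalWord k).map ![a, b, c]).prod * ![a, b, c] i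
      = listComb (fun j => ((normalWord j).map ![a, b, c]).prod) (mulTable k i) := by
  obtain ⟨h₃, h₄, h₅⟩ := rewriting_of_relations haa hbb hcc h₂
  have h₆ : b * (c * (b * (a * b))) = -(c * (b * (c * (a * b)))) := by
    simpa only [mul_assoc, neg_mul] using congrArg (· * b) h₃
  have hbb' (t : S) : b * (b * t) = 0 := by rw [← mul_assoc, hbb, zero_mul]
  have hcc' (t : S) : c * (c * t) = 0 := by rw [← mul_assoc, hcc, zero_mul]
  fin_cases k <;> fin_cases i <;>
    simp [normalWord, normalWordList, mulTable, mulTableList,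
      mul_assoc, haa, hbb, hcc, hac, h₁, h₂, h₃, h₄, h₅, h₆, hbb', hcc', mul_add,
      sub_eq_add_neg, add_comm]

variable (K : Type*) [Field K]

theorem monomial_eq_prod (w : List (Fin 3)) : monomial K w
    = (w.map ![monomial K [0], monomial K [1], monomial K [2]]).prod := by
  induction w with
  | nil => simp
  | cons i w ih => rw [monomial_cons, ih, List.map_cons, List.prod_cons]; fin_cases i <;> rfl

theorem monomial_normalWord_mul (k : Fin 24) (i : Fin 3) :
    monomial K (normalWord k) * monomial K [i]
      = listComb (fun j => monomial K (normalWord j)) (mulTable k i) := by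
  have h := prod_normalWord_mul (sq_eq_zero K 0) (sq_eq_zero K 1) (sq_eq_zero K 2)
    (cubic_rel₁ K) (cubic_rel₂ K) (comm_rel K) k i
  simp_rw [monomial_eq_prod K (normalWord _)]
  rw [← h]
  congr 1
  fin_cases i <;> rfl

theorem listComb_expandFrom (L : List (ℤ × Fin 24)) (w : List (Fin 3)) :
    listComb (fun j => monomial K (normalWord j)) (expandFrom L w)
      = listComb (fun j => monomial K (normalWord j)) L * monomial K w := by
  induction w generalizing L with
  | nil => rw [expandFrom, monomial_nil, mul_one]
  | cons i w ih =>
    rw [expandFrom, ih, listComb_flatMap _ L fun k => mulTable k i, monomial_cons, ← mul_assoc]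
    simp_rw [← monomial_normalWord_mul]
    exact congrArg (· * monomial K w) (map_listComb (AddMonoidHom.mulRight (monomial K [i]))
      (fun j => monomial K (normalWord j)) L).symm

theorem monomial_eq_listComb (w : List (Fin 3)) :
    monomial K w = listComb (fun j => monomial K (normalWord j)) (expand w) := by
  rw [expand, listComb_expandFrom, listComb_cons]
  simp [normalWord, normalWordList]

/-- The expansion in normal words is homogeneous for the length and for the end point. -/
theorem mulTable_homogeneous : ∀ (k : Fin 24) (i : Fin 3), ∀ t ∈ mulTable k i,
    (normalWord t.2).length = (normalWord k).length + 1 ∧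
      wordEnd (normalWord t.2) = wordEnd (normalWord k) * arrowStep i := by
  decide +kernel

theorem expandFrom_homogeneous (L : List (ℤ × Fin 24)) (w : List (Fin 3)) (n : ℕ)
    (g : Equiv.Perm (Fin 3))
    (h : ∀ t ∈ L, (normalWord t.2).length = n ∧ wordEnd (normalWord t.2) = g) :
    ∀ t ∈ expandFrom L w, (normalWord t.2).length = n + w.length ∧
      wordEnd (normalWord t.2) = g * wordEnd w := by
  induction w generalizing L n g with
  | nil => simpa [expandFrom] using h
  | cons i w ih =>
    rw [expandFrom, wordEnd_cons, ← mul_assoc, List.length_cons, add_comm w.length, ← add_assoc]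
    · refine ih _ (n + 1) (g * arrowStep i) fun t ht => ?_
      simp only [List.mem_flatMap, List.mem_map] at ht
      obtain ⟨u, hu, s, hs, rfl⟩ := ht
      have h1 := h u hu
      have h2 := mulTable_homogeneous u.2 i s hs
      rw [h1.1, h1.2] at h2
      exact h2

theorem expand_homogeneous (w : List (Fin 3)) : ∀ t ∈ expand w,
    (normalWord t.2).length = w.length ∧ wordEnd (normalWord t.2) = wordEnd w := by
  have h := expandFrom_homogeneous [(1, 0)] w 0 1 (by simp [normalWord, normalWordList])
  simpa [expand] using h

/-! ### Linear independence of the normal words -/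

/-- The operator of right multiplication with the letter `i` on the space of formal linear
combinations of normal words. -/
def rightMul (i : Fin 3) : Module.End K (Fin 24 → K) :=
  (Pi.basisFun K (Fin 24)).constr K fun k => listComb (fun j => Pi.single j 1) (mulTable k i)

theorem rightMul_single (i : Fin 3) (k : Fin 24) :
    rightMul K i (Pi.single k 1) = listComb (fun j => Pi.single j (1 : K)) (mulTable k i) := by
  rw [rightMul, ← Pi.basisFun_apply, Module.Basis.constr_basis]

theorem rightMul_listComb (i : Fin 3) (L : List (ℤ × Fin 24)) :
    rightMul K i (listComb (fun j => Pi.single j (1 : K)) L)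
      = listComb (fun j => Pi.single j (1 : K)) (expandFrom L [i]) := by
  rw [map_listComb, expandFrom, expandFrom, listComb_flatMap _ L fun k => mulTable k i]
  simp_rw [rightMul_single]

theorem lift_prod_apply (w : List (Fin 3)) (L : List (ℤ × Fin 24)) :
    (FreeAlgebra.lift K (fun i => MulOpposite.op (rightMul K i))
      (w.map (FreeAlgebra.ι K)).prod).unop (listComb (fun j => Pi.single j (1 : K)) L)
      = listComb (fun j => Pi.single j (1 : K)) (expandFrom L w) := by
  induction w generalizing L with
  | nil => simp [expandFrom]
  | cons i w ih =>
    rw [List.map_cons, List.prod_cons, map_mul, MulOpposite.unop_mul, FreeAlgebra.lift_ι_apply,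
      MulOpposite.unop_op, Module.End.mul_apply, rightMul_listComb, ih]
    rfl

theorem lift_prod_single (w : List (Fin 3)) (k : Fin 24) :
    (FreeAlgebra.lift K (fun i => MulOpposite.op (rightMul K i))
      (w.map (FreeAlgebra.ι K)).prod).unop (Pi.single k 1)
      = listComb (fun j => Pi.single j (1 : K)) (expandFrom [(1, k)] w) := by
  simpa using lift_prod_apply K w [(1, k)]

/-- This is the confluence of the rewriting system in disguise: the multiplication table defines a
right module because every relation annihilates each of the 24 basis vectors, a statement about
integer coefficients. -/
theorem rightMul_relations ⦃x y : FreeAlgebra K (Fin 3)⦄ (h : GrRel K x y) :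
    FreeAlgebra.lift K (fun i => MulOpposite.op (rightMul K i)) x
      = FreeAlgebra.lift K (fun i => MulOpposite.op (rightMul K i)) y := by
  refine MulOpposite.unop_injective ((Pi.basisFun K (Fin 24)).ext fun k => ?_)
  rw [Pi.basisFun_apply]
  have key := lift_prod_single K
  have e2 (i j : Fin 3) : FreeAlgebra.ι K i * FreeAlgebra.ι K j
      = ([i, j].map (FreeAlgebra.ι K)).prod := by simp
  have e3 (i j l : Fin 3) : FreeAlgebra.ι K i * FreeAlgebra.ι K j * FreeAlgebra.ι K l
      = ([i, j, l].map (FreeAlgebra.ι K)).prod := by simp [mul_assoc]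
  cases h with
  | sq t =>
    rw [e2, key, map_zero]
    refine (listComb_congr (L' := []) _ ?_).trans (listComb_nil _)
    revert k t
    decide +kernel
  | comm =>
    rw [map_zero, map_sub, MulOpposite.unop_sub, LinearMap.sub_apply, e2, e2, key, key]
    refine sub_eq_zero.2 (listComb_congr _ ?_)
    revert k
    decide +kernel
  | cubic₁ =>
    rw [map_zero, map_sub, map_sub, MulOpposite.unop_sub, MulOpposite.unop_sub, LinearMap.sub_apply,
      LinearMap.sub_apply, e3, e3, e3, key, key, key, sub_sub, ← listComb_append]
    refine sub_eq_zero.2 (listComb_congr _ ?_)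
    revert k
    decide +kernel
  | cubic₂ =>
    rw [map_zero, map_add, map_sub, MulOpposite.unop_add, MulOpposite.unop_sub, LinearMap.add_apply,
      LinearMap.sub_apply, e3, e3, e3, key, key, key, sub_add_eq_add_sub, ← listComb_append]
    refine sub_eq_zero.2 (listComb_congr _ ?_)
    revert k
    decide +kernel

/-- The right regular representation. -/
def rightHom : GrPresentation K →ₐ[K] (Module.End K (Fin 24 → K))ᵐᵒᵖ :=
  RingQuot.liftAlgHom K ⟨_, rightMul_relations K⟩

theorem expand_normalWord : ∀ k j : Fin 24,
    listCoeff (expand (normalWord k)) j = listCoeff [(1, k)] j := by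
  decide +kernel

theorem rightHom_normalWord (k : Fin 24) :
    (rightHom K (monomial K (normalWord k))).unop (Pi.single 0 1) = Pi.single k 1 := by
  rw [rightHom, monomial, RingQuot.liftAlgHom_mkAlgHom_apply, lift_prod_single]
  exact (listComb_congr _ (expand_normalWord k)).trans (by simp)

/-- Acting on the basis vector of the empty word, the normal words give the 24 different basis
vectors. -/
theorem linearIndependent_normalWord :
    LinearIndependent K fun k => monomial K (normalWord k) := by
  let f : GrPresentation K →ₗ[K] (Fin 24 → K) :=
    (LinearMap.applyₗ (Pi.single 0 1)).comp
      ((MulOpposite.opLinearEquiv K).symm.toLinearMap.comp (rightHom K).toLinearMap)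
  refine LinearIndependent.of_comp f ?_
  have : f ∘ (fun k => monomial K (normalWord k)) = Pi.basisFun K (Fin 24) := by
    funext k
    rw [Pi.basisFun_apply]
    exact rightHom_normalWord K k
  rw [this]
  exact (Pi.basisFun K (Fin 24)).linearIndependent

theorem span_range_monomial : Submodule.span K (Set.range (monomial K)) = ⊤ := by
  rw [eq_top_iff]
  rintro x -
  obtain ⟨x, rfl⟩ := RingQuot.mkAlgHom_surjective K (GrRel K) x
  induction x using FreeAlgebra.induction with
  | grade0 r =>
    rw [AlgHom.commutes, Algebra.algebraMap_eq_smul_one, ← monomial_nil]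
    exact Submodule.smul_mem _ _ (Submodule.subset_span ⟨_, rfl⟩)
  | grade1 i =>
    refine Submodule.subset_span ⟨[i], ?_⟩
    simp [monomial]
  | mul a b ha hb =>
    rw [map_mul]
    have h := Submodule.mul_mem_mul ha hb
    rw [Submodule.span_mul_span] at h
    refine Submodule.span_mono ?_ h
    rintro _ ⟨_, ⟨v, rfl⟩, _, ⟨w, rfl⟩, rfl⟩
    exact ⟨v ++ w, monomial_append K v w⟩
  | add a b ha hb => rw [map_add]; exact add_mem ha hb

theorem span_range_normalWord :
    Submodule.span K (Set.range fun k => monomial K (normalWord k)) = ⊤ := by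
  rw [eq_top_iff, ← span_range_monomial, Submodule.span_le]
  rintro _ ⟨w, rfl⟩
  rw [monomial_eq_listComb]
  exact listComb_mem _ _ _ fun t _ => Submodule.subset_span ⟨t.2, rfl⟩

/-- The basis of normal words. -/
def normalBasis : Module.Basis (Fin 24) K (GrPresentation K) :=
  Module.Basis.mk (linearIndependent_normalWord K) (span_range_normalWord K).ge

@[simp] theorem normalBasis_apply (k : Fin 24) :
    normalBasis K k = monomial K (normalWord k) := by
  simp [normalBasis]

/-- The coefficients of a word vanish at the normal words of another length. -/
theorem normalBasis_repr_monomial (w : List (Fin 3)) (k : Fin 24)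
    (h : (normalWord k).length ≠ w.length ∨ wordEnd (normalWord k) ≠ wordEnd w) :
    (normalBasis K).repr (monomial K w) k = 0 := by
  rw [monomial_eq_listComb, map_listComb, ← Finsupp.lapply_apply (R := K), map_listComb]
  refine listComb_mem (⊥ : Submodule K K) _ _ fun t ht => ?_
  rw [← normalBasis_apply, Module.Basis.repr_self, Finsupp.lapply_apply, Submodule.mem_bot]
  refine Finsupp.single_eq_of_ne ?_
  rintro rfl
  have := expand_homogeneous w t ht
  tauto

/-- The expansion in normal words preserves the length, and no normal word has length 7 or more. -/
theorem monomial_eq_zero_of_length {w : List (Fin 3)} (hw : 7 ≤ w.length) : monomial K w = 0 := by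
  refine (normalBasis K).ext_elem fun k => ?_
  have h : ∀ k, (normalWord k).length < 7 := by decide +kernel
  rw [normalBasis_repr_monomial K w k (Or.inl ((h k).trans_le hw).ne)]
  simp

end GrPresentation

end

noncomputable section

/-! ### The radical filtration of the presented algebra -/

namespace GrPresentation

variable (K : Type*) [Field K]

/-- The span of the words of length at least `n`. -/
def lengthFiltration (n : ℕ) : Submodule K (GrPresentation K) :=
  Submodule.span K {x | ∃ w : List (Fin 3), n ≤ w.length ∧ monomial K w = x}

variable {K}

theorem monomial_mem_lengthFiltration {n : ℕ} {w : List (Fin 3)} (h : n ≤ w.length) :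
    monomial K w ∈ lengthFiltration K n := Submodule.subset_span ⟨w, h, rfl⟩

theorem lengthFiltration_induction {n : ℕ} {p : Submodule K (GrPresentation K)}
    (h : ∀ w : List (Fin 3), n ≤ w.length → monomial K w ∈ p) : lengthFiltration K n ≤ p := by
  rw [lengthFiltration, Submodule.span_le]
  rintro _ ⟨w, hw, rfl⟩
  exact h w hw

theorem lengthFiltration_zero : lengthFiltration K 0 = ⊤ := by
  rw [eq_top_iff, ← span_range_monomial, Submodule.span_le]
  rintro _ ⟨w, rfl⟩
  exact monomial_mem_lengthFiltration (Nat.zero_le _)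

theorem mem_lengthFiltration_zero (r : GrPresentation K) : r ∈ lengthFiltration K 0 :=
  lengthFiltration_zero (K := K) ▸ Submodule.mem_top

theorem lengthFiltration_eq_bot {n : ℕ} (hn : 7 ≤ n) : lengthFiltration K n = ⊥ :=
  le_bot_iff.1 (lengthFiltration_induction fun w hw => by
    rw [monomial_eq_zero_of_length K (hn.trans hw)]; exact zero_mem _)

variable (K)

/-- The projection to the homogeneous component of degree `n`. -/
def component (n : ℕ) : GrPresentation K →ₗ[K] GrPresentation K :=
  (normalBasis K).constr K fun k =>
    if (normalWord k).length = n then monomial K (normalWord k) else 0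

variable {K}

theorem component_normalWord (n : ℕ) (k : Fin 24) : component K n (monomial K (normalWord k))
    = if (normalWord k).length = n then monomial K (normalWord k) else 0 := by
  rw [← normalBasis_apply, component, Module.Basis.constr_basis, normalBasis_apply]

theorem component_monomial (n : ℕ) (w : List (Fin 3)) :
    component K n (monomial K w) = if w.length = n then monomial K w else 0 := by
  rw [monomial_eq_listComb, map_listComb]
  have h : ∀ L : List (ℤ × Fin 24), (∀ t ∈ L, (normalWord t.2).length = w.length) →
      listComb (fun j => component K n (monomial K (normalWord j))) L
        = if w.length = n then listComb (fun j => monomial K (normalWord j)) L else 0 := by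
    intro L
    induction L with
    | nil => simp
    | cons t L ih =>
      intro hL
      rw [listComb_cons, listComb_cons, ih fun u hu => hL u (by simp [hu]), component_normalWord,
        hL t (by simp)]
      split_ifs <;> simp
  exact h _ fun t ht => (expand_homogeneous w t ht).1

theorem linearMap_ext_monomial {M : Type*} [AddCommGroup M] [Module K M]
    {f g : GrPresentation K →ₗ[K] M} (h : ∀ w, f (monomial K w) = g (monomial K w)) : f = g :=
  LinearMap.ext_on_range (span_range_monomial K) h

theorem component_mem (n : ℕ) (r : GrPresentation K) : component K n r ∈ lengthFiltration K n := by
  suffices lengthFiltration K 0 ≤ (lengthFiltration K n).comap (component K n) from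
    this (mem_lengthFiltration_zero r)
  refine lengthFiltration_induction fun w _ => ?_
  rw [Submodule.mem_comap, component_monomial]
  split_ifs with h
  · exact monomial_mem_lengthFiltration h.ge
  · exact zero_mem _

theorem component_component (m n : ℕ) (r : GrPresentation K) :
    component K m (component K n r) = if n = m then component K n r else 0 := by
  have : (component K m) ∘ₗ (component K n) = if n = m then component K n else 0 := by
    refine linearMap_ext_monomial fun w => ?_
    rw [LinearMap.comp_apply, component_monomial]
    split_ifs with h₁ h₂ h₂ <;> simp [component_monomial, h₁] <;> grind
  rw [← LinearMap.comp_apply, this]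
  split_ifs <;> rfl

theorem component_eq_zero {n : ℕ} {r : GrPresentation K} (h : r ∈ lengthFiltration K (n + 1)) :
    component K n r = 0 := by
  suffices lengthFiltration K (n + 1) ≤ LinearMap.ker (component K n) from this h
  refine lengthFiltration_induction fun w hw => ?_
  rw [LinearMap.mem_ker, component_monomial, if_neg (by lia)]

theorem sub_component_mem {n : ℕ} {r : GrPresentation K} (h : r ∈ lengthFiltration K n) :
    r - component K n r ∈ lengthFiltration K (n + 1) := by
  suffices lengthFiltration K n ≤
      (lengthFiltration K (n + 1)).comap (LinearMap.id - component K n) from this h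
  refine lengthFiltration_induction fun w hw => ?_
  rw [Submodule.mem_comap, LinearMap.sub_apply, component_monomial, LinearMap.id_apply]
  split_ifs with h
  · rw [sub_self]; exact zero_mem _
  · rw [sub_zero]; exact monomial_mem_lengthFiltration (by lia)

theorem sum_component (r : GrPresentation K) : ∑ n ∈ Finset.range 7, component K n r = r := by
  have : ∑ n ∈ Finset.range 7, component K n = LinearMap.id := by
    refine linearMap_ext_monomial fun w => ?_
    rw [LinearMap.sum_apply, LinearMap.id_apply]
    simp_rw [component_monomial]
    rw [Finset.sum_ite_eq]
    split_ifs with h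
    · rfl
    · rw [monomial_eq_zero_of_length K (by simpa using h)]
  rw [← LinearMap.sum_apply, this, LinearMap.id_apply]

variable (K)

/-- The augmentation. -/
def augmentation : GrPresentation K →ₐ[K] K :=
  RingQuot.liftAlgHom K ⟨FreeAlgebra.lift K fun _ => 0, by
    rintro x y (h | h | h | h) <;> simp⟩

variable {K}

theorem augmentation_monomial (w : List (Fin 3)) :
    augmentation K (monomial K w) = if w = [] then 1 else 0 := by
  cases w with
  | nil => simp
  | cons i w =>
    rw [monomial_cons, map_mul]
    simp [augmentation, monomial, RingQuot.liftAlgHom_mkAlgHom_apply]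

theorem augmentation_eq_zero {r : GrPresentation K} (h : r ∈ lengthFiltration K 1) :
    augmentation K r = 0 := by
  suffices hle : lengthFiltration K 1 ≤ LinearMap.ker (augmentation K).toLinearMap from hle h
  refine lengthFiltration_induction fun w hw => ?_
  rw [LinearMap.mem_ker, AlgHom.toLinearMap_apply, augmentation_monomial, if_neg]
  rintro rfl
  simp at hw

theorem sub_augmentation_mem (r : GrPresentation K) :
    r - algebraMap K _ (augmentation K r) ∈ lengthFiltration K 1 := by
  suffices h : lengthFiltration K 0 ≤ (lengthFiltration K 1).comap
      (LinearMap.id - (Algebra.linearMap K (GrPresentation K)) ∘ₗ (augmentation K).toLinearMap) from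
    h (mem_lengthFiltration_zero r)
  refine lengthFiltration_induction fun w _ => ?_
  change monomial K w - algebraMap K _ (augmentation K (monomial K w)) ∈ lengthFiltration K 1
  rw [augmentation_monomial]
  split_ifs with h
  · simp [h]
  · rw [map_zero, sub_zero]
    exact monomial_mem_lengthFiltration (List.length_pos_iff.2 h)

/-- The letters are themselves normal words, so their coefficients are coordinates in the normal
basis, and these coordinates vanish on words of length at least 2. This becomes the statement that
the arrows form a basis of the radical modulo its square. -/
theorem existsUnique_letter_coefficients {r : GrPresentation K} (h : r ∈ lengthFiltration K 1) :
    ∃! c : Fin 3 → K, r - ∑ i, c i • monomial K [i] ∈ lengthFiltration K 2 := by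
  -- The positions of the three letters in `normalWordList`.
  let d : Fin 3 → Fin 24 := ![1, 2, 3]
  have hd (i : Fin 3) : normalWord (d i) = [i] := by fin_cases i <;> rfl
  have hdi : Function.Injective d := by decide
  have hc (c : Fin 3 → K) (j : Fin 3) :
      (normalBasis K).repr (∑ i, c i • monomial K [i]) (d j) = c j := by
    simp_rw [← hd, ← normalBasis_apply, map_sum, map_smul, Module.Basis.repr_self,
      Finsupp.finsetSum_apply, Finsupp.smul_apply, smul_eq_mul]
    rw [Finset.sum_eq_single j]
    · simp
    · intro i _ hij
      rw [Finsupp.single_eq_of_ne (fun h => hij (hdi h).symm), mul_zero]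
    · simp
  have h2 : lengthFiltration K 2 ≤ ⨅ j, LinearMap.ker ((normalBasis K).coord (d j)) := by
    refine lengthFiltration_induction fun w hw => ?_
    rw [Submodule.mem_iInf]
    intro j
    rw [LinearMap.mem_ker, Module.Basis.coord_apply]
    refine normalBasis_repr_monomial K w _ (Or.inl ?_)
    rw [hd]
    simp only [List.length_singleton]
    lia
  obtain ⟨c, hcr⟩ : ∃ c : Fin 3 → K, component K 1 r = ∑ i, c i • monomial K [i] := by
    suffices lengthFiltration K 0 ≤ (Submodule.span K (Set.range fun i => monomial K [i])).comap
        (component K 1) by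
      obtain ⟨c, hc⟩ := (Submodule.mem_span_range_iff_exists_fun K).1 (this (mem_lengthFiltration_zero r))
      exact ⟨c, hc.symm⟩
    refine lengthFiltration_induction fun w _ => ?_
    rw [Submodule.mem_comap, component_monomial]
    split_ifs with hw
    · obtain ⟨i, rfl⟩ := List.length_eq_one_iff.1 hw
      exact Submodule.subset_span ⟨i, rfl⟩
    · exact zero_mem _
  refine ⟨c, ?_, fun c' hc' => ?_⟩
  · change r - ∑ i, c i • monomial K [i] ∈ _
    rw [← hcr]
    exact sub_component_mem h
  · have h3 : ∑ i, c' i • monomial K [i] - ∑ i, c i • monomial K [i] ∈ lengthFiltration K 2 := by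
      rw [← hcr]
      have := sub_mem (sub_component_mem h) hc'
      rwa [sub_sub_sub_cancel_left] at this
    funext j
    have h4 := Submodule.mem_iInf _ |>.1 (h2 h3) j
    rw [LinearMap.mem_ker, map_sub, Module.Basis.coord_apply, Module.Basis.coord_apply, hc, hc,
      sub_eq_zero] at h4
    exact h4

end GrPresentation

end

/-! ### Algebras covered by the presented algebra: idempotents, quiver and associated graded module
-/

noncomputable section

open GrPresentation

/-- An algebra that is covered by the presented algebra: it has idempotents and a homomorphism from
the presented algebra that identify every indecomposable projective module with the presented
algebra, compatibly with the radical filtration. -/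
structure CoverData (K B : Type*) [Field K] [Ring B] [Algebra K B] where
  idem : Equiv.Perm (Fin 3) → B
  complete : CompleteOrthogonalIdempotents idem
  hom : GrPresentation K →ₐ[K] B
  idem_mul_hom : ∀ σ i,
    idem σ * hom (monomial K [i]) = hom (monomial K [i]) * idem (σ * arrowStep i)
  exists_hom : ∀ σ x, ∃ r, idem σ * x = idem σ * hom r
  mem_iff : ∀ σ n r, idem σ * hom r ∈ Ring.jacobson B ^ n ↔ r ∈ lengthFiltration K n

theorem RingEquiv.map_mem_jacobson_pow {B C : Type*} [Ring B] [Ring C] (f : B ≃+* C) {n : ℕ} {x : B}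
    (hx : x ∈ Ring.jacobson B ^ n) : f x ∈ Ring.jacobson C ^ n := by
  induction n generalizing x with
  | zero => rw [Submodule.pow_zero, Ideal.one_eq_top]; trivial
  | succ n ih =>
    rw [Ideal.IsTwoSided.pow_succ] at hx ⊢
    refine Submodule.smul_induction_on hx (fun a ha b hb => ?_) fun a b ha hb => ?_
    · rw [smul_eq_mul, map_mul]
      have : RingHomSurjective (f : B →+* C) := ⟨f.surjective⟩
      exact Ideal.mul_mem_mul (Ring.le_comap_jacobson (f : B →+* C) ha) (ih hb)
    · rw [map_add]; exact add_mem ha hb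

theorem RingEquiv.map_mem_jacobson_pow_iff {B C : Type*} [Ring B] [Ring C] (f : B ≃+* C) {n : ℕ}
    {x : B} : f x ∈ Ring.jacobson C ^ n ↔ x ∈ Ring.jacobson B ^ n :=
  ⟨fun h => by simpa using f.symm.map_mem_jacobson_pow h, f.map_mem_jacobson_pow⟩

/-- Conjugation with a unit. -/
def Units.conjAlgEquiv (K : Type*) {B : Type*} [Field K] [Ring B] [Algebra K B] (u : Bˣ) :
    B ≃ₐ[K] B where
  toFun x := u * x * ↑u⁻¹
  invFun x := ↑u⁻¹ * x * u
  left_inv x := by simp [mul_assoc]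
  right_inv x := by simp [mul_assoc]
  map_mul' x y := by simp [mul_assoc]
  map_add' x y := by rw [mul_add, add_mul]
  commutes' k := by rw [← Algebra.commutes, mul_assoc, Units.mul_inv, mul_one]

namespace CoverData

variable {K B : Type*} [Field K] [Ring B] [Algebra K B] (D : CoverData K B)

theorem idem_mul_idem (σ : Equiv.Perm (Fin 3)) : D.idem σ * D.idem σ = D.idem σ :=
  D.complete.idem σ

/-- Renumbering of the vertices by a left translation. -/
def translate (ρ : Equiv.Perm (Fin 3)) : CoverData K B where
  idem σ := D.idem (ρ * σ)
  complete := (CompleteOrthogonalIdempotents.equiv (Equiv.mulLeft ρ)).2 D.complete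
  hom := D.hom
  idem_mul_hom σ i := by rw [D.idem_mul_hom, mul_assoc]
  exists_hom σ := D.exists_hom (ρ * σ)
  mem_iff σ := D.mem_iff (ρ * σ)

/-- Transport along an isomorphism of algebras. -/
def map {C : Type*} [Ring C] [Algebra K C] (f : B ≃ₐ[K] C) : CoverData K C where
  idem σ := f (D.idem σ)
  complete := D.complete.map f.toRingEquiv.toRingHom
  hom := f.toAlgHom.comp D.hom
  idem_mul_hom σ i := by
    change f (D.idem σ) * f (D.hom _) = f (D.hom _) * f (D.idem _)
    rw [← map_mul, D.idem_mul_hom, map_mul]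
  exists_hom σ x := by
    obtain ⟨r, hr⟩ := D.exists_hom σ (f.symm x)
    refine ⟨r, ?_⟩
    change f (D.idem σ) * x = f (D.idem σ) * f (D.hom r)
    rw [← map_mul, ← hr, map_mul, AlgEquiv.apply_symm_apply]
  mem_iff σ n r := by
    rw [← D.mem_iff σ]
    change f (D.idem σ) * f (D.hom r) ∈ _ ↔ _
    rw [← map_mul]
    exact f.toRingEquiv.map_mem_jacobson_pow_iff

theorem eq_of_idem_mul {x y : B} (h : ∀ σ, D.idem σ * x = D.idem σ * y) : x = y := by
  rw [← one_mul x, ← one_mul y, ← D.complete.complete, Finset.sum_mul, Finset.sum_mul]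
  exact Finset.sum_congr rfl fun σ _ => h σ

theorem jacobson_pow_eq_bot (D : CoverData K B) : Ring.jacobson B ^ 7 = ⊥ := by
  rw [eq_bot_iff]
  intro x hx
  refine D.eq_of_idem_mul fun σ => ?_
  obtain ⟨r, hr⟩ := D.exists_hom σ x
  have h : D.idem σ * D.hom r ∈ Ring.jacobson B ^ 7 := hr ▸ Ideal.mul_mem_left _ _ hx
  rw [D.mem_iff, lengthFiltration_eq_bot le_rfl, Submodule.mem_bot] at h
  rw [hr, h, map_zero]

theorem isNilpotent_of_mem (D : CoverData K B) {x : B} (hx : x ∈ Ring.jacobson B) :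
    IsNilpotent x := by
  refine ⟨7, ?_⟩
  have := Ideal.pow_mem_pow hx 7
  rwa [D.jacobson_pow_eq_bot] at this

theorem eq_zero_of_isIdempotentElem (D : CoverData K B) {x : B}
    (hx : x ∈ Ring.jacobson B) (h : IsIdempotentElem x) :
    x = 0 := by
  obtain ⟨n, hn⟩ := D.isNilpotent_of_mem hx
  rw [← h.pow_succ_eq n, pow_succ, hn, zero_mul]

/-- Modulo the radical, `D.idem σ * B` is spanned by `D.idem σ`; the coefficient is the augmentation
of a representative in the presented algebra. -/
theorem exists_coeff (σ : Equiv.Perm (Fin 3)) (x : B) :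
    ∃ c : K, D.idem σ * x - c • D.idem σ ∈ Ring.jacobson B := by
  obtain ⟨r, hr⟩ := D.exists_hom σ x
  refine ⟨augmentation K r, ?_⟩
  have h := (D.mem_iff σ 1 _).2 (sub_augmentation_mem r)
  rw [Submodule.pow_one, map_sub, mul_sub, ← hr, AlgHom.commutes, ← Algebra.commutes,
    ← Algebra.smul_def] at h
  exact h

theorem idem_notMem (σ : Equiv.Perm (Fin 3)) : D.idem σ ∉ Ring.jacobson B := by
  intro h
  have h1 : D.idem σ * D.hom 1 ∈ Ring.jacobson B ^ 1 := by rwa [map_one, mul_one, Submodule.pow_one]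
  rw [D.mem_iff] at h1
  simpa using augmentation_eq_zero h1

theorem eq_zero_of_smul_mem (σ : Equiv.Perm (Fin 3)) {c : K}
    (h : c • D.idem σ ∈ Ring.jacobson B) : c = 0 := by
  by_contra hne
  refine D.idem_notMem σ ?_
  have := ((Ring.jacobson B).restrictScalars K).smul_mem c⁻¹ h
  rwa [smul_smul, inv_mul_cancel₀ hne, one_smul] at this

/-- Modulo the radical an idempotent `f` below `D.idem σ` is a multiple `c • D.idem σ` with `c * c =
c`. According to the value of `c`, either `f` or `D.idem σ - f` is an idempotent in the nilpotent
radical, hence zero. -/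
theorem isPrimitiveIdempotent (σ : Equiv.Perm (Fin 3)) : IsPrimitiveIdempotent (D.idem σ) where
  idem := D.idem_mul_idem σ
  ne_zero h := D.idem_notMem σ (h ▸ zero_mem _)
  eq_or_eq f hf h₁ h₂ := by
    obtain ⟨c, hc⟩ := D.exists_coeff σ f
    rw [h₁] at hc
    have h₃ : (c * c - c) • D.idem σ ∈ Ring.jacobson B := by
      have h₄ : (c * c - c) • D.idem σ
          = (f - c • D.idem σ) - (f - c • D.idem σ) * f - c • D.idem σ * (f - c • D.idem σ) := by
        simp only [sub_mul, mul_sub, smul_mul_assoc, mul_smul_comm, h₁, hf.eq, sub_smul,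
          D.idem_mul_idem, mul_smul]
        abel
      rw [h₄]
      exact sub_mem (sub_mem hc (Ideal.mul_mem_right _ _ hc)) (Ideal.mul_mem_left _ _ hc)
    have h₅ : c * c - c = 0 := D.eq_zero_of_smul_mem σ h₃
    rcases mul_eq_zero.1 (by rw [← h₅]; ring : c * (c - 1) = 0) with h₆ | h₆
    · left
      rw [h₆, zero_smul, sub_zero] at hc
      exact D.eq_zero_of_isIdempotentElem hc hf
    · right
      rw [sub_eq_zero.1 h₆, one_smul, ← neg_mem_iff, neg_sub] at hc
      refine (sub_eq_zero.1 (D.eq_zero_of_isIdempotentElem hc ?_)).symm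
      rw [IsIdempotentElem, sub_mul, mul_sub, mul_sub, h₁, h₂, hf.eq, D.idem_mul_idem, sub_self,
        sub_zero]

/-- Every primitive idempotent is conjugate to one of the given idempotents. -/
theorem exists_conj (D : CoverData K B) {e : B} (he : IsPrimitiveIdempotent e) :
    ∃ (σ : Equiv.Perm (Fin 3)) (u : Bˣ), e = u * D.idem σ * ↑u⁻¹ := by
  choose c hc using fun x σ => D.exists_coeff σ x
  -- The coefficients also describe multiplication from the other side, because the idempotents are
  -- orthogonal.
  have hr (x : B) (σ) : x * D.idem σ - c x σ • D.idem σ ∈ Ring.jacobson B := by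
    have h : x * D.idem σ - c x σ • D.idem σ
        = ∑ τ, (D.idem τ * x - c x τ • D.idem τ) * D.idem σ := by
      simp_rw [sub_mul, smul_mul_assoc, Finset.sum_sub_distrib]
      rw [← Finset.sum_mul, ← Finset.sum_mul, D.complete.complete, one_mul,
        Finset.sum_eq_single σ (fun τ _ hτ => by rw [D.complete.ortho hτ, smul_zero]) (by simp),
        D.idem_mul_idem]
    rw [h]
    exact sum_mem fun τ _ => Ideal.mul_mem_right _ _ (hc x τ)
  have he₀ : e ∉ Ring.jacobson B := fun h => he.ne_zero (D.eq_zero_of_isIdempotentElem h he.idem)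
  obtain ⟨σ, hσ⟩ : ∃ σ, c e σ ≠ 0 := by
    by_contra! h
    refine he₀ ?_
    rw [← one_mul e, ← D.complete.complete, Finset.sum_mul]
    refine sum_mem fun σ _ => ?_
    simpa [h σ] using hc e σ
  let E := D.idem σ
  have hE : E * E = E := D.idem_mul_idem σ
  let k := c e σ
  -- Thus `E * e * E = k • (E - n)` with `n` nilpotent, so `E * e * E` is invertible in the corner
  -- ring of `E`.
  let n := E - k⁻¹ • (E * e * E)
  have hEn : E * n = n := by simp only [n, mul_sub, mul_smul_comm, ← mul_assoc, hE]
  have hnE : n * E = n := by simp only [n, sub_mul, smul_mul_assoc, mul_assoc, hE]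
  have hn : n ∈ Ring.jacobson B := by
    have h : n = -(k⁻¹ • ((E * e - k • E) * E)) := by
      rw [sub_mul, smul_sub, smul_mul_assoc, hE, smul_smul, inv_mul_cancel₀ hσ, one_smul, neg_sub]
    rw [h, neg_mem_iff]
    exact ((Ring.jacobson B).restrictScalars K).smul_mem _ (Ideal.mul_mem_right _ _ (hc e σ))
  obtain ⟨v, hv⟩ := (D.isNilpotent_of_mem hn).isUnit_one_sub
  have hvE : Commute (v : B) E := by
    rw [hv]; exact (Commute.one_left E).sub_left (hnE.trans hEn.symm)
  have hvE' : Commute (↑v⁻¹ : B) E := hvE.units_inv_left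
  have hEeE : E * e * E = k • (v * E) := by
    rw [hv, sub_mul, one_mul, hnE, sub_sub_cancel, smul_smul, mul_inv_cancel₀ hσ, one_smul]
  -- The inverse of `E * e * E` in the corner ring. It makes `e * w * e` a nonzero idempotent below
  -- `e`, which is `e` by primitivity.
  let w := k⁻¹ • (↑v⁻¹ * E)
  have hw : w * (E * e * E) = E := by
    rw [hEeE, smul_mul_smul_comm, inv_mul_cancel₀ hσ, one_smul, hvE.eq, mul_assoc, ← mul_assoc E,
      hE, ← hvE.eq, ← mul_assoc, Units.inv_mul, one_mul]
  have hwE : w * E = w := by simp only [w, smul_mul_assoc, mul_assoc, hE]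
  have hEw : E * w = w := by
    simp only [w, mul_smul_comm]
    rw [← mul_assoc, ← hvE'.eq, mul_assoc, hE]
  have hf : e * w * e = e := by
    have h₁ : e * w * e * (e * w * e) = e * w * e := by
      calc e * w * e * (e * w * e) = e * ((w * E) * (e * e) * (E * w)) * e := by
            rw [hwE, hEw]; simp only [mul_assoc]
        _ = e * ((w * (E * e * E)) * w) * e := by rw [he.idem.eq]; simp only [mul_assoc]
        _ = e * w * e := by rw [hw, hEw]
    rcases he.eq_or_eq (e * w * e) h₁ (by simp only [← mul_assoc, he.idem.eq])
      (by simp only [mul_assoc, he.idem.eq]) with h | h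
    · exfalso
      have h₂ : E * e * E = E * (e * w * e) * E := by
        calc E * e * E = (E * e * E) * (w * (E * e * E)) := by rw [hw, mul_assoc (E * e), hE]
          _ = E * (e * ((E * w) * E) * e) * E := by simp only [mul_assoc]
          _ = _ := by rw [hEw, hwE]
      rw [h, mul_zero, zero_mul] at h₂
      rw [h₂, mul_zero] at hw
      exact (D.isPrimitiveIdempotent σ).ne_zero hw.symm
    · exact h
  -- Modulo the radical `E` absorbs neighbouring factors up to their coefficients: `e = e * w * e`
  -- is congruent to `c w σ • (e * E * e)`, and this to a multiple of `E`.
  obtain ⟨t, ht⟩ : ∃ t : K, e - t • E ∈ Ring.jacobson B := by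
    refine ⟨c w σ * c e σ * c e σ, ?_⟩
    have h : e - (c w σ * c e σ * c e σ) • E = e * (w * E - c w σ • E) * e
        + c w σ • ((e * E - c e σ • E) * e) + (c w σ * c e σ) • (E * e - c e σ • E) := by
      rw [hwE]
      simp only [mul_sub, sub_mul, smul_sub, mul_smul_comm, smul_mul_assoc, hf, mul_smul]
      abel
    rw [h]
    refine add_mem (add_mem (Ideal.mul_mem_right _ _ (Ideal.mul_mem_left _ _ (hr w σ))) ?_) ?_
    · exact ((Ring.jacobson B).restrictScalars K).smul_mem _ (Ideal.mul_mem_right _ _ (hr e σ))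
    · exact ((Ring.jacobson B).restrictScalars K).smul_mem _ (hc e σ)
  have ht₁ : t = 1 := by
    have h : (t - t * t) • E = (e - t • E) * e + t • (E * (e - t • E)) - (e - t • E) := by
      simp only [mul_sub, sub_mul, smul_sub, mul_smul_comm, smul_mul_assoc, he.idem.eq, mul_smul,
        sub_smul, hE]
      abel
    have h₁ : t - t * t = 0 := D.eq_zero_of_smul_mem σ (h ▸ sub_mem (add_mem
      (Ideal.mul_mem_right _ _ ht) (((Ring.jacobson B).restrictScalars K).smul_mem _
        (Ideal.mul_mem_left _ _ ht))) ht)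
    have h₂ : t ≠ 0 := by
      rintro rfl
      rw [zero_smul, sub_zero] at ht
      exact he₀ ht
    exact (mul_left_cancel₀ h₂ (by rw [mul_one]; exact sub_eq_zero.1 h₁)).symm
  rw [ht₁, one_smul] at ht
  -- The standard intertwiner of two idempotents: it satisfies `e * u = u * E`, and it is invertible
  -- since it differs from 1 by a radical element.
  obtain ⟨u, hu⟩ : IsUnit (e * E + (1 - e) * (1 - E)) := by
    have h : 1 - ((e - E) * (1 - E) - (e - E) * E) = e * E + (1 - e) * (1 - E) := by
      simp only [mul_sub, sub_mul, mul_one, one_mul, hE]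
      abel
    rw [← h]
    exact (D.isNilpotent_of_mem (sub_mem (Ideal.mul_mem_right _ _ ht)
      (Ideal.mul_mem_right _ _ ht))).isUnit_one_sub
  refine ⟨σ, u, ?_⟩
  have h₁ : e * (1 - e) = 0 := by rw [mul_sub, mul_one, he.idem.eq, sub_self]
  have h₂ : (1 - E) * E = 0 := by rw [sub_mul, one_mul, hE, sub_self]
  rw [Units.eq_mul_inv_iff_mul_eq, hu]
  change e * (e * E + (1 - e) * (1 - E)) = (e * E + (1 - e) * (1 - E)) * E
  rw [mul_add, add_mul, ← mul_assoc, ← mul_assoc, h₁, he.idem.eq, zero_mul, mul_assoc, mul_assoc,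
    h₂, hE, mul_zero]

/-- The realisation of the quiver. -/
def toQuiverRealization : QuiverRealization K (D.idem 1) where
  idem := D.idem
  complete := D.complete
  primitive := D.isPrimitiveIdempotent
  idem_one := rfl
  arrow i σ := D.idem σ * D.hom (monomial K [i])
  arrow_mem i σ := by
    have := (D.mem_iff σ 1 (monomial K [i])).2 (monomial_mem_lengthFiltration le_rfl)
    rwa [Submodule.pow_one] at this
  idem_mul_arrow i σ := by rw [← mul_assoc, D.idem_mul_idem]
  arrow_mul_idem i σ := by rw [mul_assoc, ← D.idem_mul_hom, ← mul_assoc, D.idem_mul_idem]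
  basis σ x hx := by
    obtain ⟨r, hr⟩ := D.exists_hom σ x
    have hr₁ : r ∈ lengthFiltration K 1 := by
      rw [← D.mem_iff σ, ← hr, Submodule.pow_one]
      exact Ideal.mul_mem_left _ _ hx
    have h (c : Fin 3 → K) :
        D.idem σ * x - ∑ i, c i • (D.idem σ * D.hom (monomial K [i])) ∈ Ring.jacobson B ^ 2 ↔
          r - ∑ i, c i • monomial K [i] ∈ lengthFiltration K 2 := by
      rw [← D.mem_iff σ, hr, map_sub, map_sum, mul_sub, Finset.mul_sum]
      simp_rw [map_smul, mul_smul_comm]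
    simp_rw [h]
    exact existsUnique_letter_coefficients hr₁

/-- The idempotent in front of the remaining path can be moved to the left across the first letter,
where it becomes `D.idem σ` again and is absorbed. -/
theorem path_eq (σ : Equiv.Perm (Fin 3)) (w : List (Fin 3)) :
    D.toQuiverRealization.path σ w = D.idem σ * D.hom (monomial K w) := by
  induction w generalizing σ with
  | nil => rw [monomial_nil, map_one, mul_one]; rfl
  | cons i w ih =>
    rw [QuiverRealization.path, ih]
    change D.idem σ * D.hom (monomial K [i]) * _ = _
    rw [← mul_assoc, mul_assoc (D.idem σ), ← D.idem_mul_hom, ← mul_assoc, D.idem_mul_idem,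
      monomial_cons K i w, map_mul, mul_assoc]

theorem mem_projFiltration (n : ℕ) (r : GrPresentation K) :
    D.idem 1 * D.hom r ∈ projFiltration K (D.idem 1) n ↔ r ∈ lengthFiltration K n := by
  rw [← D.mem_iff 1]
  constructor
  · rintro ⟨z, hz, h⟩
    rw [← h]
    exact Ideal.mul_mem_left _ _ hz
  · intro h
    refine ⟨_, h, ?_⟩
    rw [LinearMap.mulLeft_apply, ← mul_assoc, D.idem_mul_idem]

/-- The identification of a step of the filtration. -/
def toPiece (n : ℕ) : lengthFiltration K n →ₗ[K] GrProjPiece K (D.idem 1) n :=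
  (Submodule.mkQ _) ∘ₗ LinearMap.codRestrict (projFiltration K (D.idem 1) n)
    ((LinearMap.mulLeft K (D.idem 1)) ∘ₗ D.hom.toLinearMap ∘ₗ (lengthFiltration K n).subtype)
    fun r => (D.mem_projFiltration n r).2 r.2

theorem toPiece_eq_zero_iff (n : ℕ) (r : lengthFiltration K n) :
    D.toPiece n r = 0 ↔ (r : GrPresentation K) ∈ lengthFiltration K (n + 1) := by
  rw [← D.mem_projFiltration]
  exact Submodule.Quotient.mk_eq_zero _

theorem toPiece_surjective (n : ℕ) : Function.Surjective (D.toPiece n) := by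
  intro y
  obtain ⟨⟨y, hy⟩, rfl⟩ := Submodule.Quotient.mk_surjective _ y
  obtain ⟨z, hz, rfl⟩ := id hy
  obtain ⟨r, hr⟩ := D.exists_hom 1 z
  have h : LinearMap.mulLeft K (D.idem 1) z = D.idem 1 * D.hom r := hr
  have hr' : r ∈ lengthFiltration K n := by
    rw [← D.mem_projFiltration, ← h]
    exact hy
  exact ⟨⟨r, hr'⟩, congrArg (Submodule.mkQ _) (Subtype.ext h.symm)⟩

theorem grClass_eq_zero {e x : B} {n : ℕ} {hx : x ∈ projFiltration K e n} (h : x = 0) :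
    grClass K e n x hx = 0 := by
  subst h
  exact map_zero (DirectSum.of (fun n => GrProjPiece K e n) n)

/-- The map from the presented algebra to the associated graded module. -/
def toGrProj : GrPresentation K →ₗ[K] GrProj K (D.idem 1) :=
  -- Both sides vanish in degrees 7 and above, so a finite sum suffices.
  ∑ n ∈ Finset.range 7, DirectSum.lof K ℕ (fun n => GrProjPiece K (D.idem 1) n) n ∘ₗ D.toPiece n ∘ₗ
    LinearMap.codRestrict (lengthFiltration K n) (component K n) (component_mem n)

theorem toGrProj_apply (r : GrPresentation K) : D.toGrProj r =
    ∑ n ∈ Finset.range 7, DirectSum.of (fun n => GrProjPiece K (D.idem 1) n) n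
      (D.toPiece n ⟨component K n r, component_mem n r⟩) := by
  rw [toGrProj, LinearMap.sum_apply]
  rfl

theorem toGrProj_component {n : ℕ} (hn : n < 7) (r : GrPresentation K) :
    D.toGrProj (component K n r) = DirectSum.of (fun n => GrProjPiece K (D.idem 1) n) n
      (D.toPiece n ⟨component K n r, component_mem n r⟩) := by
  rw [toGrProj_apply, Finset.sum_eq_single n]
  · simp_rw [component_component, if_true]
  · intro m _ hm
    simp_rw [component_component, if_neg hm.symm]
    rw [show (⟨0, _⟩ : lengthFiltration K m) = 0 from rfl, map_zero, map_zero]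
  · simp [hn]

theorem toGrProj_monomial (w : List (Fin 3)) (h) :
    D.toGrProj (monomial K w)
      = grClass K (D.idem 1) w.length (D.idem 1 * D.hom (monomial K w)) h := by
  by_cases hw : w.length < 7
  · have hc : component K w.length (monomial K w) = monomial K w := by
      rw [component_monomial, if_pos rfl]
    have := D.toGrProj_component hw (monomial K w)
    simp_rw [hc] at this
    exact this
  · have hc := monomial_eq_zero_of_length K (not_lt.1 hw)
    rw [grClass_eq_zero (by rw [hc, map_zero, mul_zero]), hc, map_zero]

theorem toGrProj_injective : Function.Injective D.toGrProj := by
  rw [injective_iff_map_eq_zero]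
  intro r hr
  rw [← sum_component r]
  refine Finset.sum_eq_zero fun n hn => ?_
  rw [toGrProj_apply] at hr
  have h := congrArg (DirectSum.component K ℕ (fun n => GrProjPiece K (D.idem 1) n) n) hr
  rw [map_sum, map_zero, Finset.sum_eq_single n] at h
  · change DirectSum.of (fun n => GrProjPiece K (D.idem 1) n) n _ n = 0 at h
    rw [DirectSum.of_eq_same, toPiece_eq_zero_iff] at h
    have := component_eq_zero h
    rwa [component_component, if_pos rfl] at this
  · intro m _ hm
    exact DirectSum.of_eq_of_ne _ _ _ hm.symm
  · exact fun h' => absurd hn h'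

theorem toGrProj_surjective : Function.Surjective D.toGrProj := by
  intro y
  induction y using DirectSum.induction_on with
  | zero => exact ⟨0, map_zero _⟩
  | of n y =>
    obtain ⟨r, rfl⟩ := D.toPiece_surjective n y
    by_cases hn : n < 7
    · refine ⟨component K n r, ?_⟩
      rw [toGrProj_component D hn]
      congr 1
      rw [← sub_eq_zero, ← map_sub, toPiece_eq_zero_iff, ← neg_mem_iff]
      change -(component K n r - (r : GrPresentation K)) ∈ _
      rw [neg_sub]
      exact sub_component_mem r.2
    · refine ⟨0, ?_⟩
      have : r = 0 := Subtype.ext ((lengthFiltration_eq_bot (not_lt.1 hn)).le r.2)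
      rw [this, map_zero, map_zero, map_zero]
  | add x y hx hy =>
    obtain ⟨r, rfl⟩ := hx
    obtain ⟨s, rfl⟩ := hy
    exact ⟨r + s, map_add _ _ _⟩

/-- The associated graded module of an indecomposable projective module. -/
def grEquiv : GrPresentation K ≃ₗ[K] GrProj K (D.idem 1) :=
  LinearEquiv.ofBijective D.toGrProj ⟨D.toGrProj_injective, D.toGrProj_surjective⟩

/-- The cover data can be adapted to `e`: `e` is conjugate to the idempotent at some vertex, and a
left translation moves that vertex to 1. Left translations are compatible with the arrows, which
multiply vertices on the right. -/
theorem exists_quiverRealization (D : CoverData K B) {e : B} (he : IsPrimitiveIdempotent e) :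
    ∃ (Q : QuiverRealization K e) (Φ : GrPresentation K ≃ₗ[K] GrProj K e),
      ∀ w : List (Fin 3),
        Φ (GrPresentation.monomial K w) = grClass K e w.length (Q.path 1 w) (Q.path_mem w) := by
  obtain ⟨D', rfl⟩ : ∃ D' : CoverData K B, D'.idem 1 = e := by
    obtain ⟨σ, u, rfl⟩ := D.exists_conj he
    exact ⟨(D.translate σ).map (u.conjAlgEquiv K), congrArg (fun τ => ↑u * D.idem τ * ↑u⁻¹)
      (mul_one σ)⟩
  refine ⟨D'.toQuiverRealization, D'.grEquiv, fun w => ?_⟩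
  change D'.toGrProj _ = _
  rw [D'.toGrProj_monomial w ((D'.mem_projFiltration _ _).2 (monomial_mem_lengthFiltration le_rfl))]
  simp_rw [path_eq]

end CoverData

end

/-! ### Recognition of covered algebras -/

noncomputable section

open GrPresentation

theorem GrPresentation.mul_mem_lengthFiltration {K : Type*} [Field K] {m n : ℕ}
    {r s : GrPresentation K} (hr : r ∈ lengthFiltration K m) (hs : s ∈ lengthFiltration K n) :
    r * s ∈ lengthFiltration K (m + n) := by
  have h := Submodule.mul_mem_mul hr hs
  rw [lengthFiltration, lengthFiltration, Submodule.span_mul_span] at h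
  refine Submodule.span_mono ?_ h
  rintro _ ⟨_, ⟨v, hv, rfl⟩, _, ⟨w, hw, rfl⟩, rfl⟩
  exact ⟨v ++ w, by rw [List.length_append]; lia, monomial_append K v w⟩

section Construction

variable {K B : Type*} [Field K] [Ring B] [Algebra K B] {E : Equiv.Perm (Fin 3) → B}
  {G : GrPresentation K →ₐ[K] B}

theorem idem_mul_hom_monomial
    (hEG : ∀ σ i, E σ * G (monomial K [i]) = G (monomial K [i]) * E (σ * arrowStep i))
    (σ : Equiv.Perm (Fin 3)) (w : List (Fin 3)) :
    E σ * G (monomial K w) = G (monomial K w) * E (σ * wordEnd w) := by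
  induction w generalizing σ with
  | nil => simp
  | cons i w ih =>
    rw [monomial_cons, map_mul, ← mul_assoc, hEG, mul_assoc, ih, wordEnd_cons, mul_assoc, mul_assoc]

/-- By linearity `r` may be taken to be a word `w`. Moving `E σ` across `w` turns it into the
idempotent at the end of `w`, where the expression for `x` at that vertex applies. Lengths add up,
so the same argument serves the closure under products and the radical filtration. -/
theorem exists_mul_eq
    (hEG : ∀ σ i, E σ * G (monomial K [i]) = G (monomial K [i]) * E (σ * arrowStep i))
    {m n : ℕ} {r : GrPresentation K} (hr : r ∈ lengthFiltration K m) {x : B}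
    (hx : ∀ σ, ∃ s ∈ lengthFiltration K n, E σ * x = E σ * G s) (σ : Equiv.Perm (Fin 3)) :
    ∃ s ∈ lengthFiltration K (m + n), E σ * G r * x = E σ * G s := by
  induction hr using Submodule.span_induction with
  | mem r hr =>
    obtain ⟨w, hw, rfl⟩ := hr
    obtain ⟨s, hs, h⟩ := hx (σ * wordEnd w)
    refine ⟨monomial K w * s, mul_mem_lengthFiltration (monomial_mem_lengthFiltration hw) hs, ?_⟩
    rw [idem_mul_hom_monomial hEG, mul_assoc, h, map_mul, ← mul_assoc, ← mul_assoc,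
      idem_mul_hom_monomial hEG]
  | zero => exact ⟨0, zero_mem _, by simp⟩
  | add r r' _ _ h h' =>
    obtain ⟨s, hs, h⟩ := h
    obtain ⟨s', hs', h'⟩ := h'
    exact ⟨s + s', add_mem hs hs', by rw [map_add, map_add, mul_add, mul_add, add_mul, h, h']⟩
  | smul c r _ h =>
    obtain ⟨s, hs, h⟩ := h
    exact ⟨c • s, Submodule.smul_mem _ c hs, by
      rw [map_smul, map_smul, mul_smul_comm, mul_smul_comm, smul_mul_assoc, h]⟩

variable (hE : CompleteOrthogonalIdempotents E)
  (hEG : ∀ σ i, E σ * G (monomial K [i]) = G (monomial K [i]) * E (σ * arrowStep i))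

/-- The subalgebra generated by the idempotents and the image of the presented algebra. -/
def coverSubalgebra : Subalgebra K B where
  carrier := {x | ∀ σ, ∃ r, E σ * x = E σ * G r}
  mul_mem' {x y} hx hy σ := by
    obtain ⟨r, hr⟩ := hx σ
    obtain ⟨s, -, hs⟩ := exists_mul_eq hEG (mem_lengthFiltration_zero r) (n := 0)
      (fun τ => let ⟨s, hs⟩ := hy τ; ⟨s, mem_lengthFiltration_zero s, hs⟩) σ
    exact ⟨s, by rw [← mul_assoc, hr, hs]⟩
  add_mem' {x y} hx hy σ := by
    obtain ⟨r, hr⟩ := hx σ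
    obtain ⟨s, hs⟩ := hy σ
    exact ⟨r + s, by rw [mul_add, hr, hs, map_add, mul_add]⟩
  algebraMap_mem' k σ := ⟨algebraMap K _ k, by rw [AlgHom.commutes]⟩

variable (hgen : ∀ σ x, ∃ r, E σ * x = E σ * G r) (hinj : ∀ σ r, E σ * G r = 0 → r = 0)

include hEG in
theorem exists_mem_mul_eq {m n : ℕ} {x y : B}
    (hx : ∀ σ, ∃ s ∈ lengthFiltration K m, E σ * x = E σ * G s)
    (hy : ∀ σ, ∃ s ∈ lengthFiltration K n, E σ * y = E σ * G s) (σ : Equiv.Perm (Fin 3)) :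
    ∃ s ∈ lengthFiltration K (m + n), E σ * (x * y) = E σ * G s := by
  obtain ⟨r, hr, h⟩ := hx σ
  rw [← mul_assoc, h]
  exact exists_mul_eq hEG hr hy σ

include hE hEG hgen hinj in
-- Elements all of whose components have length at least 1 form an ideal, and seven factors of this
-- kind multiply to zero, so they lie in the radical. Conversely, a radical element with nonzero
-- augmentation at `σ` would put `E σ` into the radical; an idempotent there is zero, which
-- contradicts `hinj` for `r = 1`.
theorem mem_jacobson_iff_of_cover (x : B) :
    x ∈ Ring.jacobson B ↔ ∀ σ, ∃ s ∈ lengthFiltration K 1, E σ * x = E σ * G s := by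
  have h₀ (y : B) (σ) : ∃ s ∈ lengthFiltration K 0, E σ * y = E σ * G s :=
    let ⟨s, hs⟩ := hgen σ y; ⟨s, mem_lengthFiltration_zero s, hs⟩
  have hJ : ∀ x, (∀ σ, ∃ s ∈ lengthFiltration K 1, E σ * x = E σ * G s) → x ∈ Ring.jacobson B := by
    intro x hx
    rw [← Ideal.jacobson_bot, Ideal.mem_jacobson_iff]
    intro y
    have h₁ (n : ℕ) : ∀ σ, ∃ s ∈ lengthFiltration K n, E σ * (-(y * x)) ^ n = E σ * G s := by
      induction n with
      | zero => rw [pow_zero]; exact h₀ 1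
      | succ n ih =>
        rw [pow_succ, ← neg_mul]
        rw [← neg_mul] at ih
        refine exists_mem_mul_eq hEG ih ?_
        have := exists_mem_mul_eq hEG (h₀ (-y)) hx
        rwa [zero_add] at this
    have h₂ : (-(y * x)) ^ 7 = 0 := by
      rw [← one_mul (_ ^ 7), ← hE.complete, Finset.sum_mul]
      refine Finset.sum_eq_zero fun σ _ => ?_
      obtain ⟨s, hs, h⟩ := h₁ 7 σ
      rw [lengthFiltration_eq_bot le_rfl, Submodule.mem_bot] at hs
      rw [h, hs, map_zero, mul_zero]
    obtain ⟨u, hu⟩ := IsNilpotent.isUnit_one_sub ⟨7, h₂⟩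
    refine ⟨↑u⁻¹, ?_⟩
    rw [Submodule.mem_bot, mul_assoc, sub_eq_zero]
    calc ↑u⁻¹ * (y * x) + ↑u⁻¹ = ↑u⁻¹ * (1 - -(y * x)) := by
          rw [sub_neg_eq_add, mul_add, mul_one, add_comm]
      _ = 1 := by rw [← hu, Units.inv_mul]
  refine ⟨fun hx σ => ?_, hJ x⟩
  obtain ⟨r, hr⟩ := hgen σ x
  have hc : augmentation K r = 0 := by
    by_contra hne
    have h₁ : E σ * x - augmentation K r • E σ ∈ Ring.jacobson B := by
      refine hJ _ fun τ => ?_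
      rcases eq_or_ne τ σ with rfl | hτ
      · refine ⟨_, sub_augmentation_mem r, ?_⟩
        rw [hr, map_sub, AlgHom.commutes, mul_sub, mul_sub, mul_smul_comm, ← mul_assoc, hE.idem τ,
          ← Algebra.commutes, ← Algebra.smul_def]
      · refine ⟨0, zero_mem _, ?_⟩
        rw [mul_sub, mul_smul_comm, ← mul_assoc, hE.ortho hτ]
        simp
    have h₂ : E σ ∈ Ring.jacobson B := by
      have h₃ := sub_mem (Ideal.mul_mem_left _ (E σ) hx) h₁
      rw [sub_sub_cancel] at h₃
      have h₄ := ((Ring.jacobson B).restrictScalars K).smul_mem (augmentation K r)⁻¹ h₃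
      rwa [smul_smul, inv_mul_cancel₀ hne, one_smul] at h₄
    rw [← Ideal.jacobson_bot, Ideal.mem_jacobson_iff] at h₂
    obtain ⟨z, hz⟩ := h₂ (-1)
    rw [Submodule.mem_bot, sub_eq_zero] at hz
    have h₃ : E σ = 0 := by
      have h₄ := congrArg (· * E σ) hz
      simp only [mul_neg, mul_one, neg_mul, add_mul, mul_assoc, (hE.idem σ).eq, neg_add_cancel,
        one_mul] at h₄
      exact h₄.symm
    have h₄ : (1 : GrPresentation K) = 0 := hinj σ 1 (by rw [h₃, zero_mul])
    have h₅ := congrArg (augmentation K) h₄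
    rw [map_one, map_zero] at h₅
    exact one_ne_zero h₅
  refine ⟨r, ?_, hr⟩
  have := sub_augmentation_mem r
  rwa [hc, map_zero, sub_zero] at this

/-- The criterion used to recognise covered algebras. -/
def CoverData.ofInjective : CoverData K B where
  idem := E
  complete := hE
  hom := G
  idem_mul_hom := hEG
  exists_hom := hgen
  mem_iff σ n r := by
    have hJ := mem_jacobson_iff_of_cover hE hEG hgen hinj
    constructor
    · intro h
      -- A product of `n` radical elements has components of length at least `n`; by `hinj` the
      -- representative is unique, so `r` itself has that length.
      have h₁ : ∀ n, ∀ x ∈ Ring.jacobson B ^ n,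
          ∀ σ, ∃ s ∈ lengthFiltration K n, E σ * x = E σ * G s := by
        intro n
        induction n with
        | zero => exact fun x _ σ => let ⟨s, hs⟩ := hgen σ x; ⟨s, mem_lengthFiltration_zero s, hs⟩
        | succ n ih =>
          intro x hx
          rw [Ideal.IsTwoSided.pow_succ] at hx
          refine Submodule.smul_induction_on hx (fun a ha b hb => ?_) fun a b ha hb σ => ?_
          · rw [add_comm]
            exact exists_mem_mul_eq hEG ((hJ a).1 ha) (ih b hb)
          · obtain ⟨s, hs, h⟩ := ha σ
            obtain ⟨s', hs', h'⟩ := hb σ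
            exact ⟨s + s', add_mem hs hs', by rw [mul_add, h, h', map_add, mul_add]⟩
      obtain ⟨s, hs, h₂⟩ := h₁ n _ h σ
      rw [← mul_assoc, (hE.idem σ).eq] at h₂
      rwa [sub_eq_zero.1 (hinj σ (r - s) (by rw [map_sub, mul_sub, h₂, sub_self]))]
    · intro h
      -- A word of length at least `n` factors into a first letter, which lies in the radical, and a
      -- shorter word starting at the next vertex.
      have h₁ (n : ℕ) (σ) (w : List (Fin 3)) (hw : n ≤ w.length) :
          E σ * G (monomial K w) ∈ Ring.jacobson B ^ n := by
        induction n generalizing σ w with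
        | zero => rw [Submodule.pow_zero, Ideal.one_eq_top]; trivial
        | succ n ih =>
          obtain - | ⟨i, w⟩ := w
          · simp at hw
          · have h₂ : E σ * G (monomial K (i :: w))
                = E σ * G (monomial K [i]) * (E (σ * arrowStep i) * G (monomial K w)) := by
              rw [monomial_cons K i w, map_mul, ← mul_assoc (E σ * _), mul_assoc (E σ) _ (E _),
                ← hEG, ← mul_assoc (E σ) (E σ), (hE.idem σ).eq, mul_assoc]
            rw [h₂, Ideal.IsTwoSided.pow_succ]
            refine Ideal.mul_mem_mul ((hJ _).2 fun τ => ?_) (ih _ w (by simpa using hw))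
            rcases eq_or_ne τ σ with rfl | hτ
            · exact ⟨_, monomial_mem_lengthFiltration le_rfl, by rw [← mul_assoc, (hE.idem τ).eq]⟩
            · exact ⟨0, zero_mem _, by rw [← mul_assoc, hE.ortho hτ, map_zero, mul_zero, zero_mul]⟩
      suffices h₂ : lengthFiltration K n ≤ ((Ring.jacobson B ^ n).restrictScalars K).comap
          ((LinearMap.mulLeft K (E σ)) ∘ₗ G.toLinearMap) from h₂ h
      exact lengthFiltration_induction fun w hw => h₁ n σ w hw

end Construction

/-! ### Dimension and basicness of covered algebras -/

namespace CoverData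

variable {K B : Type*} [Field K] [Ring B] [Algebra K B] (D : CoverData K B)

theorem hom_injective (σ : Equiv.Perm (Fin 3)) {r : GrPresentation K}
    (h : D.idem σ * D.hom r = 0) : r = 0 := by
  have := (D.mem_iff σ 7 r).1 (h ▸ zero_mem _)
  rwa [lengthFiltration_eq_bot le_rfl, Submodule.mem_bot] at this

/-- The identification of the underlying vector space. -/
def linearEquiv : (Equiv.Perm (Fin 3) → GrPresentation K) ≃ₗ[K] B :=
  LinearEquiv.ofBijective
    (∑ σ, LinearMap.mulLeft K (D.idem σ) ∘ₗ D.hom.toLinearMap ∘ₗ LinearMap.proj σ) <| by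
    have h (f : Equiv.Perm (Fin 3) → GrPresentation K) (σ) :
        D.idem σ * ∑ τ, D.idem τ * D.hom (f τ) = D.idem σ * D.hom (f σ) := by
      rw [Finset.mul_sum, Finset.sum_eq_single σ]
      · rw [← mul_assoc, D.idem_mul_idem]
      · intro τ _ hτ
        rw [← mul_assoc, D.complete.ortho hτ.symm, zero_mul]
      · simp
    constructor
    · rw [injective_iff_map_eq_zero]
      intro f hf
      funext σ
      refine D.hom_injective σ ?_
      rw [← h, ← mul_zero (D.idem σ), ← hf, LinearMap.sum_apply]
      rfl
    · intro x
      choose f hf using fun σ => D.exists_hom σ x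
      refine ⟨f, D.eq_of_idem_mul fun σ => ?_⟩
      rw [hf, ← h, LinearMap.sum_apply]
      rfl

theorem finite (D : CoverData K B) : Module.Finite K B := by
  have : Module.Finite K (GrPresentation K) := Module.Finite.of_basis (normalBasis K)
  exact Module.Finite.equiv D.linearEquiv

/-- Six vertices, with 24 normal words starting at each of them. -/
theorem finrank_eq (D : CoverData K B) : Module.finrank K B = 144 := by
  rw [← D.linearEquiv.finrank_eq]
  have : Module.Finite K (GrPresentation K) := Module.Finite.of_basis (normalBasis K)
  rw [Module.finrank_pi_fintype, Finset.sum_const, Module.finrank_eq_card_basis (normalBasis K)]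
  rfl

/-- The coefficients from `exists_coeff` at the six vertices are characters; together they map onto
the product of six copies of `K`, with the radical as kernel. -/
theorem isBasicAlgebra (D : CoverData K B) : IsBasicAlgebra K B := by
  refine ⟨D.finite, Fintype.card (Equiv.Perm (Fin 3)), ?_⟩
  choose c hc using D.exists_coeff
  have hu (σ x) (k : K) (h : D.idem σ * x - k • D.idem σ ∈ Ring.jacobson B) : c σ x = k := by
    refine (sub_eq_zero.1 (D.eq_zero_of_smul_mem σ ?_)).symm
    rw [sub_smul]
    simpa using sub_mem (hc σ x) h
  let f : B →ₐ[K] (Equiv.Perm (Fin 3) → K) :=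
    { toFun := fun x σ => c σ x
      map_one' := by
        funext σ
        exact hu σ 1 1 (by simp)
      map_mul' := fun x y => by
        funext σ
        refine hu σ (x * y) (c σ x * c σ y) ?_
        have h : D.idem σ * (x * y) - (c σ x * c σ y) • D.idem σ
            = (D.idem σ * x - c σ x • D.idem σ) * y
              + c σ x • (D.idem σ * y - c σ y • D.idem σ) := by
          rw [sub_mul, smul_sub, smul_mul_assoc, mul_assoc, mul_smul]
          abel
        rw [h]
        exact add_mem (Ideal.mul_mem_right _ _ (hc σ x))
          (((Ring.jacobson B).restrictScalars K).smul_mem _ (hc σ y))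
      map_zero' := by
        funext σ
        exact hu σ 0 0 (by simp)
      map_add' := fun x y => by
        funext σ
        refine hu σ (x + y) (c σ x + c σ y) ?_
        rw [mul_add, add_smul, add_sub_add_comm]
        exact add_mem (hc σ x) (hc σ y)
      commutes' := fun k => by
        funext σ
        refine hu σ _ k ?_
        rw [← Algebra.commutes, ← Algebra.smul_def, sub_self]
        exact zero_mem _ }
  have hf : Function.Surjective f := by
    intro v
    refine ⟨∑ σ, v σ • D.idem σ, ?_⟩
    funext σ
    refine hu σ _ _ ?_
    rw [Finset.mul_sum, Finset.sum_eq_single σ]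
    · rw [mul_smul_comm, D.idem_mul_idem, sub_self]
      exact zero_mem _
    · intro τ _ hτ
      rw [mul_smul_comm, D.complete.ortho hτ.symm, smul_zero]
    · simp
  have hker : RingHom.ker f = Ring.jacobson B := by
    ext x
    rw [RingHom.mem_ker, funext_iff]
    constructor
    · intro h
      rw [← one_mul x, ← D.complete.complete, Finset.sum_mul]
      refine sum_mem fun σ _ => ?_
      have h₁ : c σ x = 0 := h σ
      simpa [h₁] using hc σ x
    · intro h σ
      exact hu σ x 0 (by rw [zero_smul, sub_zero]; exact Ideal.mul_mem_left _ _ h)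
  let g : (B ⧸ Ring.jacobson B) →ₐ[K] (Equiv.Perm (Fin 3) → K) :=
    Ideal.Quotient.liftₐ (Ring.jacobson B) f fun x hx => by rwa [← RingHom.mem_ker, hker]
  have hg : Function.Bijective g := by
    constructor
    · rw [injective_iff_map_eq_zero]
      intro x hx
      obtain ⟨x, rfl⟩ := Ideal.Quotient.mk_surjective x
      rw [Ideal.Quotient.eq_zero_iff_mem, ← hker]
      exact hx
    · intro v
      obtain ⟨x, rfl⟩ := hf v
      exact ⟨Ideal.Quotient.mk _ x, rfl⟩
  exact ⟨(AlgEquiv.ofBijective g hg).trans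
    (AlgEquiv.piCongrLeft K (fun _ => K) (Fintype.equivFin _))⟩

end CoverData

end

noncomputable section

open GrPresentation

/-! ### The cover of the presented algebra -/

namespace GrCover

variable (K : Type*) [Field K]

/-- Square matrices over the presented algebra, indexed by the vertices. -/
abbrev MatrixAlgebra : Type _ :=
  Matrix (Equiv.Perm (Fin 3)) (Equiv.Perm (Fin 3)) (GrPresentation K)

/-- The matrix of right multiplication by a word in the category of the cover. -/
def wordMatrix (w : List (Fin 3)) : MatrixAlgebra K :=
  Matrix.of fun σ τ => if τ = σ * wordEnd w then monomial K w else 0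

theorem wordMatrix_nil : wordMatrix K [] = 1 := by
  ext σ τ
  simp [wordMatrix, Matrix.one_apply, eq_comm]

theorem wordMatrix_append (v w : List (Fin 3)) :
    wordMatrix K (v ++ w) = wordMatrix K v * wordMatrix K w := by
  ext σ τ
  rw [Matrix.mul_apply, Finset.sum_eq_single (σ * wordEnd v)]
  · simp only [wordMatrix, Matrix.of_apply, if_true, wordEnd_append, ← mul_assoc, mul_ite, mul_zero,
      monomial_append]
  · intro ρ _ h
    simp [wordMatrix, h]
  · simp

theorem wordMatrix_apply (v w : List (Fin 3)) (h : wordEnd v = wordEnd w)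
    (σ τ : Equiv.Perm (Fin 3)) :
    wordMatrix K v σ τ = if τ = σ * wordEnd w then monomial K v else 0 := by
  rw [← h]
  rfl

/-- The homomorphism from the free algebra underlying `hom`. -/
def freeHom : FreeAlgebra K (Fin 3) →ₐ[K] MatrixAlgebra K :=
  FreeAlgebra.lift K fun i => wordMatrix K [i]

theorem freeHom_word (w : List (Fin 3)) :
    freeHom K (w.map (FreeAlgebra.ι K)).prod = wordMatrix K w := by
  induction w with
  | nil => simp [wordMatrix_nil]
  | cons i w ih =>
    rw [List.map_cons, List.prod_cons, map_mul, ih, freeHom, FreeAlgebra.lift_ι_apply,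
      ← wordMatrix_append, List.singleton_append]

/-- Within each relation all words have the same end point. This homogeneity is what makes the cover
exist. -/
theorem wordEnd_relations :
    wordEnd [0, 2] = 1 ∧ wordEnd [2, 0] = 1 ∧ (∀ i, wordEnd [i, i] = 1) ∧
    wordEnd [1, 0, 1] = wordEnd [0, 1, 0] ∧ wordEnd [0, 1, 2] = wordEnd [0, 1, 0] ∧
    wordEnd [2, 1, 0] = wordEnd [0, 1, 0] ∧ wordEnd [1, 2, 1] = wordEnd [0, 1, 0] ∧
    wordEnd [2, 1, 2] = wordEnd [0, 1, 0] := by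
  decide +kernel

theorem freeHom_rel {x y : FreeAlgebra K (Fin 3)} (h : GrRel K x y) :
    freeHom K x = freeHom K y := by
  have hw (l : List (Fin 3)) := freeHom_word K l
  obtain ⟨h₁, h₂, h₃, h₄, h₅, h₆, h₇, h₈⟩ := wordEnd_relations
  obtain t | - | - | - := h
  · have h := hw [t, t]
    simp only [List.map_cons, List.map_nil, List.prod_cons, List.prod_nil, mul_one] at h
    rw [h, map_zero]
    ext σ τ
    rw [wordMatrix_apply K _ [] (h₃ t), monomial_cons, sq_eq_zero]
    simp
  · have h := hw [0, 2]
    have h' := hw [2, 0]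
    simp only [List.map_cons, List.map_nil, List.prod_cons, List.prod_nil, mul_one] at h h'
    rw [map_sub, h, h', map_zero, sub_eq_zero]
    ext σ τ
    rw [wordMatrix_apply K _ [] h₁, wordMatrix_apply K _ [] h₂, monomial_cons K 0, comm_rel,
      monomial_cons K 2 [0]]
  · have h := hw [1, 0, 1]
    have h' := hw [0, 1, 2]
    have h'' := hw [2, 1, 0]
    simp only [List.map_cons, List.map_nil, List.prod_cons, List.prod_nil, mul_one] at h h' h''
    rw [map_sub, map_sub, mul_assoc, mul_assoc, mul_assoc, h, h', h'', map_zero, sub_sub,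
      sub_eq_zero]
    ext σ τ
    rw [Matrix.add_apply, wordMatrix_apply K _ _ h₄, wordMatrix_apply K _ _ h₅,
      wordMatrix_apply K _ _ h₆]
    split_ifs
    · simp_rw [monomial_cons K _ [_, _], monomial_cons K _ [_]]
      rw [cubic_rel₁, sub_add_cancel]
    · rw [add_zero]
  · have h := hw [1, 2, 1]
    have h' := hw [0, 1, 0]
    have h'' := hw [2, 1, 2]
    simp only [List.map_cons, List.map_nil, List.prod_cons, List.prod_nil, mul_one] at h h' h''
    rw [map_add, map_sub, mul_assoc, mul_assoc, mul_assoc, h, h', h'', map_zero, sub_add_eq_add_sub,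
      sub_eq_zero]
    ext σ τ
    rw [Matrix.add_apply, wordMatrix_apply K _ _ h₇, wordMatrix_apply K [0, 1, 0] _ rfl,
      wordMatrix_apply K _ _ h₈]
    split_ifs
    · simp_rw [monomial_cons K _ [_, _], monomial_cons K _ [_]]
      rw [cubic_rel₂]
    · rw [add_zero]

/-- The homomorphism from the presented algebra to its matrices. -/
def matrixHom : GrPresentation K →ₐ[K] MatrixAlgebra K :=
  RingQuot.liftAlgHom K ⟨freeHom K, fun _ _ h => freeHom_rel K h⟩

theorem matrixHom_monomial (w : List (Fin 3)) : matrixHom K (monomial K w) = wordMatrix K w := by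
  rw [matrixHom, monomial, RingQuot.liftAlgHom_mkAlgHom_apply, freeHom_word]

/-- The diagonal idempotents. -/
def matrixIdem (σ : Equiv.Perm (Fin 3)) : MatrixAlgebra K :=
  Matrix.diagonal (Pi.single σ 1)

theorem completeOrthogonalIdempotents_matrixIdem :
    CompleteOrthogonalIdempotents (matrixIdem K) where
  idem σ := by
    rw [IsIdempotentElem, matrixIdem, Matrix.diagonal_mul_diagonal]
    refine congrArg Matrix.diagonal (funext fun τ => ?_)
    simp +contextual [Pi.single_apply]
  ortho σ τ h := by
    change Matrix.diagonal _ * Matrix.diagonal _ = 0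
    rw [Matrix.diagonal_mul_diagonal, ← Matrix.diagonal_zero]
    refine congrArg Matrix.diagonal (funext fun ρ => ?_)
    rcases eq_or_ne ρ σ with rfl | h'
    · simp [h]
    · simp [h']
  complete := by
    ext σ τ
    rcases eq_or_ne σ τ with rfl | h
    · simp [matrixIdem, Matrix.sum_apply, Pi.single_apply]
    · simp [matrixIdem, Matrix.sum_apply, h]

theorem matrixIdem_mul (σ : Equiv.Perm (Fin 3)) (i : Fin 3) :
    matrixIdem K σ * matrixHom K (monomial K [i])
      = matrixHom K (monomial K [i]) * matrixIdem K (σ * arrowStep i) := by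
  rw [matrixHom_monomial]
  ext ρ τ
  rw [matrixIdem, matrixIdem, Matrix.diagonal_mul, Matrix.mul_diagonal, wordMatrix, Matrix.of_apply,
    wordEnd_cons, wordEnd_nil, mul_one]
  simp only [Pi.single_apply]
  split_ifs <;> simp_all

/-- Summing the row `σ` forgets the end points of words. The recovery of `r` gives the injectivity
that `CoverData.ofInjective` needs. -/
theorem sum_wordMatrix (σ : Equiv.Perm (Fin 3)) (r : GrPresentation K) :
    ∑ τ, (matrixIdem K σ * matrixHom K r) σ τ = r := by
  let f : GrPresentation K →ₗ[K] GrPresentation K :=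
    { toFun := fun r => ∑ τ, (matrixIdem K σ * matrixHom K r) σ τ
      map_add' := fun r s => by simp [mul_add, Finset.sum_add_distrib]
      map_smul' := fun c r => by simp [Finset.smul_sum] }
  suffices f = LinearMap.id from LinearMap.congr_fun this r
  refine linearMap_ext_monomial fun w => ?_
  simp [f, matrixHom_monomial, matrixIdem, wordMatrix]

/-- The cover of the presented algebra. -/
abbrev Cover : Type _ := coverSubalgebra (matrixIdem_mul K)

/-- The idempotents of the cover. -/
def idem (σ : Equiv.Perm (Fin 3)) : Cover K :=
  ⟨matrixIdem K σ, fun τ => by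
    rcases eq_or_ne τ σ with rfl | h
    · exact ⟨1, by rw [map_one, mul_one, ((completeOrthogonalIdempotents_matrixIdem K).idem τ).eq]⟩
    · exact ⟨0, by rw [map_zero, mul_zero, (completeOrthogonalIdempotents_matrixIdem K).ortho h]⟩⟩

/-- The homomorphism from the presented algebra to its cover. -/
def hom : GrPresentation K →ₐ[K] Cover K :=
  (matrixHom K).codRestrict _ fun r _ => ⟨r, rfl⟩

/-- The cover has the structure of a covered algebra. -/
def coverData : CoverData K (Cover K) :=
  CoverData.ofInjective (E := idem K) (G := hom K)
    { idem := fun σ => Subtype.ext ((completeOrthogonalIdempotents_matrixIdem K).idem σ)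
      ortho := fun _ _ h => Subtype.ext ((completeOrthogonalIdempotents_matrixIdem K).ortho h)
      complete := Subtype.ext <| by
        rw [AddSubmonoidClass.coe_finsetSum]
        exact (completeOrthogonalIdempotents_matrixIdem K).complete }
    (fun σ i => Subtype.ext (matrixIdem_mul K σ i))
    (fun σ x => let ⟨r, hr⟩ := x.2 σ; ⟨r, Subtype.ext hr⟩)
    (fun σ r h => by
      have h₁ : matrixIdem K σ * matrixHom K r = 0 := congrArg Subtype.val h
      rw [← sum_wordMatrix K σ r, h₁]
      simp)

end GrCover

end

noncomputable section

open GrPresentation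

/-! ### Collecting equal terms -/

theorem listComb_eq_zero_of_all {ι M : Type*} [AddCommGroup M] (v : ι → M) {L : List (ℤ × ι)}
    (h : (L.all fun t => t.1 == 0) = true) : listComb v L = 0 := by
  rw [List.all_eq_true] at h
  exact List.sum_eq_zero fun x hx => by
    obtain ⟨t, ht, rfl⟩ := List.mem_map.1 hx
    rw [beq_iff_eq.1 (h t ht), zero_smul]

section Collect

variable {ι M : Type*} [AddCommGroup M] [DecidableEq ι]

/-- Add a term to a list of terms with different indices. -/
def addTerm (t : ℤ × ι) : List (ℤ × ι) → List (ℤ × ι)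
  | [] => [t]
  | s :: L => if s.2 = t.2 then (t.1 + s.1, s.2) :: L else s :: addTerm t L

/-- Collect the terms with equal indices. -/
def collectTerms (L : List (ℤ × ι)) : List (ℤ × ι) := L.foldr addTerm []

theorem listComb_addTerm (v : ι → M) (t : ℤ × ι) (L : List (ℤ × ι)) :
    listComb v (addTerm t L) = t.1 • v t.2 + listComb v L := by
  induction L with
  | nil => simp [addTerm]
  | cons s L ih =>
    rw [addTerm]
    split_ifs with h
    · rw [listComb_cons, listComb_cons, add_smul, h, add_assoc]
    · rw [listComb_cons, listComb_cons, ih, add_left_comm]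

theorem listComb_collectTerms (v : ι → M) (L : List (ℤ × ι)) :
    listComb v (collectTerms L) = listComb v L := by
  induction L with
  | nil => rfl
  | cons t L ih => rw [listComb_cons, ← ih]; exact listComb_addTerm v t _

/-- A sufficient criterion by evaluation that, unlike `listComb_congr`, also works for an infinite
index type. -/
theorem listComb_eq_zero (v : ι → M) {L : List (ℤ × ι)}
    (h : (collectTerms L).all (fun t => t.1 == 0) = true) : listComb v L = 0 := by
  rw [← listComb_collectTerms, listComb_eq_zero_of_all v h]

end Collect

/-! ### Matrices over a covered algebra -/

/-- The exponents `(a, b)` of a product `XᵃZᵇ` of the matrices `X = !![0, 1; 1, 0]` and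
`Z = !![1, 0; 0, -1]`. -/
abbrev Pauli : Type := Bool × Bool

namespace Pauli

/-- The matrix `XᵃZᵇ`. -/
def toMatrix : Pauli → Matrix (Fin 2) (Fin 2) ℤ
  | (false, false) => !![1, 0; 0, 1]
  | (true, false) => !![0, 1; 1, 0]
  | (false, true) => !![1, 0; 0, -1]
  | (true, true) => !![0, -1; 1, 0]

/-- The sign that occurs in the product of two of the matrices `XᵃZᵇ`. -/
def sign (m n : Pauli) : ℤ := if m.2 && n.1 then -1 else 1

/-- The exponents of the product of two of the matrices `XᵃZᵇ`. -/
def mul (m n : Pauli) : Pauli := (xor m.1 n.1, xor m.2 n.2)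

theorem toMatrix_mul (m n : Pauli) :
    toMatrix m * toMatrix n = sign m n • toMatrix (mul m n) := by
  revert m n
  decide +kernel

end Pauli

/-- The symbols `XᵃZᵇ ⊗ w` for words `w`. -/
abbrev PauliWord : Type := Pauli × List (Fin 3)

namespace PauliWord

/-- A numbering of the symbols `XᵃZᵇ ⊗ w` for normal words `w`. -/
def encode (m : Pauli) (j : Fin 24) : ℕ :=
  (if m.1 then if m.2 then 72 else 48 else if m.2 then 24 else 0) + j

/-- The symbol with the given number. -/
def decode (n : ℕ) : PauliWord :=
  ((decide (48 ≤ n), decide (n % 48 ≥ 24)), normalWord (Fin.ofNat 24 n))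

theorem decode_encode (m : Pauli) (j : Fin 24) : decode (encode m j) = (m, normalWord j) := by
  revert m j
  decide +kernel

/-- The expansion of a combination of words in normal words. -/
def reduce (L : List (ℤ × PauliWord)) : List (ℤ × ℕ) :=
  L.flatMap fun t =>
    ((expand t.2.2).map fun s => (s.1, encode t.2.1 s.2)).map fun s => (t.1 * s.1, s.2)

/-- The product of combinations in the cover, where the second factor depends on the vertex. -/
def mulAt (f : Equiv.Perm (Fin 3) → List (ℤ × PauliWord)) (σ : Equiv.Perm (Fin 3))
    (L : List (ℤ × PauliWord)) : List (ℤ × PauliWord) :=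
  L.flatMap fun t => ((f (σ * wordEnd t.2.2)).map fun s =>
    (Pauli.sign t.2.1 s.2.1 * s.1, (Pauli.mul t.2.1 s.2.1, t.2.2 ++ s.2.2))).map
      fun s => (t.1 * s.1, s.2)

end PauliWord

namespace CoverData

variable {K C : Type*} [Field K] [Ring C] [Algebra K C] (D : CoverData K C)

/-- The matrix `XᵃZᵇ` over a ring. -/
def pauli (C : Type*) [Ring C] (m : Pauli) : Matrix (Fin 2) (Fin 2) C :=
  (Int.castRingHom C).mapMatrix m.toMatrix

theorem pauli_mul (m n : Pauli) :
    pauli C m * pauli C n = Pauli.sign m n • pauli C (m.mul n) := by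
  rw [pauli, pauli, ← map_mul, Pauli.toMatrix_mul, map_zsmul, pauli]

theorem pauli_mul_scalar (m : Pauli) (c : C) :
    pauli C m * Matrix.scalar (Fin 2) c = Matrix.scalar (Fin 2) c * pauli C m := by
  ext i j
  rw [Matrix.scalar_apply, Matrix.mul_diagonal, Matrix.diagonal_mul]
  exact Int.cast_comm _ _

/-- The value of `XᵃZᵇ ⊗ w`. -/
def pauliWord (t : PauliWord) : Matrix (Fin 2) (Fin 2) C :=
  pauli C t.1 * Matrix.scalar (Fin 2) (D.hom (monomial K t.2))

theorem pauliWord_mul (s t : PauliWord) : D.pauliWord s * D.pauliWord t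
    = Pauli.sign s.1 t.1 • D.pauliWord (s.1.mul t.1, s.2 ++ t.2) := by
  rw [pauliWord, pauliWord, pauliWord, mul_assoc, ← mul_assoc _ (pauli C _), ← pauli_mul_scalar,
    mul_assoc, ← mul_assoc, pauli_mul, ← map_mul, ← map_mul, ← monomial_append, smul_mul_assoc]

/-- The idempotents as scalar matrices. -/
def scalarIdem (σ : Equiv.Perm (Fin 3)) : Matrix (Fin 2) (Fin 2) C :=
  Matrix.scalar (Fin 2) (D.idem σ)

theorem sum_scalarIdem : ∑ σ, D.scalarIdem σ = 1 := by
  simp_rw [scalarIdem]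
  rw [← map_sum, D.complete.complete, map_one]

theorem scalarIdem_mul_scalarIdem (σ τ : Equiv.Perm (Fin 3)) :
    D.scalarIdem σ * D.scalarIdem τ = if σ = τ then D.scalarIdem σ else 0 := by
  rw [scalarIdem, scalarIdem, ← map_mul]
  split_ifs with h
  · rw [h, D.idem_mul_idem]
  · rw [D.complete.ortho h, map_zero]

theorem scalarIdem_mul_pauliWord (σ : Equiv.Perm (Fin 3)) (t : PauliWord) :
    D.scalarIdem σ * D.pauliWord t = D.pauliWord t * D.scalarIdem (σ * wordEnd t.2) := by
  rw [pauliWord, scalarIdem, ← mul_assoc, ← pauli_mul_scalar, mul_assoc, mul_assoc, ← map_mul,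
    idem_mul_hom_monomial D.idem_mul_hom, map_mul, scalarIdem]

/-- The matrix whose component at the vertex `σ` is the given combination `f σ`. -/
def cover (f : Equiv.Perm (Fin 3) → List (ℤ × PauliWord)) : Matrix (Fin 2) (Fin 2) C :=
  ∑ σ, D.scalarIdem σ * listComb D.pauliWord (f σ)

theorem scalarIdem_mul_cover (f : Equiv.Perm (Fin 3) → List (ℤ × PauliWord))
    (σ : Equiv.Perm (Fin 3)) :
    D.scalarIdem σ * D.cover f = D.scalarIdem σ * listComb D.pauliWord (f σ) := by
  simp_rw [cover, Finset.mul_sum, ← mul_assoc, scalarIdem_mul_scalarIdem, ite_mul, zero_mul]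
  simp

/-- A term with the word `w` in the component at `σ` ends at `σ * wordEnd w`, so it meets the
component of the second factor at that vertex. -/
theorem cover_mul_cover (f g : Equiv.Perm (Fin 3) → List (ℤ × PauliWord)) :
    D.cover f * D.cover g = D.cover fun σ => PauliWord.mulAt g σ (f σ) := by
  refine (Finset.sum_mul _ _ _).trans (Finset.sum_congr rfl fun σ _ => ?_)
  beta_reduce
  rw [PauliWord.mulAt, listComb_flatMap D.pauliWord (f σ) fun t =>
    (g (σ * wordEnd t.2)).map fun s => (Pauli.sign t.1 s.2.1 * s.1, (Pauli.mul t.1 s.2.1, t.2 ++ s.2.2))]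
  induction f σ with
  | nil => simp
  | cons t L ih =>
    rw [listComb_cons, listComb_cons, mul_add, add_mul, mul_add, ih]
    congr 1
    rw [mul_smul_comm, mul_smul_comm, smul_mul_assoc, scalarIdem_mul_pauliWord, mul_assoc,
      scalarIdem_mul_cover, ← mul_assoc, ← scalarIdem_mul_pauliWord, mul_assoc]
    congr 2
    induction g (σ * wordEnd t.2.2) with
    | nil => simp
    | cons s L ih =>
      rw [listComb_cons, mul_add, ih, List.map_cons, listComb_cons]
      congr 1
      rw [mul_smul_comm, pauliWord_mul, smul_smul, mul_comm]

theorem cover_append (f g : Equiv.Perm (Fin 3) → List (ℤ × PauliWord)) :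
    D.cover (fun σ => f σ ++ g σ) = D.cover f + D.cover g := by
  simp_rw [cover, listComb_append, mul_add, Finset.sum_add_distrib]

theorem cover_one : D.cover (fun _ => [(1, ((false, false), []))]) = 1 := by
  have : D.pauliWord ((false, false), []) = 1 := by
    have h : Pauli.toMatrix (false, false) = 1 := Matrix.one_fin_two.symm
    rw [pauliWord, monomial_nil, map_one, map_one, mul_one, pauli, h, map_one]
  simp_rw [cover, listComb_cons, this, listComb_nil, add_zero, one_smul, mul_one, sum_scalarIdem]

/-- The combination with all coefficients multiplied by `k`. -/
def _root_.PauliWord.scale (k : ℤ) (L : List (ℤ × PauliWord)) : List (ℤ × PauliWord) :=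
  L.map fun t => (k * t.1, t.2)

theorem cover_scale (k : ℤ) (f : Equiv.Perm (Fin 3) → List (ℤ × PauliWord)) :
    D.cover (fun σ => PauliWord.scale k (f σ)) = k • D.cover f := by
  rw [cover, cover, Finset.smul_sum]
  refine Finset.sum_congr rfl fun σ _ => ?_
  rw [← mul_smul_comm]
  congr 1
  induction f σ with
  | nil => simp [PauliWord.scale]
  | cons t L ih =>
    rw [listComb_cons, smul_add, ← ih, smul_smul]
    exact listComb_cons _ _ _

theorem listComb_reduce (L : List (ℤ × PauliWord)) :
    listComb (fun n => D.pauliWord (PauliWord.decode n)) (PauliWord.reduce L)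
      = listComb D.pauliWord L := by
  rw [PauliWord.reduce, listComb_flatMap _ L fun t =>
    (expand t.2).map fun s => (s.1, PauliWord.encode t.1 s.2)]
  congr 1
  funext t
  rw [pauliWord, monomial_eq_listComb K t.2]
  induction expand t.2 with
  | nil => simp
  | cons s L ih =>
    rw [List.map_cons, listComb_cons, ih, listComb_cons, map_add, map_add, mul_add, map_zsmul,
      map_zsmul, mul_smul_comm, PauliWord.decode_encode, pauliWord]

/-- Every identity between matrices needed below is brought into this form: at each vertex, an
integer combination whose normal form is evaluated. -/
theorem cover_eq_zero {f : Equiv.Perm (Fin 3) → List (ℤ × PauliWord)}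
    (h : ∀ σ, (collectTerms (PauliWord.reduce (f σ))).all (fun t => t.1 == 0) = true) :
    D.cover f = 0 :=
  Finset.sum_eq_zero fun σ _ => by rw [← listComb_reduce, listComb_eq_zero _ (h σ), mul_zero]

end CoverData

end

noncomputable section

open GrPresentation

/-! ### The generators -/

namespace Pauli

/-- The index of the identity matrix. -/
abbrev one : Pauli := (false, false)

/-- The index of the matrix `X`. -/
abbrev x : Pauli := (true, false)

/-- The index of the matrix `Z`. -/
abbrev z : Pauli := (false, true)

/-- The index of the matrix `X * Z`. -/
abbrev xz : Pauli := (true, true)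

end Pauli

namespace PauliWord

/-- The combination that describes `x 0 3` at the vertex `1`. -/
def termsZeroThree : List (ℤ × PauliWord) :=
  [(-4, Pauli.one, [1, 2, 0, 1]), (-2, Pauli.one, [0, 1]), (-2, Pauli.one, [2, 1, 2, 0]),
   (4, Pauli.one, [2, 1, 2]), (2, Pauli.one, [2]), (-2, Pauli.one, [1]), (1, Pauli.x, []),
   (2, Pauli.x, [1, 2]), (2, Pauli.x, [2, 1, 2, 1]), (2, Pauli.x, [2, 1]),
   (-2, Pauli.x, [1, 2, 1, 2]), (4, Pauli.x, [2, 1, 0]), (-2, Pauli.x, [2, 0, 1]),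
   (-2, Pauli.x, [1, 2, 0]), (2, Pauli.z, [1, 2]), (2, Pauli.z, [2, 1, 2, 1]),
   (2, Pauli.xz, [2])]

/-- The combination that describes `x 1 3` at the vertex `1`. -/
def termsOneThree : List (ℤ × PauliWord) :=
  [(2, Pauli.one, [1, 0]), (-2, Pauli.one, [2, 1, 0, 1]), (4, Pauli.one, [2, 1, 2]),
   (2, Pauli.one, [2]), (2, Pauli.x, [2, 1]), (2, Pauli.x, [1, 2, 1, 2]),
   (-2, Pauli.x, [2, 0, 1]), (2, Pauli.x, [1, 2, 0]), (1, Pauli.z, []), (2, Pauli.z, [2, 1]),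
   (2, Pauli.z, [1, 2, 1, 2]), (-2, Pauli.z, [2, 0, 1]), (2, Pauli.z, [1, 2, 0]),
   (-2, Pauli.xz, [1, 0]), (2, Pauli.xz, [2, 1, 0, 1]), (-2, Pauli.xz, [2])]

/-- The combination that describes `x 2 3` at the vertex `1`. -/
def termsTwoThree : List (ℤ × PauliWord) :=
  [(-4, Pauli.one, [2, 0]), (-4, Pauli.one, [1, 2, 0, 1]), (-2, Pauli.one, [1, 0]),
   (-2, Pauli.one, [2, 1, 0, 1]), (2, Pauli.one, [0, 1]), (-2, Pauli.one, [2, 1, 2, 0]),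
   (4, Pauli.one, [2, 1, 2]), (-2, Pauli.one, [2]), (-4, Pauli.one, [1, 2, 1, 2, 1]),
   (-1, Pauli.x, []), (2, Pauli.x, [1, 2]), (-2, Pauli.x, [2, 1, 2, 1]),
   (-4, Pauli.x, [2, 1, 0]), (4, Pauli.x, [1, 0, 1]), (2, Pauli.x, [0]), (2, Pauli.x, [2, 0, 1]),
   (-2, Pauli.x, [1, 2, 0]), (2, Pauli.z, [2, 0, 1]), (-2, Pauli.z, [1, 2, 0]),
   (2, Pauli.xz, [0, 1]), (-2, Pauli.xz, [2, 1, 2, 0])]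

/-- The combinations that describe the generators at the vertex `1`. -/
def baseTerms : Fin 4 → Fin 4 → List (ℤ × PauliWord) :=
  ![![[], [(-1, Pauli.x, [])], [(1, Pauli.z, [])], termsZeroThree],
    ![[(1, Pauli.x, [])], [], [(-1, Pauli.x, [])], termsOneThree],
    ![[(-1, Pauli.z, [])], [(1, Pauli.x, [])], [], termsTwoThree],
    ![scale (-1) termsZeroThree, scale (-1) termsOneThree, scale (-1) termsTwoThree, []]]

/-- The automorphism that changes the signs of `X`, `Z` and of the letter `0`. -/
def twist (L : List (ℤ × PauliWord)) : List (ℤ × PauliWord) :=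
  L.map fun t => (if xor (xor t.2.1.1 t.2.1.2) (t.2.2.count 0 % 2 == 1) then -t.1 else t.1, t.2)

/-- The generators at an even or odd vertex. -/
def parityTerms (b : Bool) (i j : Fin 4) : List (ℤ × PauliWord) :=
  if b then twist (baseTerms i j) else baseTerms i j

/-- The permutation of the four indices given by a letter. -/
def letterAct (i : Fin 3) : Fin 4 → Fin 4 :=
  (![![1, 0, 2, 3], ![0, 2, 1, 3], ![1, 0, 2, 3]] : Fin 3 → Fin 4 → Fin 4) i

/-- The action of the inverse of the end point of a word on the four indices. -/
def wordAct : List (Fin 3) → Fin 4 → Fin 4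
  | [], p => p
  | i :: w, p => wordAct w (letterAct i p)

/-- The action of the inverse of a permutation on the four indices. -/
def permAct (σ : Equiv.Perm (Fin 3)) (p : Fin 4) : Fin 4 :=
  Fin.lastCases (motive := fun _ => Fin 4) 3 (fun i => (σ⁻¹ i).castSucc) p

/-- The parity of a permutation. -/
def isOdd (σ : Equiv.Perm (Fin 3)) : Bool := Equiv.Perm.sign σ = -1

theorem permAct_mul_arrowStep (σ : Equiv.Perm (Fin 3)) (i : Fin 3) (p : Fin 4) :
    permAct (σ * arrowStep i) p = letterAct i (permAct σ p) := by
  revert σ i p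
  decide +kernel

theorem isOdd_mul_arrowStep (σ : Equiv.Perm (Fin 3)) (i : Fin 3) :
    isOdd (σ * arrowStep i) = !isOdd σ := by
  revert σ i
  decide +kernel

theorem permAct_injective (σ : Equiv.Perm (Fin 3)) {i j : Fin 4} (h : i ≠ j) :
    permAct σ i ≠ permAct σ j := by
  revert σ i j
  decide +kernel

theorem permAct_mul_wordEnd (σ : Equiv.Perm (Fin 3)) (w : List (Fin 3)) (p : Fin 4) :
    permAct (σ * wordEnd w) p = wordAct w (permAct σ p) := by
  induction w generalizing σ p with
  | nil => rw [wordEnd_nil, mul_one, wordAct]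
  | cons i w ih => rw [wordEnd_cons, ← mul_assoc, ih, permAct_mul_arrowStep, wordAct]

theorem isOdd_mul_wordEnd (σ : Equiv.Perm (Fin 3)) (w : List (Fin 3)) :
    isOdd (σ * wordEnd w) = xor (isOdd σ) (w.length % 2 == 1) := by
  induction w generalizing σ with
  | nil => simp
  | cons i w ih =>
    rw [wordEnd_cons, ← mul_assoc, ih, isOdd_mul_arrowStep, List.length_cons]
    rcases Nat.mod_two_eq_zero_or_one w.length with h | h
    · rw [h, Nat.add_mod, h]; simp
    · rw [h, Nat.add_mod, h]; simp

/-- The generators at all vertices. -/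
def genTerms (i j : Fin 4) (σ : Equiv.Perm (Fin 3)) : List (ℤ × PauliWord) :=
  parityTerms (isOdd σ) (permAct σ i) (permAct σ j)

/-- The product of two generators at a vertex, computed from the position of the indices at this
vertex. -/
def mulTerms (b : Bool) (i j k l : Fin 4) : List (ℤ × PauliWord) :=
  (parityTerms b i j).flatMap fun t =>
    ((parityTerms (xor b (t.2.2.length % 2 == 1)) (wordAct t.2.2 k) (wordAct t.2.2 l)).map fun s =>
      (Pauli.sign t.2.1 s.2.1 * s.1, (Pauli.mul t.2.1 s.2.1, t.2.2 ++ s.2.2))).map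
        fun s => (t.1 * s.1, s.2)

/-- The vertex enters only through its parity and the positions to which it moves the four indices.
A relation therefore needs to be checked for the two parities and all choices of indices, not
separately at every vertex. -/
theorem mulAt_genTerms (i j k l : Fin 4) (σ : Equiv.Perm (Fin 3)) :
    mulAt (genTerms k l) σ (genTerms i j σ)
      = mulTerms (isOdd σ) (permAct σ i) (permAct σ j) (permAct σ k) (permAct σ l) := by
  simp only [mulAt, mulTerms, genTerms, permAct_mul_wordEnd, isOdd_mul_wordEnd]

/-- The combination vanishes after reduction to normal words. -/
def IsNull (L : List (ℤ × PauliWord)) : Prop :=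
  (collectTerms (reduce L)).all (fun t => t.1 == 0) = true

instance (L : List (ℤ × PauliWord)) : Decidable (IsNull L) :=
  inferInstanceAs (Decidable (_ = true))

theorem baseTerms_symm (i j : Fin 4) : baseTerms i j = scale (-1) (baseTerms j i) := by
  revert i j
  decide +kernel

/-- The defining relations are checked in the normalisation in which both parameters are 1; the term
with coefficient -1 is the right hand side. -/
theorem isNull_sq : ∀ (b : Bool) (i j : Fin 4), i ≠ j →
    IsNull (mulTerms b i j i j ++ [(-1, Pauli.one, [])]) := by
  decide +kernel

theorem isNull_comm : ∀ (b : Bool) (i j k l : Fin 4), [i, j, k, l].Nodup →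
    IsNull (mulTerms b i j k l ++ scale (-1) (mulTerms b k l i j)) := by
  decide +kernel

theorem isNull_cyclic : ∀ (b : Bool) (i j k : Fin 4), i ≠ j → j ≠ k → i ≠ k →
    IsNull (mulTerms b i j j k ++ mulTerms b j k k i ++ mulTerms b k i i j
      ++ [(-1, Pauli.one, [])]) := by
  decide +kernel

end PauliWord

end

/-! ### The homomorphism from the deformed Fomin–Kirillov algebra to matrices over the cover -/

noncomputable section

open GrPresentation

namespace CoverData

variable {K C : Type*} [Field K] [Ring C] [Algebra K C] (D : CoverData K C)

/-- The matrices that generate the matrix algebra. -/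
def gen (i j : Fin 4) : Matrix (Fin 2) (Fin 2) C := D.cover (PauliWord.genTerms i j)

theorem gen_symm (i j : Fin 4) : D.gen i j = -D.gen j i := by
  have h : PauliWord.genTerms i j = fun σ => PauliWord.scale (-1) (PauliWord.genTerms j i σ) := by
    funext σ
    rw [PauliWord.genTerms, PauliWord.genTerms, PauliWord.parityTerms, PauliWord.parityTerms,
      PauliWord.baseTerms_symm]
    split_ifs
    · simp only [PauliWord.twist, PauliWord.scale, List.map_map]
      refine List.map_congr_left fun t _ => ?_
      simp only [Function.comp_apply]
      split_ifs <;> simp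
    · rfl
  rw [gen, h, cover_scale, neg_one_smul, gen]

theorem gen_self (i : Fin 4) : D.gen i i = 0 := by
  refine D.cover_eq_zero fun σ => ?_
  rw [PauliWord.genTerms]
  generalize PauliWord.permAct σ i = p
  generalize PauliWord.isOdd σ = b
  revert b p
  decide +kernel

theorem gen_mul_gen (i j k l : Fin 4) : D.gen i j * D.gen k l = D.cover fun σ =>
    PauliWord.mulTerms (PauliWord.isOdd σ) (PauliWord.permAct σ i) (PauliWord.permAct σ j)
      (PauliWord.permAct σ k) (PauliWord.permAct σ l) := by
  simp_rw [gen, cover_mul_cover, PauliWord.mulAt_genTerms]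

theorem cover_neg_one : D.cover (fun _ => [(-1, Pauli.one, [])]) = -1 := by
  have h := D.cover_scale (-1) fun _ => [(1, (Pauli.one, []))]
  rwa [neg_one_smul, cover_one] at h

theorem gen_sq {i j : Fin 4} (h : i ≠ j) : D.gen i j * D.gen i j = 1 := by
  rw [← sub_eq_zero, sub_eq_add_neg, gen_mul_gen, ← D.cover_neg_one, ← cover_append]
  exact D.cover_eq_zero fun σ => PauliWord.isNull_sq _ _ _ (PauliWord.permAct_injective σ h)

theorem gen_comm {i j k l : Fin 4} (h : [i, j, k, l].Nodup) :
    D.gen i j * D.gen k l - D.gen k l * D.gen i j = 0 := by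
  rw [sub_eq_add_neg, ← neg_one_smul ℤ, gen_mul_gen, gen_mul_gen, ← cover_scale, ← cover_append]
  refine D.cover_eq_zero fun σ => PauliWord.isNull_comm _ _ _ _ _ ?_
  exact h.map (f := PauliWord.permAct σ) fun a b => not_imp_not.1 (PauliWord.permAct_injective σ)

theorem gen_cyclic {i j k : Fin 4} (hij : i ≠ j) (hjk : j ≠ k) (hik : i ≠ k) :
    D.gen i j * D.gen j k + D.gen j k * D.gen k i + D.gen k i * D.gen i j = 1 := by
  rw [← sub_eq_zero, sub_eq_add_neg, gen_mul_gen, gen_mul_gen, gen_mul_gen, ← D.cover_neg_one,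
    ← cover_append, ← cover_append, ← cover_append]
  exact D.cover_eq_zero fun σ => PauliWord.isNull_cyclic _ _ _ _
    (PauliWord.permAct_injective σ hij) (PauliWord.permAct_injective σ hjk)
    (PauliWord.permAct_injective σ hik)

/-- The homomorphism from the deformed Fomin–Kirillov algebra. -/
def ofDeformedFK (r : K) : DeformedFK K 4 (r * r) (r * r) →ₐ[K] Matrix (Fin 2) (Fin 2) C :=
  -- The factor `r` turns the relations with right hand side 1 into those with right hand side `r *
  -- r`.
  RingQuot.liftAlgHom K ⟨FreeAlgebra.lift K fun p => r • D.gen p.1 p.2, fun x y h => by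
    have hr (a b : Matrix (Fin 2) (Fin 2) C) : r • a * r • b = (r * r) • (a * b) := by
      rw [smul_mul_smul_comm]
    cases h with
    | diag i => rw [FreeAlgebra.lift_ι_apply, gen_self, smul_zero, map_zero]
    | antisymm i j h =>
      rw [map_neg, FreeAlgebra.lift_ι_apply, FreeAlgebra.lift_ι_apply, ← smul_neg, ← gen_symm]
    | sq i j h =>
      rw [map_mul, FreeAlgebra.lift_ι_apply, hr, D.gen_sq h, AlgHom.commutes,
        Algebra.algebraMap_eq_smul_one]
    | comm i j k l hij hik hil hjk hjl hkl =>
      rw [map_sub, map_mul, map_mul, FreeAlgebra.lift_ι_apply, FreeAlgebra.lift_ι_apply, hr, hr,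
        ← smul_sub, D.gen_comm (by simp_all), smul_zero, map_zero]
    | cyclic i j k hij hjk hik =>
      rw [AlgHom.commutes, Algebra.algebraMap_eq_smul_one]
      simp only [map_add, map_mul, FreeAlgebra.lift_ι_apply, hr, ← smul_add,
        D.gen_cyclic hij hjk hik]⟩

theorem ofDeformedFK_ι (r : K) (i j : Fin 4) :
    D.ofDeformedFK r (RingQuot.mkAlgHom K _ (FreeAlgebra.ι K (i, j))) = r • D.gen i j := by
  rw [ofDeformedFK, RingQuot.liftAlgHom_mkAlgHom_apply, FreeAlgebra.lift_ι_apply]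

theorem gen_mem_range {r : K} (hr : r ≠ 0) (i j : Fin 4) :
    D.gen i j ∈ (D.ofDeformedFK r).range := by
  rw [← inv_smul_smul₀ hr (D.gen i j), ← ofDeformedFK_ι]
  exact Subalgebra.smul_mem _ (AlgHom.mem_range_self _ _) _

end CoverData

end

noncomputable section

open GrPresentation

/-! ### The generators generate the matrix algebra -/

namespace PauliWord

/-- Families of combinations, indexed by the vertices. -/
abbrev Family : Type := Equiv.Perm (Fin 3) → List (ℤ × PauliWord)

namespace Family

/-- The product of families. -/
def mul (f g : Family) : Family := fun σ => mulAt g σ (f σ)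

/-- The sum of families. -/
def add (f g : Family) : Family := fun σ => f σ ++ g σ

/-- The family that has the same terms at all vertices. -/
def const (n : ℤ) (m : Pauli) : Family := fun _ => [(n, (m, []))]

/-- Four times the part of a family that involves only the identity matrix. -/
def average (f : Family) : Family :=
  -- Conjugation by `X`, `Z` and `XZ` fixes the identity component, and the signs cancel on the
  -- other three. The coefficient -1 occurs because the inverse of `XZ` is `-XZ`.
  add (add f (mul (mul (const 1 Pauli.x) f) (const 1 Pauli.x)))
    (add (mul (mul (const 1 Pauli.z) f) (const 1 Pauli.z))
      (mul (mul (const (-1) Pauli.xz) f) (const 1 Pauli.xz)))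

/-- The generators with indices different from `3`, numbered by the remaining index. -/
def cyclicGen (k : Fin 3) : Family := genTerms (k + 2).castSucc (k + 1).castSucc

/-- The sum of the idempotents at the vertices `σ` with `σ 1 = k`. -/
def vertexPair (k : Fin 3) : Family := fun σ => if σ 1 = k then [(1, (Pauli.one, []))] else []

/-- The difference of the idempotents at the vertices `σ` with `σ 1 = k`. -/
def vertexDiff (k : Fin 3) : Family := fun σ =>
  if σ 1 = k then [(if isOdd σ then -1 else 1, (Pauli.one, []))] else []

/-- The path at a vertex that is given by a word. -/
def pathAt (ρ : Equiv.Perm (Fin 3)) (w : List (Fin 3)) : Family := fun σ =>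
  if σ = ρ then [(1, (Pauli.one, w))] else []

/-- At the vertices with `σ 1 = k` the generator `cyclicGen k` is `Z` and the other two are `X`. An
anticommutator of two of them is thus 2 where they coincide and 0 elsewhere, which separates the
vertices into pairs; the next two lemmas then assemble `X` and `Z`. -/
theorem isNull_vertexPair (k : Fin 3) (σ : Equiv.Perm (Fin 3)) :
    IsNull (add (add (mul (cyclicGen (k + 1)) (cyclicGen (k + 2)))
      (mul (cyclicGen (k + 2)) (cyclicGen (k + 1)))) (fun σ => scale (-2) (vertexPair k σ)) σ) := by
  revert k σ
  decide +kernel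

theorem isNull_x (σ : Equiv.Perm (Fin 3)) :
    IsNull (add (add (mul (cyclicGen 1) (vertexPair 0)) (add (mul (cyclicGen 2) (vertexPair 1))
      (mul (cyclicGen 0) (vertexPair 2)))) (fun σ => scale (-1) (const 1 Pauli.x σ)) σ) := by
  revert σ
  decide +kernel

theorem isNull_z (σ : Equiv.Perm (Fin 3)) :
    IsNull (add (add (mul (cyclicGen 0) (vertexPair 0)) (add (mul (cyclicGen 1) (vertexPair 1))
      (mul (cyclicGen 2) (vertexPair 2)))) (fun σ => scale (-1) (const 1 Pauli.z σ)) σ) := by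
  revert σ
  decide +kernel

theorem isNull_xz (σ : Equiv.Perm (Fin 3)) :
    IsNull (add (mul (const 1 Pauli.x) (const 1 Pauli.z))
      (fun σ => scale (-1) (const 1 Pauli.xz σ)) σ) := by
  revert σ
  decide +kernel

/-- Multiplying by `Z` and averaging extracts the `Z`-component of `x k 3` between the vertices of a
pair. It is the sign of the vertex, so the two vertices of the pair can be told apart. -/
theorem isNull_vertexDiff (k : Fin 3) (σ : Equiv.Perm (Fin 3)) :
    IsNull (add (average (mul (mul (vertexPair k) (genTerms k.castSucc 3))
      (mul (vertexPair k) (const 1 Pauli.z)))) (fun σ => scale (-4) (vertexDiff k σ)) σ) := by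
  revert k σ
  decide +kernel

theorem isNull_pathAt_nil (ρ σ : Equiv.Perm (Fin 3)) :
    IsNull (add (add (vertexPair (ρ 1)) (fun σ => scale (if isOdd ρ then -1 else 1)
      (vertexDiff (ρ 1) σ))) (fun σ => scale (-2) (pathAt ρ [] σ)) σ) := by
  revert ρ σ
  decide +kernel

/-- In `termsTwoThree` the term `X ⊗ [0]` has coefficient 2, and averaging contributes a factor 4.
The idempotents on both sides remove the `X`-terms with other end points. -/
theorem isNull_pathAt_zero (ρ σ : Equiv.Perm (Fin 3)) :
    IsNull (add (average (mul (mul (pathAt ρ []) (genTerms (ρ 2).castSucc 3))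
      (mul (pathAt (ρ * arrowStep 0) []) (const 1 Pauli.x))))
      (fun σ => scale (-8) (pathAt ρ [0] σ)) σ) := by
  revert ρ σ
  decide +kernel

/-- The words `[1]` and `[2]` occur in `termsZeroThree` with the identity matrix and coefficients -2
and 2, which explains the factors -8 here and 8 in the next lemma. -/
theorem isNull_pathAt_one (ρ σ : Equiv.Perm (Fin 3)) :
    IsNull (add (average (mul (mul (pathAt ρ []) (genTerms (ρ 0).castSucc 3))
      (pathAt (ρ * arrowStep 1) []))) (fun σ => scale (- -8) (pathAt ρ [1] σ)) σ) := by
  revert ρ σ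
  decide +kernel

theorem isNull_pathAt_two (ρ σ : Equiv.Perm (Fin 3)) :
    IsNull (add (average (mul (mul (pathAt ρ []) (genTerms (ρ 0).castSucc 3))
      (pathAt (ρ * arrowStep 2) []))) (fun σ => scale (-8) (pathAt ρ [2] σ)) σ) := by
  revert ρ σ
  decide +kernel

end Family

end PauliWord

namespace CoverData

open PauliWord PauliWord.Family

variable {K C : Type*} [Field K] [Ring C] [Algebra K C] (D : CoverData K C)

theorem cover_pathAt (ρ : Equiv.Perm (Fin 3)) (w : List (Fin 3)) :
    D.cover (pathAt ρ w) = D.scalarIdem ρ * D.pauliWord (Pauli.one, w) := by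
  rw [cover, Finset.sum_eq_single ρ]
  · simp [pathAt]
  · intro σ _ h
    simp [pathAt, h]
  · simp

theorem cover_const (m : Pauli) : D.cover (const 1 m) = pauli C m := by
  have h : D.pauliWord (m, []) = pauli C m := by
    rw [pauliWord, monomial_nil, map_one, map_one, mul_one]
  simp_rw [cover, const, listComb_cons, h, listComb_nil, add_zero, one_smul, ← Finset.sum_mul,
    sum_scalarIdem, one_mul]

/-- Over a ring in which 2 can be cancelled by scalars, `1`, `X` and `Z` produce all matrix units.
-/
theorem pauli_add_pauli :
    pauli C Pauli.one + pauli C Pauli.z = 2 • Matrix.single 0 0 1 ∧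
      pauli C Pauli.one - pauli C Pauli.z = 2 • Matrix.single 1 1 1 ∧
      pauli C Pauli.x * Matrix.single 0 0 1 = Matrix.single 1 0 1 ∧
      pauli C Pauli.x * Matrix.single 1 1 1 = Matrix.single 0 1 1 := by
  refine ⟨?_, ?_, ?_, ?_⟩ <;> ext i j <;> fin_cases i <;> fin_cases j <;>
    simp [pauli, Pauli.toMatrix, Matrix.single, Matrix.mul_apply, one_add_one_eq_two]

variable (U : Subalgebra K (Matrix (Fin 2) (Fin 2) C))

theorem mul_mem_cover {f g : Family} (hf : D.cover f ∈ U) (hg : D.cover g ∈ U) :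
    D.cover (mul f g) ∈ U := by
  have := U.mul_mem hf hg
  rwa [cover_mul_cover] at this

theorem add_mem_cover {f g : Family} (hf : D.cover f ∈ U) (hg : D.cover g ∈ U) :
    D.cover (add f g) ∈ U := by
  have := U.add_mem hf hg
  rwa [← cover_append] at this

theorem scale_mem_cover (n : ℤ) {f : Family} (hf : D.cover f ∈ U) :
    D.cover (fun σ => scale n (f σ)) ∈ U := by
  rw [cover_scale]
  exact zsmul_mem hf n

variable [CharZero K]

theorem mem_of_zsmul_mem {n : ℤ} (hn : n ≠ 0) {x : Matrix (Fin 2) (Fin 2) C} (h : n • x ∈ U) :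
    x ∈ U := by
  rw [← Int.cast_smul_eq_zsmul K] at h
  rw [← inv_smul_smul₀ (Int.cast_ne_zero.2 hn : (n : K) ≠ 0) x]
  exact U.smul_mem h _

/-- An identity `f = n • g` between families puts `g` into `U`; the division by `n` is where
characteristic 0 enters. -/
theorem mem_of_isNull {f g : Family} {n : ℤ} (hn : n ≠ 0)
    (h : ∀ σ, IsNull (add f (fun σ => scale (-n) (g σ)) σ)) (hf : D.cover f ∈ U) :
    D.cover g ∈ U := by
  have h₁ : D.cover (fun σ => f σ ++ scale (-n) (g σ)) = 0 := D.cover_eq_zero h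
  rw [cover_append, cover_scale, neg_smul, ← sub_eq_add_neg, sub_eq_zero] at h₁
  exact mem_of_zsmul_mem U hn (h₁ ▸ hf)

theorem average_mem_cover (hx : D.cover (const 1 Pauli.x) ∈ U) (hz : D.cover (const 1 Pauli.z) ∈ U)
    {f : Family} (hf : D.cover f ∈ U) : D.cover (average f) ∈ U := by
  have h₁ : D.cover (const 1 Pauli.xz) ∈ U :=
    D.mem_of_isNull U (n := 1) one_ne_zero isNull_xz (D.mul_mem_cover U hx hz)
  have h₂ : D.cover (const (-1) Pauli.xz) ∈ U := by
    have h : const (-1) Pauli.xz = fun σ => scale (-1) (const 1 Pauli.xz σ) := rfl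
    rw [h]
    exact D.scale_mem_cover U (-1) h₁
  rw [average]
  exact D.add_mem_cover U
    (D.add_mem_cover U hf (D.mul_mem_cover U (D.mul_mem_cover U hx hf) hx))
    (D.add_mem_cover U (D.mul_mem_cover U (D.mul_mem_cover U hz hf) hz)
      (D.mul_mem_cover U (D.mul_mem_cover U h₂ hf) h₁))

variable {U}

theorem pauli_mem_and_pathAt_mem (h : ∀ i j, D.gen i j ∈ U) :
    pauli C Pauli.x ∈ U ∧ pauli C Pauli.z ∈ U ∧ ∀ ρ, D.cover (pathAt ρ []) ∈ U ∧
      ∀ i, D.cover (pathAt ρ [i]) ∈ U := by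
  have hg (i j : Fin 4) : D.cover (genTerms i j) ∈ U := h i j
  have hc (k : Fin 3) : D.cover (cyclicGen k) ∈ U := hg _ _
  have hp (k : Fin 3) : D.cover (vertexPair k) ∈ U :=
    D.mem_of_isNull U (n := 2) two_ne_zero (isNull_vertexPair k)
      (D.add_mem_cover U (D.mul_mem_cover U (hc _) (hc _)) (D.mul_mem_cover U (hc _) (hc _)))
  have hx : D.cover (const 1 Pauli.x) ∈ U :=
    D.mem_of_isNull U (n := 1) one_ne_zero isNull_x (D.add_mem_cover U
      (D.mul_mem_cover U (hc _) (hp _)) (D.add_mem_cover U (D.mul_mem_cover U (hc _) (hp _))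
        (D.mul_mem_cover U (hc _) (hp _))))
  have hz : D.cover (const 1 Pauli.z) ∈ U :=
    D.mem_of_isNull U (n := 1) one_ne_zero isNull_z (D.add_mem_cover U
      (D.mul_mem_cover U (hc _) (hp _)) (D.add_mem_cover U (D.mul_mem_cover U (hc _) (hp _))
        (D.mul_mem_cover U (hc _) (hp _))))
  have hd (k : Fin 3) : D.cover (vertexDiff k) ∈ U :=
    D.mem_of_isNull U (n := 4) four_ne_zero (isNull_vertexDiff k)
      (D.average_mem_cover U hx hz (D.mul_mem_cover U (D.mul_mem_cover U (hp k) (hg _ _))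
        (D.mul_mem_cover U (hp k) hz)))
  have he (ρ) : D.cover (pathAt ρ []) ∈ U :=
    D.mem_of_isNull U (n := 2) two_ne_zero (isNull_pathAt_nil ρ)
      (D.add_mem_cover U (hp _) (D.scale_mem_cover U _ (hd _)))
  rw [← D.cover_const, ← D.cover_const]
  refine ⟨hx, hz, fun ρ => ⟨he ρ, fun i => ?_⟩⟩
  match i with
  | 0 =>
    exact D.mem_of_isNull U (n := 8) (by norm_num) (isNull_pathAt_zero ρ)
      (D.average_mem_cover U hx hz (D.mul_mem_cover U (D.mul_mem_cover U (he ρ) (hg _ _))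
        (D.mul_mem_cover U (he _) hx)))
  | 1 =>
    exact D.mem_of_isNull U (n := -8) (by norm_num) (isNull_pathAt_one ρ)
      (D.average_mem_cover U hx hz (D.mul_mem_cover U (D.mul_mem_cover U (he ρ) (hg _ _)) (he _)))
  | 2 =>
    exact D.mem_of_isNull U (n := 8) (by norm_num) (isNull_pathAt_two ρ)
      (D.average_mem_cover U hx hz (D.mul_mem_cover U (D.mul_mem_cover U (he ρ) (hg _ _)) (he _)))

/-- Summing the one-letter paths over all vertices gives the letters as scalar matrices. With the
idempotents they yield all scalar matrices over `C`, and `X`, `Z` supply the matrix units. -/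
theorem eq_top_of_gen_mem (h : ∀ i j, D.gen i j ∈ U) : U = ⊤ := by
  obtain ⟨hx, hz, hp⟩ := D.pauli_mem_and_pathAt_mem h
  have h₁ (w : List (Fin 3)) : D.pauliWord (Pauli.one, w)
      = Matrix.scalar (Fin 2) (D.hom (monomial K w)) := by
    have h₂ : Pauli.toMatrix Pauli.one = 1 := Matrix.one_fin_two.symm
    rw [pauliWord, pauli, h₂, map_one, one_mul]
  have he (σ) : Matrix.scalar (Fin 2) (D.idem σ) ∈ U := by
    have := (hp σ).1
    rwa [cover_pathAt, h₁, monomial_nil, map_one, map_one, mul_one] at this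
  have hs (i) : Matrix.scalar (Fin 2) (D.hom (monomial K [i])) ∈ U := by
    have h₂ := sum_mem fun σ (_ : σ ∈ Finset.univ) => (hp σ).2 i
    simp_rw [cover_pathAt] at h₂
    rwa [← Finset.sum_mul, sum_scalarIdem, one_mul, h₁] at h₂
  have hw (w) : Matrix.scalar (Fin 2) (D.hom (monomial K w)) ∈ U := by
    induction w with
    | nil => rw [monomial_nil, map_one, map_one]; exact U.one_mem
    | cons i w ih => rw [monomial_cons, map_mul, map_mul]; exact U.mul_mem (hs i) ih
  have hr (r) : Matrix.scalar (Fin 2) (D.hom r) ∈ U := by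
    have hr : r ∈ Submodule.span K (Set.range (monomial K)) := by
      rw [span_range_monomial]; trivial
    induction hr using Submodule.span_induction with
    | mem _ h => obtain ⟨w, rfl⟩ := h; exact hw w
    | zero => rw [map_zero, map_zero]; exact U.zero_mem
    | add _ _ _ _ h h' => rw [map_add, map_add]; exact U.add_mem h h'
    | smul k r _ h =>
      have h₂ : Matrix.scalar (Fin 2) (k • D.hom r) = k • Matrix.scalar (Fin 2) (D.hom r) := by
        ext i j
        simp [Matrix.diagonal_apply]
      rw [map_smul, h₂]
      exact U.smul_mem h k
  have hc (c) : Matrix.scalar (Fin 2) c ∈ U := by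
    rw [← one_mul c, ← D.complete.complete, Finset.sum_mul, map_sum]
    refine sum_mem fun σ _ => ?_
    obtain ⟨r, h⟩ := D.exists_hom σ c
    rw [h, map_mul]
    exact U.mul_mem (he σ) (hr r)
  obtain ⟨h₂, h₃, h₄, h₅⟩ := pauli_add_pauli (C := C)
  have h₆ : pauli C Pauli.one = 1 := by
    have h : Pauli.toMatrix Pauli.one = 1 := Matrix.one_fin_two.symm
    rw [pauli, h, map_one]
  have h00 : Matrix.single 0 0 1 ∈ U := mem_of_zsmul_mem U (n := 2) two_ne_zero <| by
    rw [ofNat_zsmul, ← h₂, h₆]; exact U.add_mem U.one_mem hz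
  have h11 : Matrix.single 1 1 1 ∈ U := mem_of_zsmul_mem U (n := 2) two_ne_zero <| by
    rw [ofNat_zsmul, ← h₃, h₆]; exact U.sub_mem U.one_mem hz
  have hij (i j) : Matrix.single i j 1 ∈ U := by
    match i, j with
    | 0, 0 => exact h00
    | 1, 1 => exact h11
    | 1, 0 => rw [← h₄]; exact U.mul_mem hx h00
    | 0, 1 => rw [← h₅]; exact U.mul_mem hx h11
  refine eq_top_iff.2 fun M _ => ?_
  rw [Matrix.matrix_eq_sum_single M]
  refine sum_mem fun i _ => sum_mem fun j _ => ?_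
  have : Matrix.single i j (M i j) = Matrix.scalar (Fin 2) (M i j) * Matrix.single i j 1 := by
    ext k l
    simp [Matrix.scalar_apply, Matrix.diagonal_mul, Matrix.single_apply]
  rw [this]
  exact U.mul_mem (hc _) (hij i j)

theorem ofDeformedFK_surjective {r : K} (hr : r ≠ 0) : Function.Surjective (D.ofDeformedFK r) :=
  AlgHom.range_eq_top _ |>.1 <| D.eq_top_of_gen_mem fun i j => D.gen_mem_range hr i j

end CoverData

end

noncomputable section

/-! ### Rewriting systems for words -/

/-- A rewriting rule: a word, and the combination of words by which it may be replaced. -/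
abbrev RewriteRule (k : ℕ) : Type := List (Fin k) × List (ℤ × List (Fin k))

namespace RewriteRule

variable {k : ℕ}

/-- The value of a word. -/
def wordValue {A : Type*} [Ring A] (v : Fin k → A) (w : List (Fin k)) : A := (w.map v).prod

/-- The two sides of the rule have the same value. -/
def Holds {A : Type*} [Ring A] (v : Fin k → A) (ρ : RewriteRule k) : Prop :=
  wordValue v ρ.1 = listComb (wordValue v) ρ.2

/-- Application of a rule to a prefix of a word. -/
def rewritePrefix (R : List (RewriteRule k)) (w : List (Fin k)) :
    Option (List (ℤ × List (Fin k))) :=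
  R.findSome? fun ρ =>
    if ρ.1.isPrefixOf w then some (ρ.2.map fun t => (t.1, t.2 ++ w.drop ρ.1.length)) else none

/-- Application of a rule to the leftmost possible subword of a word. -/
def rewriteWord (R : List (RewriteRule k)) : List (Fin k) → List (ℤ × List (Fin k))
  | [] => [(1, [])]
  | i :: w => match rewritePrefix R (i :: w) with
    | some L => L
    | none => (rewriteWord R w).map fun t => (t.1, i :: t.2)

/-- Repeated application of rules to a combination of words. -/
def rewriteComb (R : List (RewriteRule k)) : ℕ → List (ℤ × List (Fin k)) → List (ℤ × List (Fin k))
  | 0, L => L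
  | n + 1, L => rewriteComb R n <| collectTerms <|
      L.flatMap fun t => (rewriteWord R t.2).map fun s => (t.1 * s.1, s.2)

section Soundness

variable {A : Type*} [Ring A] {v : Fin k → A}

theorem wordValue_append (u w : List (Fin k)) :
    wordValue v (u ++ w) = wordValue v u * wordValue v w := by simp [wordValue]

theorem listComb_append_right (L : List (ℤ × List (Fin k))) (w : List (Fin k)) :
    listComb (wordValue v) (L.map fun t => (t.1, t.2 ++ w))
      = listComb (wordValue v) L * wordValue v w := by
  induction L with
  | nil => simp
  | cons t L ih =>
    rw [List.map_cons, listComb_cons, ih, listComb_cons, add_mul, wordValue_append, smul_mul_assoc]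

theorem listComb_append_left (L : List (ℤ × List (Fin k))) (w : List (Fin k)) :
    listComb (wordValue v) (L.map fun t => (t.1, w ++ t.2))
      = wordValue v w * listComb (wordValue v) L := by
  induction L with
  | nil => simp
  | cons t L ih =>
    rw [List.map_cons, listComb_cons, ih, listComb_cons, mul_add, wordValue_append, mul_smul_comm]

theorem listComb_rewritePrefix {R : List (RewriteRule k)} (hR : ∀ ρ ∈ R, ρ.Holds v)
    {w : List (Fin k)} {L : List (ℤ × List (Fin k))} (h : rewritePrefix R w = some L) :
    listComb (wordValue v) L = wordValue v w := by
  obtain ⟨ρ, hρ, h⟩ := List.exists_of_findSome?_eq_some h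
  split_ifs at h with hp
  · obtain ⟨s, rfl⟩ := List.isPrefixOf_iff_prefix.1 hp
    rw [← Option.some_inj.1 h, List.drop_left, listComb_append_right, ← hR ρ hρ, wordValue_append]

theorem listComb_rewriteWord {R : List (RewriteRule k)} (hR : ∀ ρ ∈ R, ρ.Holds v)
    (w : List (Fin k)) : listComb (wordValue v) (rewriteWord R w) = wordValue v w := by
  induction w with
  | nil => simp [rewriteWord]
  | cons i w ih =>
    rw [rewriteWord]
    split
    · exact listComb_rewritePrefix hR ‹_›
    · refine (listComb_append_left (rewriteWord R w) [i]).trans ?_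
      rw [ih, ← wordValue_append, List.singleton_append]

theorem listComb_rewriteComb {R : List (RewriteRule k)} (hR : ∀ ρ ∈ R, ρ.Holds v) (n : ℕ)
    (L : List (ℤ × List (Fin k))) :
    listComb (wordValue v) (rewriteComb R n L) = listComb (wordValue v) L := by
  induction n generalizing L with
  | zero => rfl
  | succ n ih =>
    rw [rewriteComb, ih, listComb_collectTerms, listComb_flatMap]
    simp_rw [listComb_rewriteWord hR]

/-- The rule `ρ` follows from the rules in `R` by resolving an ambiguity: the word `w` can be
rewritten at the beginning and after `m` letters, and the difference of the results is equal to the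
difference of the two sides of `ρ` up to sign. -/
def resolves (R : List (RewriteRule k)) (n : ℕ) (d : RewriteRule k × Bool × List (Fin k) × ℕ) :
    Bool :=
  match rewritePrefix R d.2.2.1, rewritePrefix R (d.2.2.1.drop d.2.2.2) with
  | some L, some L' =>
    (rewriteComb R n (L.map (fun t => (if d.2.1 then t.1 else -t.1, t.2))
      ++ L'.map (fun t => (if d.2.1 then -t.1 else t.1, d.2.2.1.take d.2.2.2 ++ t.2))
      ++ (-1, d.1.1) :: d.1.2)).all fun t => t.1 == 0
  | _, _ => false

theorem listComb_map_neg {ι M : Type*} [AddCommGroup M] (v : ι → M) (L : List (ℤ × ι)) :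
    listComb v (L.map fun t => (-t.1, t.2)) = -listComb v L := by
  induction L with
  | nil => simp
  | cons t L ih => rw [List.map_cons, listComb_cons, ih, listComb_cons, neg_add, neg_smul]

/-- Two rewritings of the same word have the same value; their difference, reduced by known rules,
is up to sign the difference of the two sides of the new rule. -/
theorem holds_of_resolves {R : List (RewriteRule k)} (hR : ∀ ρ ∈ R, ρ.Holds v) {n : ℕ}
    {d : RewriteRule k × Bool × List (Fin k) × ℕ} (h : resolves R n d = true) : d.1.Holds v := by
  obtain ⟨ρ, b, w, m⟩ := d
  rw [resolves] at h
  split at h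
  · rename_i L L' hL hL'
    have h₁ := listComb_rewritePrefix hR hL
    have h₂ : listComb (wordValue v) (L'.map fun t => (t.1, w.take m ++ t.2)) = wordValue v w := by
      rw [listComb_append_left, listComb_rewritePrefix hR hL', ← wordValue_append,
        List.take_append_drop]
    have h₃ := listComb_eq_zero_of_all (wordValue v) h
    rw [listComb_rewriteComb hR, listComb_append, listComb_append, listComb_cons] at h₃
    have h₄ : listComb (wordValue v) (L.map fun t => (if b then t.1 else -t.1, t.2))
        + listComb (wordValue v) (L'.map fun t => (if b then -t.1 else t.1, w.take m ++ t.2))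
        = 0 := by
      have h₅ := listComb_map_neg (wordValue v) (L'.map fun t => (t.1, w.take m ++ t.2))
      rw [List.map_map] at h₅
      cases b
      · simp only [Bool.false_eq_true, if_false]
        rw [listComb_map_neg, h₁, h₂, neg_add_cancel]
      · simp only [if_true]
        rw [h₂] at h₅
        exact (congrArg₂ (· + ·) (by simpa using h₁) h₅).trans (add_neg_cancel _)
    rw [h₄, zero_add, neg_one_smul, neg_add_eq_zero] at h₃
    exact h₃
  · cases h

/-- All rules in the second list follow successively from the rules in the first list. -/
def resolvesAll (n : ℕ) : List (RewriteRule k) → List (RewriteRule k × Bool × List (Fin k) × ℕ) →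
    Bool
  | _, [] => true
  | R, d :: ds => resolves R n d && resolvesAll n (R ++ [d.1]) ds

theorem holds_of_resolvesAll {R : List (RewriteRule k)} (hR : ∀ ρ ∈ R, ρ.Holds v) {n : ℕ}
    {ds : List (RewriteRule k × Bool × List (Fin k) × ℕ)} (h : resolvesAll n R ds = true) :
    ∀ ρ ∈ R ++ ds.map Prod.fst, ρ.Holds v := by
  induction ds generalizing R with
  | nil => simpa using hR
  | cons d ds ih =>
    rw [resolvesAll, Bool.and_eq_true] at h
    have h₁ := ih (R := R ++ [d.1]) (fun ρ hρ => by
      rcases List.mem_append.1 hρ with hρ | hρ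
      · exact hR ρ hρ
      · rw [List.mem_singleton.1 hρ]; exact holds_of_resolves hR h.1) h.2
    simpa using h₁

end Soundness

/-! ### Normal words -/

/-- A numbering of the words that is compatible with the length-lexicographic order. -/
def code (w : List (Fin k)) : ℕ := w.foldl (fun n (i : Fin k) => (k + 1) * n + ((i : ℕ) + 1)) 0

theorem foldl_code (n : ℕ) (w : List (Fin k)) :
    w.foldl (fun n (i : Fin k) => (k + 1) * n + ((i : ℕ) + 1)) n
      = (k + 1) ^ w.length * n + code w := by
  induction w generalizing n with
  | nil => simp [code]
  | cons i w ih =>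
    rw [code, List.foldl_cons, List.foldl_cons, ih, ih, List.length_cons, pow_succ]
    ring

theorem code_append (u w : List (Fin k)) :
    code (u ++ w) = (k + 1) ^ w.length * code u + code w := by
  rw [code, List.foldl_append, foldl_code]
  rfl

theorem code_cons (i : Fin k) (w : List (Fin k)) :
    code (i :: w) = (k + 1) ^ w.length * (i + 1) + code w := by
  rw [← List.singleton_append, code_append]
  simp [code]

theorem code_lt (w : List (Fin k)) : code w < (k + 1) ^ w.length := by
  induction w with
  | nil => simp [code]
  | cons i w ih =>
    rw [code_cons, List.length_cons, pow_succ]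
    have : (k + 1) ^ w.length * (i + 1) ≤ (k + 1) ^ w.length * k := Nat.mul_le_mul_left _ i.2
    nlinarith

theorem pow_le_code (w : List (Fin k)) : (k + 1) ^ w.length ≤ k * code w + 1 := by
  induction w with
  | nil => simp
  | cons i w ih =>
    rw [code_cons, List.length_cons, pow_succ]
    nlinarith [Nat.zero_le (k * ((k + 1) ^ w.length * i))]

theorem length_le_of_code_lt {t w : List (Fin k)} (h : code t < code w) : t.length ≤ w.length := by
  by_contra! h₁
  have h₂ : (k + 1) ^ (w.length + 1) ≤ (k + 1) ^ t.length := Nat.pow_le_pow_right (by lia) h₁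
  have h₃ := pow_le_code t
  have h₄ := code_lt w
  rw [pow_succ] at h₂
  nlinarith [Nat.mul_le_mul_left k (Nat.succ_le_of_lt h)]

/-- The order on words is compatible with concatenation on both sides, so replacing a subword by
smaller words always lowers the code. -/
theorem code_append_lt {t w : List (Fin k)} (h : code t < code w) (p q : List (Fin k)) :
    code (p ++ (t ++ q)) < code (p ++ (w ++ q)) := by
  rw [code_append p, code_append t, code_append p, code_append w, List.length_append,
    List.length_append]
  have h₁ : (k + 1) ^ (t.length + q.length) ≤ (k + 1) ^ (w.length + q.length) :=
    Nat.pow_le_pow_right (by lia) (by have := length_le_of_code_lt h; lia)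
  have h₂ : (k + 1) ^ q.length * code t < (k + 1) ^ q.length * code w :=
    Nat.mul_lt_mul_of_pos_left h (by positivity)
  have h₃ := Nat.mul_le_mul_right (code p) h₁
  lia

/-- A word that contains none of the left hand sides of the rules. -/
def IsNormal (R : List (RewriteRule k)) (w : List (Fin k)) : Prop := ∀ ρ ∈ R, ¬ρ.1 <:+: w

/-- Induction on the code: a word that is not normal is a combination of words of smaller code.
Confluence is not needed, since only an upper bound for the dimension is sought. -/
theorem wordValue_mem_span {A K : Type*} [Field K] [Ring A] [Algebra K A] {v : Fin k → A}
    {R : List (RewriteRule k)} (hR : ∀ ρ ∈ R, ρ.Holds v)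
    (hlt : ∀ ρ ∈ R, ∀ t ∈ ρ.2, code t.2 < code ρ.1) (w : List (Fin k)) :
    wordValue v w ∈ Submodule.span K (wordValue v '' {w | IsNormal R w}) := by
  induction hn : code w using Nat.strong_induction_on generalizing w with
  | _ n ih =>
    by_cases hw : IsNormal R w
    · exact Submodule.subset_span ⟨w, hw, rfl⟩
    · rw [IsNormal] at hw
      push Not at hw
      obtain ⟨ρ, hρ, p, q, rfl⟩ := hw
      rw [List.append_assoc, wordValue_append, wordValue_append, hR ρ hρ, ← listComb_append_right,
        ← listComb_append_left]
      refine listComb_mem _ _ _ fun s hs => ?_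
      simp only [List.mem_map, exists_exists_and_eq_and] at hs
      obtain ⟨t, ht, rfl⟩ := hs
      refine ih _ ?_ _ rfl
      rw [← hn, List.append_assoc]
      exact code_append_lt (hlt ρ hρ t ht) p q

/-- The normal words of given length. -/
def normalWords (R : List (RewriteRule k)) : ℕ → List (List (Fin k))
  | 0 => [[]]
  | n + 1 => (normalWords R n).flatMap fun w => (List.finRange k).filterMap fun i =>
      if R.any (fun ρ => ρ.1.isPrefixOf (i :: w)) then none else some (i :: w)

theorem IsNormal.mem_normalWords {R : List (RewriteRule k)} {w : List (Fin k)}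
    (hw : IsNormal R w) : w ∈ normalWords R w.length := by
  induction w with
  | nil => simp [normalWords]
  | cons i w ih =>
    rw [List.length_cons, normalWords, List.mem_flatMap]
    refine ⟨w, ih fun ρ hρ h => hw ρ hρ (h.trans (List.suffix_cons i w).isInfix), ?_⟩
    rw [List.mem_filterMap]
    refine ⟨i, List.mem_finRange i, ?_⟩
    rw [if_neg]
    simp only [List.any_eq_true, not_exists, not_and]
    exact fun ρ hρ h => hw ρ hρ (List.isPrefixOf_iff_prefix.1 h).isInfix

theorem normalWords_eq_nil {R : List (RewriteRule k)} {m n : ℕ} (h : normalWords R m = [])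
    (hmn : m ≤ n) : normalWords R n = [] := by
  induction n, hmn using Nat.le_induction with
  | base => exact h
  | succ n _ ih => rw [normalWords, ih]; rfl

/-- The normal words of length less than `n`. -/
def allNormalWords (R : List (RewriteRule k)) (n : ℕ) : List (List (Fin k)) :=
  (List.range n).flatMap (normalWords R)

theorem IsNormal.mem_allNormalWords {R : List (RewriteRule k)} {w : List (Fin k)}
    (hw : IsNormal R w) {n : ℕ} (h : normalWords R n = []) : w ∈ allNormalWords R n := by
  have h₁ := hw.mem_normalWords
  refine List.mem_flatMap.2 ⟨w.length, List.mem_range.2 ?_, h₁⟩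
  by_contra! h₂
  rw [normalWords_eq_nil h h₂] at h₁
  cases h₁

theorem finite_and_finrank_le {A K : Type*} [Field K] [Ring A] [Algebra K A] {v : Fin k → A}
    {R : List (RewriteRule k)} (hR : ∀ ρ ∈ R, ρ.Holds v)
    (hlt : ∀ ρ ∈ R, ∀ t ∈ ρ.2, code t.2 < code ρ.1) {n : ℕ} (h : normalWords R n = [])
    (hv : Submodule.span K (Set.range (wordValue v)) = ⊤) :
    Module.Finite K A ∧ Module.finrank K A ≤ (allNormalWords R n).length := by
  classical
  let s : Finset A := ((allNormalWords R n).map (wordValue v)).toFinset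
  have hs : Submodule.span K (s : Set A) = ⊤ := by
    rw [← top_le_iff, ← hv, Submodule.span_le]
    rintro _ ⟨w, rfl⟩
    refine Submodule.span_mono ?_ (wordValue_mem_span hR hlt w)
    rintro _ ⟨w, hw, rfl⟩
    rw [Finset.mem_coe, List.mem_toFinset]
    exact List.mem_map_of_mem (hw.mem_allNormalWords h)
  refine ⟨⟨⟨s, hs⟩⟩, ?_⟩
  rw [← finrank_top, ← hs]
  refine (finrank_span_finset_le_card s).trans ((List.toFinset_card_le _).trans ?_)
  rw [List.length_map]

end RewriteRule

end

noncomputable section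

/-! ### The dimension of the deformed Fomin–Kirillov algebra -/

namespace DeformedFK

open RewriteRule

/-- The defining relations, as rules for words in the six letters
`x 0 1, x 1 2, x 2 0, x 0 3, x 1 3, x 2 3`. -/
def quadraticRules : List (RewriteRule 6) :=
  [([0, 0], [(1, [])]),
   ([1, 1], [(1, [])]),
   ([2, 0], [(-1, [1, 2]), (-1, [0, 1]), (1, [])]),
   ([2, 1], [(-1, [1, 0]), (-1, [0, 2]), (1, [])]),
   ([2, 2], [(1, [])]),
   ([3, 1], [(1, [1, 3])]),
   ([3, 3], [(1, [])]),
   ([4, 0], [(1, [3, 4]), (1, [0, 3]), (1, [])]),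
   ([4, 2], [(1, [2, 4])]),
   ([4, 3], [(-1, [3, 0]), (1, [0, 4]), (-1, [])]),
   ([4, 4], [(1, [])]),
   ([5, 0], [(1, [0, 5])]),
   ([5, 1], [(1, [4, 5]), (1, [1, 4]), (1, [])]),
   ([5, 2], [(-1, [3, 5]), (1, [2, 3]), (-1, [])]),
   ([5, 3], [(1, [3, 2]), (-1, [2, 5]), (-1, [])]),
   ([5, 4], [(-1, [4, 1]), (1, [1, 5]), (-1, [])]),
   ([5, 5], [(1, [])])]

/-- The rules obtained by completion, with the ambiguities from which they arise. -/
def derivations : List (RewriteRule 6 × Bool × List (Fin 6) × ℕ) :=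
  [(([1, 0, 1], [(1, [0, 1, 0]), (1, [1]), (-1, [0])]), true, [2, 0, 0], 1),
   (([3, 0, 3], [(-1, [0, 3, 0]), (-1, [3]), (-1, [0])]), true, [4, 0, 0], 1),
   (([4, 1, 2], [(-1, [3, 4, 1]), (-1, [2, 3, 4]), (1, [1, 2, 3]), (1, [4]), (-1, [3]),
     (-1, [2]), (-1, [1])]), true, [4, 2, 0], 1),
   (([4, 1, 0], [(-1, [3, 2, 4]), (-1, [2, 4, 1]), (-1, [0, 3, 2]), (1, [4]), (-1, [2])]),
     true, [4, 2, 1], 1),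
   (([4, 1, 3], [(-1, [3, 0, 1]), (1, [0, 4, 1]), (-1, [1])]), false, [4, 3, 1], 1),
   (([4, 1, 4], [(-1, [1, 4, 1]), (-1, [4]), (-1, [1])]), true, [5, 1, 1], 1),
   (([3, 2, 3], [(1, [2, 3, 2]), (1, [3]), (-1, [2])]), false, [5, 2, 2], 1),
   (([3, 0, 1, 0], [(1, [1, 3, 0, 1]), (1, [3, 0]), (-1, [1, 3])]), false, [3, 1, 0, 1], 1),
   (([3, 0, 2, 3], [(1, [2, 3, 0, 2]), (-1, [0, 2, 3, 0]), (1, [3, 0]), (-1, [2, 3]),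
     (-1, [0, 2]), (2, [])]), false, [4, 3, 2, 3], 1),
   (([3, 0, 1, 3], [(-1, [0, 3, 0, 1]), (-1, [1, 3]), (-1, [0, 1])]), false, [5, 3, 0, 3], 1),
   (([3, 0, 1, 2, 3, 0], [(-1, [2, 3, 0, 1, 2, 3]), (-1, [3, 0, 1, 2]), (1, [2, 3, 0, 2]),
     (-1, [0, 2, 3, 0]), (1, [0, 1, 2, 3]), (1, [3, 0]), (-1, [2, 3]), (-1, [0, 2]), (1, [])]),
     false, [3, 2, 3, 0, 2, 3], 2),
   (([3, 0, 1, 2, 3, 2], [(-1, [0, 3, 0, 1, 2, 3]), (1, [3, 0, 1, 2]), (-1, [1, 2, 3, 2]),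
     (1, [0, 3, 0, 1]), (-1, [0, 1, 2, 3]), (1, [1, 2]), (1, [0, 1])]),
     false, [3, 0, 1, 3, 2, 3], 3)]

/-- The six letters among the generators. -/
def letters {A : Type*} (x : Fin 4 → Fin 4 → A) : Fin 6 → A :=
  ![x 0 1, x 1 2, x 2 0, x 0 3, x 1 3, x 2 3]

theorem quadraticRules_holds {A : Type*} [Ring A] {x : Fin 4 → Fin 4 → A}
    (hneg : ∀ i j, i ≠ j → x j i = -x i j) (hsq : ∀ i j, i ≠ j → x i j * x i j = 1)
    (hcomm : ∀ i j k l, [i, j, k, l].Nodup → x i j * x k l = x k l * x i j)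
    (hcyc : ∀ i j k, i ≠ j → j ≠ k → i ≠ k → x i j * x j k + x j k * x k i + x k i * x i j = 1) :
    ∀ ρ ∈ quadraticRules, ρ.Holds (letters x) := by
  -- Up to rotation there are eight cyclic relations, two orientations for each of the four triples
  -- of indices.
  have h012 := hcyc 0 1 2 (by decide) (by decide) (by decide)
  have h021 := hcyc 0 2 1 (by decide) (by decide) (by decide)
  have h013 := hcyc 0 1 3 (by decide) (by decide) (by decide)
  have h031 := hcyc 0 3 1 (by decide) (by decide) (by decide)
  have h023 := hcyc 0 2 3 (by decide) (by decide) (by decide)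
  have h032 := hcyc 0 3 2 (by decide) (by decide) (by decide)
  have h123 := hcyc 1 2 3 (by decide) (by decide) (by decide)
  have h132 := hcyc 1 3 2 (by decide) (by decide) (by decide)
  rw [hneg 0 1 (by decide), hneg 1 2 (by decide), hneg 2 0 (by decide)] at h021
  rw [hneg 0 3 (by decide)] at h013
  rw [hneg 1 3 (by decide), hneg 0 1 (by decide)] at h031
  rw [hneg 0 3 (by decide), hneg 2 0 (by decide)] at h023
  rw [hneg 2 3 (by decide)] at h032
  rw [hneg 1 3 (by decide)] at h123
  rw [hneg 2 3 (by decide), hneg 1 2 (by decide)] at h132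
  simp only [quadraticRules, List.forall_mem_cons]
  simp only [Holds, wordValue, listComb_cons, listComb_nil, letters, List.map_cons, List.map_nil,
    List.prod_cons, List.prod_nil, mul_one, one_smul, neg_smul, add_zero, Matrix.cons_val]
  refine ⟨hsq _ _ (by decide), hsq _ _ (by decide), ?_, ?_, hsq _ _ (by decide),
    hcomm _ _ _ _ (by decide), hsq _ _ (by decide), ?_, hcomm _ _ _ _ (by decide), ?_,
    hsq _ _ (by decide), hcomm _ _ _ _ (by decide), ?_, ?_, ?_, ?_, hsq _ _ (by decide),
    by simp⟩
  · rw [← h012]; abel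
  · rw [← h021]; simp only [neg_mul, mul_neg, neg_neg]; abel
  · rw [← h031]; simp only [neg_mul, mul_neg, neg_neg]; abel
  · rw [← h013]; simp only [neg_mul, mul_neg]; abel
  · rw [← h132]; simp only [neg_mul, mul_neg, neg_neg]; abel
  · rw [← h032]; simp only [neg_mul, mul_neg]; abel
  · rw [← h023]; simp only [neg_mul, mul_neg, neg_neg]; abel
  · rw [← h123]; simp only [neg_mul, mul_neg]; abel

/-- The completed system of rules. -/
def rules : List (RewriteRule 6) := quadraticRules ++ derivations.map Prod.fst

/-- Each derived rule may use the rules before it; 12 is the number of rounds of rewriting allowed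
in each check. -/
theorem resolvesAll_derivations : resolvesAll 12 quadraticRules derivations = true := by
  decide +kernel

theorem code_lt_of_mem_rules : ∀ ρ ∈ rules, ∀ t ∈ ρ.2, code t.2 < code ρ.1 := by
  decide +kernel

/-- Normal words have length at most 12, so the enumeration up to this length is complete. -/
theorem normalWords_rules : normalWords rules 13 = [] := by
  decide +kernel

theorem length_allNormalWords_rules : (allNormalWords rules 13).length = 576 := by
  decide +kernel

end DeformedFK

end

/-! ### The upper bound for the dimension and the conclusion -/

noncomputable section

namespace DeformedFK

open RewriteRule

variable {K : Type*} [Field K]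

/-- The generators, normalised such that their squares are `1`. -/
def normGen (r : K) (i j : Fin 4) : DeformedFK K 4 (r * r) (r * r) :=
  r⁻¹ • RingQuot.mkAlgHom K _ (FreeAlgebra.ι K (i, j))

theorem smul_mul_smul_eq_one {A : Type*} [Ring A] [Algebra K A] {r : K} (hr : r ≠ 0) {x : A}
    (h : x = algebraMap K A (r * r)) : (r⁻¹ * r⁻¹) • x = 1 := by
  rw [h, Algebra.algebraMap_eq_smul_one, smul_smul, ← mul_inv, inv_mul_cancel₀ (mul_ne_zero hr hr),
    one_smul]

theorem normGen_self (r : K) (i : Fin 4) : normGen r i i = 0 := by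
  rw [normGen, RingQuot.mkAlgHom_rel K (Rel.diag i), map_zero, smul_zero]

theorem normGen_symm (r : K) {i j : Fin 4} (h : i ≠ j) : normGen r j i = -normGen r i j := by
  rw [normGen, RingQuot.mkAlgHom_rel K (Rel.antisymm j i h.symm), map_neg, smul_neg, normGen]

theorem normGen_mul (r : K) (i j k l : Fin 4) : normGen r i j * normGen r k l
    = (r⁻¹ * r⁻¹) • RingQuot.mkAlgHom K (Rel K 4 (r * r) (r * r))
      (FreeAlgebra.ι K (i, j) * FreeAlgebra.ι K (k, l)) := by
  rw [normGen, normGen, smul_mul_smul_comm, map_mul]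

theorem normGen_sq {r : K} (hr : r ≠ 0) {i j : Fin 4} (h : i ≠ j) :
    normGen r i j * normGen r i j = 1 := by
  rw [normGen_mul]
  exact smul_mul_smul_eq_one hr
    ((RingQuot.mkAlgHom_rel K (Rel.sq i j h)).trans (AlgHom.commutes _ _))

theorem normGen_comm (r : K) {i j k l : Fin 4} (h : [i, j, k, l].Nodup) :
    normGen r i j * normGen r k l = normGen r k l * normGen r i j := by
  simp only [List.nodup_cons, List.mem_cons, List.not_mem_nil, or_false, not_or] at h
  obtain ⟨⟨hij, hik, hil⟩, ⟨hjk, hjl⟩, hkl, -⟩ := h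
  have := RingQuot.mkAlgHom_rel K
    (Rel.comm (α₁ := r * r) (α₂ := r * r) i j k l hij hik hil hjk hjl hkl)
  rw [map_sub, map_zero, sub_eq_zero] at this
  rw [normGen_mul, normGen_mul, this]

theorem normGen_cyclic {r : K} (hr : r ≠ 0) {i j k : Fin 4} (hij : i ≠ j) (hjk : j ≠ k)
    (hik : i ≠ k) : normGen r i j * normGen r j k + normGen r j k * normGen r k i
      + normGen r k i * normGen r i j = 1 := by
  rw [normGen_mul, normGen_mul, normGen_mul, ← smul_add, ← smul_add, ← map_add, ← map_add]
  exact smul_mul_smul_eq_one hr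
    ((RingQuot.mkAlgHom_rel K (Rel.cyclic i j k hij hjk hik)).trans (AlgHom.commutes _ _))

theorem normGen_mem_adjoin (r : K) (i j : Fin 4) :
    normGen r i j ∈ Algebra.adjoin K (Set.range (letters (normGen r))) := by
  have h (t : Fin 6) : letters (normGen r) t ∈ Algebra.adjoin K (Set.range (letters (normGen r))) :=
    Algebra.subset_adjoin ⟨t, rfl⟩
  have hs {i j : Fin 4} (hij : i ≠ j)
      (h : normGen r i j ∈ Algebra.adjoin K (Set.range (letters (normGen r)))) :
      normGen r j i ∈ Algebra.adjoin K (Set.range (letters (normGen r))) := by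
    rw [normGen_symm r hij]
    exact neg_mem h
  by_cases hij : i = j
  · rw [hij, normGen_self]
    exact zero_mem _
  · match i, j with
    | 0, 0 | 1, 1 | 2, 2 | 3, 3 => exact absurd rfl hij
    | 0, 1 => exact h 0
    | 1, 2 => exact h 1
    | 2, 0 => exact h 2
    | 0, 3 => exact h 3
    | 1, 3 => exact h 4
    | 2, 3 => exact h 5
    | 1, 0 => exact hs (by decide) (h 0)
    | 2, 1 => exact hs (by decide) (h 1)
    | 0, 2 => exact hs (by decide) (h 2)
    | 3, 0 => exact hs (by decide) (h 3)
    | 3, 1 => exact hs (by decide) (h 4)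
    | 3, 2 => exact hs (by decide) (h 5)

theorem adjoin_letters {r : K} (hr : r ≠ 0) :
    Algebra.adjoin K (Set.range (letters (normGen r))) = ⊤ := by
  have h : (Algebra.adjoin K (Set.range (FreeAlgebra.ι K (X := Fin 4 × Fin 4)))).map
      (RingQuot.mkAlgHom K (Rel K 4 (r * r) (r * r)))
      ≤ Algebra.adjoin K (Set.range (letters (normGen r))) := by
    rw [AlgHom.map_adjoin, Algebra.adjoin_le_iff]
    rintro _ ⟨_, ⟨⟨i, j⟩, rfl⟩, rfl⟩
    rw [← smul_inv_smul₀ hr (RingQuot.mkAlgHom K _ _)]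
    exact Subalgebra.smul_mem _ (normGen_mem_adjoin r i j) r
  rw [FreeAlgebra.adjoin_range_ι] at h
  rw [eq_top_iff]
  intro x _
  obtain ⟨y, rfl⟩ := RingQuot.mkAlgHom_surjective K _ x
  exact h ⟨y, trivial, rfl⟩

theorem span_wordValue {k : ℕ} {A : Type*} [Ring A] [Algebra K A] (v : Fin k → A) :
    Submodule.span K (Set.range (wordValue v))
      = (Algebra.adjoin K (Set.range v)).toSubmodule := by
  rw [Algebra.adjoin_eq_span]
  congr 1
  ext x
  constructor
  · rintro ⟨w, rfl⟩
    refine Submonoid.list_prod_mem _ fun y hy => ?_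
    obtain ⟨i, -, rfl⟩ := List.mem_map.1 hy
    exact Submonoid.subset_closure ⟨i, rfl⟩
  · intro hx
    induction hx using Submonoid.closure_induction with
    | mem _ h => obtain ⟨i, rfl⟩ := h; exact ⟨[i], by simp [wordValue]⟩
    | one => exact ⟨[], rfl⟩
    | mul _ _ _ _ h h' =>
      obtain ⟨u, rfl⟩ := h
      obtain ⟨w, rfl⟩ := h'
      exact ⟨u ++ w, wordValue_append u w⟩

theorem finite_and_finrank_le {r : K} (hr : r ≠ 0) :
    Module.Finite K (DeformedFK K 4 (r * r) (r * r)) ∧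
      Module.finrank K (DeformedFK K 4 (r * r) (r * r)) ≤ 576 := by
  rw [← length_allNormalWords_rules]
  refine RewriteRule.finite_and_finrank_le (v := letters (normGen r))
    (holds_of_resolvesAll (quadraticRules_holds (fun _ _ h => normGen_symm r h)
      (fun _ _ h => normGen_sq hr h) (fun _ _ _ _ h => normGen_comm r h)
      (fun _ _ _ h h' h'' => normGen_cyclic hr h h' h'')) resolvesAll_derivations)
    code_lt_of_mem_rules normalWords_rules ?_
  rw [span_wordValue, adjoin_letters hr, Algebra.top_toSubmodule]

end DeformedFK

/-- The deformed Fomin–Kirillov algebra is the algebra of matrices of size two over the cover of the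
presented algebra. -/
theorem CoverData.nonempty_deformedFK_algEquiv {K C : Type*} [Field K] [CharZero K] [Ring C]
    [Algebra K C] (D : CoverData K C) {r : K} (hr : r ≠ 0) :
    Nonempty (DeformedFK K 4 (r * r) (r * r) ≃ₐ[K] Matrix (Fin 2) (Fin 2) C) := by
  obtain ⟨hfin, hle⟩ := DeformedFK.finite_and_finrank_le hr
  have hsurj := D.ofDeformedFK_surjective hr
  have := D.finite
  have hrank : Module.finrank K (Matrix (Fin 2) (Fin 2) C) = 576 := by
    rw [Module.finrank_matrix, D.finrank_eq]
    rfl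
  -- The surjection bounds the dimension from below by 576 and the rewriting system bounds it from
  -- above, so the surjection is bijective.
  have h := LinearMap.finrank_le_finrank_of_surjective (f := (D.ofDeformedFK r).toLinearMap) hsurj
  have heq : Module.finrank K (DeformedFK K 4 (r * r) (r * r))
      = Module.finrank K (Matrix (Fin 2) (Fin 2) C) := by lia
  have hinj := (LinearMap.injective_iff_surjective_of_finrank_eq_finrank
    (f := (D.ofDeformedFK r).toLinearMap) heq).2 hsurj
  exact ⟨AlgEquiv.ofBijective _ ⟨hinj, hsurj⟩⟩

end

theorem corollary3p12 {K : Type u} [Field K] [IsAlgClosed K] [CharZero K] (α : K) (hα : α ≠ 0)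
    {B : Type u} [Ring B] [Algebra K B] (hB : IsBasicAlgebra K B)
    (hM : IsMoritaEquivalent K (DeformedFK K 4 α α) B)
    (e : B) (he : IsPrimitiveIdempotent e) :
    ∃ (Q : QuiverRealization K e) (Φ : GrPresentation K ≃ₗ[K] GrProj K e),
      ∀ w : List (Fin 3),
        Φ (GrPresentation.monomial K w) = grClass K e w.length (Q.path 1 w) (Q.path_mem w) := by
  -- Algebraic closedness provides the square root of `α` that normalises the generators.
  obtain ⟨r, rfl⟩ := IsAlgClosed.exists_eq_mul_self α
  have hr : r ≠ 0 := fun h => hα (by rw [h, mul_zero])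
  obtain ⟨C, _, _, ⟨D⟩⟩ : ∃ (C : Type u) (_ : Ring C) (_ : Algebra K C), Nonempty (CoverData K C) :=
    ⟨GrCover.Cover K, inferInstance, inferInstance, ⟨GrCover.coverData K⟩⟩
  obtain ⟨f⟩ := D.nonempty_deformedFK_algEquiv hr
  have hA : IsMoritaEquivalent K (DeformedFK K 4 (r * r) (r * r)) (Matrix (Fin 2) (Fin 2) C) :=
    IsMoritaEquivalent.of_algEquiv K f
  have hC : IsMoritaEquivalent K C (Matrix (Fin 2) (Fin 2) C) := IsMoritaEquivalent.matrix C K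
  -- `B` is Morita equivalent to the matrix algebra and hence to `C`; both are basic, so they are
  -- isomorphic and the cover data can be transported to `B`.
  obtain ⟨g⟩ := hB.nonempty_algEquiv_of_isMoritaEquivalent D.isBasicAlgebra
    ((hM.symm.trans K hA).trans K hC.symm)
  exact (D.map g.symm).exists_quiverRealization he
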